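/- Let $(V,\omega_0)$ be a real symplectic vector space of dimension $2n$, $n\ge 0$, let $\theta>0$ and $\varepsilon\in\{1,-1\}$. Let $\mathbb S=\mathbb R\times V\times\mathbb R=\{(a,x,\ell)\}$ be the elementary normal $j$-group with law $$(a,x,\ell)\cdot(a',x',\ell')=\big(a+a',\,e^{-a'}x+x',\,e^{-2a'}\ell+\ell'+\tfrac12e^{-a'}\omega_0(x,x')\big),$$ Lie algebra $\mathfrak s=\mathbb RH\oplus V\oplus\mathbb RE$ and left Haar measure $dg=da\,dx\,d\ell$ ($dx$ the Liouville measure of $\omega_0$). For $X\in\mathfrak s$ let $\tilde X$ be the left-invariant vector field, extended to $P\mapsto\tilde P$ on the enveloping algebra $\mathcal U(\mathfrak s)$, and let $\alpha_H=2\ell$, $\alpha_y=\cosh(a)\,\omega_0(y,x)$ $(y\in V)$, $\alpha_E=-\sinh(2a)$. For a basis $(e_i)$ of $V$ and $j\in\mathbb N^{2n+2}$ put $\alpha^j=\alpha_H^{j_1}\alpha_{e_1}^{j_2}\cdots\alpha_{e_{2n}}^{j_{2n+1}}\alpha_E^{j_{2n+2}}$. The Schwartz space $\mathcal S(\mathbb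 S)$ is the space of $f\in C^\infty(\mathbb S,\mathbb C)$ all of whose seminorms $\sup_g|\alpha^j(g)\,\tilde Pf(g)|$ are finite, with the topology of these seminorms. Let $\mathcal S(A)=\{a\mapsto F(\sinh 2a): F\in\mathcal S(\mathbb R)\}$ with the topology of $\mathcal S(\mathbb R)$, and let $\mathcal S(\mathbb R^{2n+1})=\mathcal S(V\times\mathbb R)$ be the usual Schwartz space of functions of $(x,\ell)$. The star-product is $$(f_1\star_\theta f_2)(g)=\frac1{(\pi\theta)^{2n+2}}\int K(g,g_1,g_2)\,e^{-\frac{2i}\theta S(g,g_1,g_2)}f_1(g_1)f_2(g_2)\,dg_1\,dg_2,$$ where, with $g=(a,x,\ell)$ and $g_i=(a_i,x_i,\ell_i)$, $$K=4\sqrt{\cosh 2(a_1-a_2)\cosh 2(a_1-a)\cosh 2(a-a_2)}\;\cosh(a_2-a)^n\cosh(a_1-a)^n\cosh(a_1-a_2)^n,$$ $$\begin{aligned}\varepsilon S=&-\sinh(2(a_1-a_2))\ell-\sinh(2(a_2-a))\ell_1-\sinh(2(a-a_1))\ell_2+\cosh(a_1-a)\cosh(a_2-a)\,\omega_0(x_1,x_2)\\&+\cosh(a_1-a)\cosh(a_1-a_2)\,\omega_0(x_2,x)+\cosh(a_1-a_2)\cosh(a_2-a)\,\omega_0(x,x_1).\end{aligned}$$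 It is understood as an oscillatory integral in the coordinates $(r=\sinh 2a,x,\ell)$: for every Schwartz function $\chi$ of $(r_1,x_1,\ell_1,r_2,x_2,\ell_2)$ with $\chi(0)=1$, one inserts $\chi(\delta\,\cdot\,)$ into the integral, which must then converge absolutely for all $\delta>0$, and lets $\delta\to0^+$; the limit must exist and not depend on $\chi$. **Proposition (Factorization).** The map $f\otimes h\mapsto\big((a,x,\ell)\mapsto f(a)h(x,\ell)\big)$ induces an isomorphism of topological vector spaces $\mathcal S(A)\hat\otimes\mathcal S(\mathbb R^{2n+1})\cong\mathcal S(\mathbb S)$ (completed projective tensor product). With this identification, for all $f\in\mathcal S(A)$ and $h\in\mathcal S(\mathbb R^{2n+1})$ the function $f\star_\theta h$, where $f$ and $h$ are regarded as functions on $\mathbb S$, is defined at every point, and there is exactly one continuous linear map $\Phi:\mathcal S(\mathbb S)\to\mathcal S(\mathbb S)$ with $\Phi(f\otimes h)=f\star_\theta h$ for all such $f,h$; it is a linear homeomorphism. Explicitly, write $\hat\varphi(a,x,\xi)=\int_{\mathbb R}e^{-i\ell\xi}\varphi(a,x,\ell)\,d\ell$ and, for $\sigma=\pm1$, let $a_\sigma(a,\xi)$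 be the real number with $$\sinh(2a_\sigma(a,\xi))=r\sqrt{1+\tfrac{\theta^2\xi^2}4}+\tfrac{\sigma\theta\xi}2\sqrt{1+r^2},\qquad r=\sinh 2a .$$ Then for all $\varphi\in\mathcal S(\mathbb S)$ $$\Phi(\varphi)(a,x,\ell)=\frac1{2\pi}\int_{\mathbb R}\hat\varphi\big(a_\varepsilon(a,\xi),x,\xi\big)e^{i\ell\xi}\,d\xi,\qquad \Phi^{-1}(\varphi)(a,x,\ell)=\frac1{2\pi}\int_{\mathbb R}\hat\varphi\big(a_{-\varepsilon}(a,\xi),x,\xi\big)e^{i\ell\xi}\,d\xi .$$ -/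

import Mathlib

open MeasureTheory Filter Topology
open scoped SchwartzMap ContDiff TensorProduct

noncomputable section

/-! ## The completed projective tensor product of two topological vector spaces -/

section ProjectiveTensor

variable (E F : Type*) [AddCommGroup E] [Module ℂ E] [TopologicalSpace E]
  [AddCommGroup F] [Module ℂ F] [TopologicalSpace F]

/-- The algebraic tensor product `E ⊗ F`, to be equipped with the projective topology. -/
def ProjTensor : Type _ := E ⊗[ℂ] F

instance : AddCommGroup (ProjTensor E F) := inferInstanceAs (AddCommGroup (E ⊗[ℂ] F))
instance : Module ℂ (ProjTensor E F) := inferInstanceAs (Module ℂ (E ⊗[ℂ] F))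

variable {E F} in
/-- The pure tensor `x ⊗ y`. -/
def ProjTensor.tmul (x : E) (y : F) : ProjTensor E F := (x ⊗ₜ[ℂ] y : E ⊗[ℂ] F)

/-- The seminorms `s` on `E ⊗ F` with `s (x ⊗ y) ≤ p x * q y` for some continuous seminorms
`p` on `E` and `q` on `F`. They define the projective topology. -/
def ProjIndex : Type _ :=
  {s : Seminorm ℂ (ProjTensor E F) // ∃ (p : Seminorm ℂ E) (q : Seminorm ℂ F),
    Continuous p ∧ Continuous q ∧ ∀ x y, s (ProjTensor.tmul x y) ≤ p x * q y}

instance : Nonempty (ProjIndex E F) :=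
  ⟨⟨0, 0, 0, continuous_const, continuous_const, fun _ _ => by simp⟩⟩

/-- The family of all seminorms defining the projective topology. -/
def projSeminormFamily : SeminormFamily ℂ (ProjTensor E F) (ProjIndex E F) := fun s => s.1

instance : TopologicalSpace (ProjTensor E F) := (projSeminormFamily E F).moduleFilterBasis.topology

theorem projTensor_withSeminorms : WithSeminorms (projSeminormFamily E F) := ⟨rfl⟩

instance : IsTopologicalAddGroup (ProjTensor E F) :=
  (projTensor_withSeminorms E F).topologicalAddGroup

instance : ContinuousSMul ℂ (ProjTensor E F) :=
  (projTensor_withSeminorms E F).continuousSMul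

instance : UniformSpace (ProjTensor E F) := IsTopologicalAddGroup.rightUniformSpace _

instance : IsUniformAddGroup (ProjTensor E F) := isUniformAddGroup_of_addCommGroup

instance : UniformContinuousConstSMul ℂ (ProjTensor E F) :=
  uniformContinuousConstSMul_of_continuousConstSMul ℂ _

/-- The completed projective tensor product `E ⊗̂ F`. -/
abbrev CompletedTensor : Type _ := UniformSpace.Completion (ProjTensor E F)

variable {E F} in
/-- The image of the pure tensor `x ⊗ y` in `E ⊗̂ F`. -/
def CompletedTensor.tmul (x : E) (y : F) : CompletedTensor E F :=
  ((ProjTensor.tmul x y : ProjTensor E F) : UniformSpace.Completion (ProjTensor E F))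

end ProjectiveTensor

/-! ## Elementary normal j-groups -/

section Group

variable {V : Type*} [NormedAddCommGroup V] [NormedSpace ℝ V]

variable (V) in
/-- The manifold `ℝ × V × ℝ = {(a, x, ℓ)}` underlying the elementary normal j-group. The same type
is used for its Lie algebra `ℝH ⊕ V ⊕ ℝE`, with `(h, y, e)` standing for `hH + y + eE`. -/
abbrev JGroup : Type _ := ℝ × V × ℝ

/-- The group law of the elementary normal j-group of the symplectic space `(V, ω₀)`. -/
def jmul (ω₀ : LinearMap.BilinForm ℝ V) (g g' : JGroup V) : JGroup V :=
  (g.1 + g'.1,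
   Real.exp (-g'.1) • g.2.1 + g'.2.1,
   Real.exp (-2 * g'.1) * g.2.2 + g'.2.2 + 1 / 2 * Real.exp (-g'.1) * ω₀ g.2.1 g'.2.1)

/-- The value at `g` of the left-invariant vector field `X̃` of the Lie algebra element `X`:
the velocity at `t = 0` of `g · (tX)`, where `t ↦ tX` is a curve through the unit with
velocity `X`. -/
def leftField (ω₀ : LinearMap.BilinForm ℝ V) (X g : JGroup V) : JGroup V :=
  deriv (fun t : ℝ => jmul ω₀ g (t • X)) 0

/-- Explicitly, `H̃ = ∂ₐ - x∂ₓ - 2ℓ∂_ℓ`, `ỹ = ∂_y + ½ω₀(x,y)∂_ℓ` and `Ẽ = ∂_ℓ`. -/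
theorem leftField_eq (ω₀ : LinearMap.BilinForm ℝ V) (X g : JGroup V) :
    leftField ω₀ X g = (X.1, X.2.1 - X.1 • g.2.1,
      X.2.2 - 2 * X.1 * g.2.2 + 1 / 2 * ω₀ g.2.1 X.2.1) := by
  obtain ⟨h, y, e⟩ := X
  obtain ⟨a, x, l⟩ := g
  have hexp : ∀ c : ℝ, HasDerivAt (fun t : ℝ => Real.exp (c * t)) c 0 := fun c => by
    simpa using ((hasDerivAt_id (0 : ℝ)).const_mul c).exp
  have h1 : HasDerivAt (fun t : ℝ => a + t * h) h 0 := by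
    simpa using ((hasDerivAt_id (0 : ℝ)).mul_const h).const_add a
  have h2 : HasDerivAt (fun t : ℝ => Real.exp (-h * t) • x + t • y) (y - h • x) 0 := by
    have := ((hexp (-h)).smul_const x).add ((hasDerivAt_id (0 : ℝ)).smul_const y)
    exact this.congr_deriv (by rw [one_smul, neg_smul, sub_eq_neg_add])
  have h3 : HasDerivAt (fun t : ℝ => Real.exp (-2 * h * t) * l + t * e
      + 1 / 2 * Real.exp (-h * t) * (t * ω₀ x y)) (e - 2 * h * l + 1 / 2 * ω₀ x y) 0 := by
    have := (((hexp (-2 * h)).mul_const l).add ((hasDerivAt_id (0 : ℝ)).mul_const e)).add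
      (((hexp (-h)).const_mul (1 / 2)).mul ((hasDerivAt_id (0 : ℝ)).mul_const (ω₀ x y)))
    exact this.congr_deriv (by simp; ring)
  have := h1.prodMk (h2.prodMk h3)
  refine Eq.trans ?_ this.deriv
  unfold leftField jmul
  congr 1
  funext t
  have e1 : -2 * (t * h) = -2 * h * t := by ring
  have e2 : -(t * h) = -h * t := by ring
  simp [e1, e2]

variable (V) in
/-- The smooth complex-valued functions on the group. -/
def SmoothFn : Submodule ℂ (JGroup V → ℂ) where
  carrier := {f | ContDiff ℝ ∞ f}
  add_mem' {f f'} (hf : ContDiff ℝ ∞ f) (hf' : ContDiff ℝ ∞ f') :=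
    show ContDiff ℝ ∞ (f + f') from hf.add hf'
  zero_mem' := show ContDiff ℝ ∞ (fun _ : JGroup V => (0 : ℂ)) from contDiff_const
  smul_mem' c f (hf : ContDiff ℝ ∞ f) := show ContDiff ℝ ∞ (c • f) from hf.const_smul c

theorem SmoothFn.contDiff (f : SmoothFn V) : ContDiff ℝ ∞ f.1 := f.2

variable [FiniteDimensional ℝ V]

theorem leftField_contDiff (ω₀ : LinearMap.BilinForm ℝ V) (X : JGroup V) :
    ContDiff ℝ ∞ (leftField ω₀ X) := by
  have hω : ContDiff ℝ ∞ (fun x : V => ω₀ x X.2.1) :=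
    (LinearMap.toContinuousLinearMap (ω₀.flip X.2.1)).contDiff
  rw [funext (leftField_eq ω₀ X)]
  have := hω.comp (contDiff_fst.comp (contDiff_snd (E := ℝ) (F := V × ℝ)) : ContDiff ℝ ∞ _)
  simp only [Function.comp_def] at this
  fun_prop

/-- The left-invariant vector field of `X`, acting on smooth functions. -/
def leftInv (ω₀ : LinearMap.BilinForm ℝ V) (X : JGroup V) : SmoothFn V →ₗ[ℂ] SmoothFn V where
  toFun f := ⟨fun g => fderiv ℝ f.1 g (leftField ω₀ X g),
    ContDiff.clm_apply ((SmoothFn.contDiff f).fderiv_right (m := ∞) (by simp)) (leftField_contDiff ω₀ X)⟩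
  map_add' f f' := by
    ext g
    have h1 : DifferentiableAt ℝ f.1 g := ((SmoothFn.contDiff f).differentiable (by simp)) g
    have h2 : DifferentiableAt ℝ f'.1 g := ((SmoothFn.contDiff f').differentiable (by simp)) g
    simp [fderiv_add h1 h2]
  map_smul' c f := by
    ext g
    have h1 : DifferentiableAt ℝ f.1 g := ((SmoothFn.contDiff f).differentiable (by simp)) g
    simp [fderiv_const_smul h1 c]

/-- The left-invariant differential operator `P̃ = X̃₁ ⋯ X̃ₖ` of the monomial `P = X₁ ⋯ Xₖ` in the
universal enveloping algebra of the Lie algebra. Such monomials span the enveloping algebra. -/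
def leftInvWord (ω₀ : LinearMap.BilinForm ℝ V) (P : List (JGroup V)) :
    SmoothFn V →ₗ[ℂ] SmoothFn V :=
  P.foldr (fun X T => leftInv ω₀ X ∘ₗ T) LinearMap.id

/-- The functions `α_X`, given by `α_H = 2ℓ`, `α_y = cosh(a) ω₀(y, x)`, `α_E = -sinh(2a)`. -/
def alphaFn (ω₀ : LinearMap.BilinForm ℝ V) (X g : JGroup V) : ℝ :=
  X.1 * (2 * g.2.2) + Real.cosh g.1 * ω₀ X.2.1 g.2.1 + X.2.2 * (-Real.sinh (2 * g.1))

variable (V) in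
/-- Multi-indices for the powers of `α_H`, of the `α_{e_i}` (for a basis `(e_i)` of `V`) and of
`α_E`. -/
abbrev AlphaIndex : Type := ℕ × (Fin (Module.finrank ℝ V) → ℕ) × ℕ

/-- The product `α^j = α_H^{j₁} ∏ᵢ α_{e_i}^{j_{i+1}} α_E^{j_last}`. -/
def alphaPow (ω₀ : LinearMap.BilinForm ℝ V) (j : AlphaIndex V) (g : JGroup V) : ℝ :=
  alphaFn ω₀ (1, 0, 0) g ^ j.1
    * (∏ i, alphaFn ω₀ (0, Module.finBasis ℝ V i, 0) g ^ j.2.1 i)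
    * alphaFn ω₀ (0, 0, 1) g ^ j.2.2

/-- The function `α^j · P̃ f`. -/
def weighted (ω₀ : LinearMap.BilinForm ℝ V) (j : AlphaIndex V) (P : List (JGroup V)) :
    SmoothFn V →ₗ[ℂ] (JGroup V → ℂ) where
  toFun f g := (alphaPow ω₀ j g : ℂ) * (leftInvWord ω₀ P f).1 g
  map_add' f f' := by ext g; simp [mul_add]
  map_smul' c f := by ext g; simp [mul_left_comm]

/-! ## The Schwartz space of the elementary normal j-group -/

/-- The Schwartz functions on the group, as a subspace of the smooth functions. -/
def schwartzSub (ω₀ : LinearMap.BilinForm ℝ V) : Submodule ℂ (SmoothFn V) where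
  carrier := {f | ∀ j P, BddAbove (Set.range fun g => ‖weighted ω₀ j P f g‖)}
  add_mem' {f f'} hf hf' j P := by
    obtain ⟨C, hC⟩ := hf j P
    obtain ⟨C', hC'⟩ := hf' j P
    refine ⟨C + C', ?_⟩
    rintro _ ⟨g, rfl⟩
    simp only [map_add, Pi.add_apply]
    exact (norm_add_le _ _).trans (add_le_add (hC ⟨g, rfl⟩) (hC' ⟨g, rfl⟩))
  zero_mem' j P := ⟨0, by rintro _ ⟨g, rfl⟩; simp⟩
  smul_mem' c f hf j P := by
    obtain ⟨C, hC⟩ := hf j P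
    refine ⟨‖c‖ * C, ?_⟩
    rintro _ ⟨g, rfl⟩
    simp only [map_smul, Pi.smul_apply, norm_smul]
    exact mul_le_mul_of_nonneg_left (hC ⟨g, rfl⟩) (norm_nonneg c)

/-- The Schwartz space of the elementary normal j-group of `(V, ω₀)`. -/
def SchwartzS (ω₀ : LinearMap.BilinForm ℝ V) : Type _ := schwartzSub ω₀

variable (ω₀ : LinearMap.BilinForm ℝ V)

instance : AddCommGroup (SchwartzS ω₀) := inferInstanceAs (AddCommGroup (schwartzSub ω₀))
instance : Module ℂ (SchwartzS ω₀) := inferInstanceAs (Module ℂ (schwartzSub ω₀))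
instance : CoeFun (SchwartzS ω₀) (fun _ => JGroup V → ℂ) := ⟨fun f => f.1.1⟩

/-- The seminorm `‖f‖_{j,P} = sup_g |α^j(g) P̃f(g)|`. -/
def schwartzSSeminorm (j : AlphaIndex V) (P : List (JGroup V)) : Seminorm ℂ (SchwartzS ω₀) :=
  Seminorm.of (fun f => ⨆ g, ‖weighted ω₀ j P f.1 g‖)
    (fun f f' => by
      refine ciSup_le fun g => ?_
      have h : weighted ω₀ j P (f + f').1 = weighted ω₀ j P f.1 + weighted ω₀ j P f'.1 :=
        map_add _ f.1 f'.1
      rw [h]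
      exact (norm_add_le _ _).trans (add_le_add (le_ciSup (f.2 j P) g) (le_ciSup (f'.2 j P) g)))
    (fun c f => by
      have h : weighted ω₀ j P (c • f).1 = c • weighted ω₀ j P f.1 := map_smul _ c f.1
      simp only [h, Pi.smul_apply, norm_smul]
      exact (Real.mul_iSup_of_nonneg (norm_nonneg c) _).symm)

/-- The family of seminorms defining the topology of the Schwartz space. -/
def schwartzSFamily :
    SeminormFamily ℂ (SchwartzS ω₀) (AlphaIndex V × List (JGroup V)) :=
  fun i => schwartzSSeminorm ω₀ i.1 i.2

instance : TopologicalSpace (SchwartzS ω₀) := (schwartzSFamily ω₀).moduleFilterBasis.topology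

end Group

/-! ## The Schwartz space of `A` -/

/-- The pull-back `γ^*` by `γ(a) = sinh(2a)`. -/
def gammaPullback : 𝓢(ℝ, ℂ) →ₗ[ℂ] (ℝ → ℂ) where
  toFun F a := F (Real.sinh (2 * a))
  map_add' _ _ := rfl
  map_smul' _ _ := rfl

/-- The space `𝓢(A) = γ^* 𝓢(ℝ)` of functions of `a`. -/
def SchwartzA : Type := LinearMap.range gammaPullback

instance : AddCommGroup SchwartzA := inferInstanceAs (AddCommGroup (LinearMap.range gammaPullback))
instance : Module ℂ SchwartzA := inferInstanceAs (Module ℂ (LinearMap.range gammaPullback))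
instance : CoeFun SchwartzA (fun _ => ℝ → ℂ) := ⟨fun f => f.1⟩

/-- The topology of `𝓢(A)` is the one of `𝓢(ℝ)`, transported by the bijection `γ^*`. -/
instance : TopologicalSpace SchwartzA :=
  TopologicalSpace.coinduced (fun F : 𝓢(ℝ, ℂ) => (gammaPullback.rangeRestrict F : SchwartzA))
    inferInstance

/-! ## The star-product -/

section StarProduct

variable {V : Type*} [NormedAddCommGroup V] [NormedSpace ℝ V] [FiniteDimensional ℝ V]
  [MeasurableSpace V] [BorelSpace V]

/-- The Liouville measure of the symplectic space `(V, ω₀)`: the Lebesgue measure of volume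
`√|det ω₀(bᵢ, bⱼ)|` on the parallelepiped of a basis `b`, i.e. of volume `1` on the
parallelepiped of a symplectic basis. -/
def liouville (ω₀ : LinearMap.BilinForm ℝ V) : Measure V :=
  ENNReal.ofReal (Real.sqrt |(Matrix.of fun i j =>
      ω₀ (Module.finBasis ℝ V i) (Module.finBasis ℝ V j)).det|)
    • (Module.finBasis ℝ V).addHaar

/-- The left Haar measure `da dx dℓ` of the group. -/
def haarS (ω₀ : LinearMap.BilinForm ℝ V) : Measure (JGroup V) :=
  (volume : Measure ℝ).prod ((liouville ω₀).prod (volume : Measure ℝ))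

/-- The amplitude of the star-product, with `dim V = 2n`. -/
def starAmp (n : ℕ) (g g₁ g₂ : JGroup V) : ℝ :=
  4 * Real.sqrt (Real.cosh (2 * (g₁.1 - g₂.1)) * Real.cosh (2 * (g₁.1 - g.1))
      * Real.cosh (2 * (g.1 - g₂.1)))
    * Real.cosh (g₂.1 - g.1) ^ n * Real.cosh (g₁.1 - g.1) ^ n * Real.cosh (g₁.1 - g₂.1) ^ n

/-- The phase of the star-product, for the coadjoint orbit of sign `ε = ±1`. -/
def starPhase (ω₀ : LinearMap.BilinForm ℝ V) (ε : ℝ) (g g₁ g₂ : JGroup V) : ℝ :=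
  ε * (-Real.sinh (2 * (g₁.1 - g₂.1)) * g.2.2 - Real.sinh (2 * (g₂.1 - g.1)) * g₁.2.2
    - Real.sinh (2 * (g.1 - g₁.1)) * g₂.2.2
    + Real.cosh (g₁.1 - g.1) * Real.cosh (g₂.1 - g.1) * ω₀ g₁.2.1 g₂.2.1
    + Real.cosh (g₁.1 - g.1) * Real.cosh (g₁.1 - g₂.1) * ω₀ g₂.2.1 g.2.1
    + Real.cosh (g₁.1 - g₂.1) * Real.cosh (g₂.1 - g.1) * ω₀ g.2.1 g₁.2.1)

/-- The coordinates `(r, x, ℓ)` with `r = sinh(2a)`. -/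
def rCoord (g : JGroup V) : JGroup V := (Real.sinh (2 * g.1), g.2.1, g.2.2)

/-- The integrand of the star-product `(f₁ ⋆ f₂)(g)`, as a function of `(g₁, g₂)`. -/
def starIntegrand (ω₀ : LinearMap.BilinForm ℝ V) (θ ε : ℝ) (n : ℕ) (f₁ f₂ : JGroup V → ℂ)
    (g : JGroup V) (p : JGroup V × JGroup V) : ℂ :=
  (starAmp n g p.1 p.2 : ℂ)
    * Complex.exp (-(2 * Complex.I / (θ : ℂ)) * (starPhase ω₀ ε g p.1 p.2 : ℂ))
    * f₁ p.1 * f₂ p.2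

/-- `HasStarProduct ω₀ θ ε n f₁ f₂ g z`: the integral
`(πθ)^{-(2n+2)} ∫∫ K(g,g₁,g₂) e^{-(2i/θ) S(g,g₁,g₂)} f₁(g₁) f₂(g₂) dg₁ dg₂`
defining `(f₁ ⋆_θ f₂)(g)` exists as an oscillatory integral in the coordinates `(r, x, ℓ)` and has
the value `z`: for every Schwartz function `χ` with `χ(0) = 1`, the integral with the additional
factor `χ(δ · (r₁, x₁, ℓ₁, r₂, x₂, ℓ₂))` converges absolutely for all `δ > 0`, and tends to `z` as
`δ → 0`. -/
def HasStarProduct (ω₀ : LinearMap.BilinForm ℝ V) (θ ε : ℝ) (n : ℕ) (f₁ f₂ : JGroup V → ℂ)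
    (g : JGroup V) (z : ℂ) : Prop :=
  ∀ χ : 𝓢(JGroup V × JGroup V, ℂ), χ 0 = 1 →
    (∀ δ : ℝ, 0 < δ → Integrable
      (fun p => starIntegrand ω₀ θ ε n f₁ f₂ g p * χ (δ • (rCoord p.1, rCoord p.2)))
      ((haarS ω₀).prod (haarS ω₀))) ∧
    Tendsto (fun δ : ℝ => 1 / ((Real.pi * θ : ℝ) : ℂ) ^ (2 * n + 2) *
        ∫ p, starIntegrand ω₀ θ ε n f₁ f₂ g p * χ (δ • (rCoord p.1, rCoord p.2))
          ∂((haarS ω₀).prod (haarS ω₀)))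
      (𝓝[>] 0) (𝓝 z)

/-! ## Partial Fourier transform -/

/-- The partial Fourier transform `φ̂(a, x, ξ) = ∫ e^{-iℓξ} φ(a, x, ℓ) dℓ`. -/
def partialFourier (φ : JGroup V → ℂ) (a : ℝ) (x : V) (ξ : ℝ) : ℂ :=
  ∫ l : ℝ, Complex.exp (-(Complex.I * (l : ℂ) * (ξ : ℂ))) * φ (a, x, l)

/-- The point `a'` with
`sinh(2a') = r √(1 + θ²ξ²/4) + ε (θξ/2) √(1 + r²)`, where `r = sinh(2a)`. -/
def shiftA (θ ε a ξ : ℝ) : ℝ :=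
  Real.arsinh (Real.sinh (2 * a) * Real.sqrt (1 + θ ^ 2 * ξ ^ 2 / 4)
    + ε * θ * ξ / 2 * Real.sqrt (1 + Real.sinh (2 * a) ^ 2)) / 2

/-- The function `(1/2π) ∫ φ̂(a', x, ξ) e^{iℓξ} dξ` of `(a, x, ℓ)`, with `a' = shiftA θ ε a ξ`. -/
def twist (θ ε : ℝ) (φ : JGroup V → ℂ) (g : JGroup V) : ℂ :=
  1 / (2 * (Real.pi : ℂ)) *
    ∫ ξ : ℝ, partialFourier φ (shiftA θ ε g.1 ξ) g.2.1 ξ *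
      Complex.exp (Complex.I * (g.2.2 : ℂ) * (ξ : ℂ))

end StarProduct

end

/-!
The proof passes to the coordinates `(r, x, ℓ)` with `r = sinh 2a`, in which all the Schwartz spaces
become ordinary ones.

*The function space.* Composition with `rCoord` is an isomorphism from the Schwartz space of
`ℝ × V × ℝ` onto `𝓢(𝕊)` (`coordEquiv`). In one direction, the left-invariant fields and the weights
`α` have coefficients of polynomial growth in these coordinates. In the other direction, the weights
control the coordinates because `ω₀` is nondegenerate (`exists_norm_rCoord_le`), and the
left-invariant fields form a moving frame whose dual frame has temperate growth
(`fderiv_toCoordFn`), so that all derivatives are controlled by induction on the order.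

*The tensor product.* The isomorphism `𝓢(ℝ) ⊗̂ 𝓢(W) ≅ 𝓢(ℝ × W)` (`completedTensorEquiv`) rests on a
Gabor expansion in the first variable: a smooth partition of unity cuts a function of `(s, w)` into
pieces supported in intervals of length less than one, and Poisson summation expands each piece into
a Fourier series. The expansion writes `F` as a sum of pure tensors, with atoms that grow
polynomially and coefficients that decrease rapidly in every continuous seminorm
(`exists_seminorm_atom_mul_coeff_le`). Hence a projective seminorm of a tensor is bounded by a
continuous seminorm of the function it defines, the algebraic tensor product embeds topologically
with dense image, and completeness of the Schwartz space finishes the argument.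

*The operator.* For `ε = ±1` the map `r = sinh u ↦ sinh(u + εv)`, with `sinh v = θξ/2`, is a
diffeomorphism of temperate growth in `(r, ξ)`, with inverse given by `-ε`. Conjugating it with the
Fourier transform in `ℓ` gives the isomorphism `twistEquiv`, which is `twist` in the group
coordinates (`twistCLM_apply`).

*The star-product.* Let the first factor depend on `a₁` only, and the second one on `(x₂, ℓ₂)` only.
The phase is affine in `(x₁, ℓ₁)`, so that the integral over these variables produces a symplectic
Fourier transform of the cut-off function, at a point which is `δ⁻¹` times a function of `(a₂, x₂)`
(`integral_starIntegrand_inner`). Taking this point as the new integration variable in place of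
`(a₂, x₂)` removes all negative powers of `δ` (`integral_starReduced_fiber`), and the integrand is
dominated uniformly in `δ` (`exists_norm_starRescaled_le`). In the limit `(a₂, x₂)` is frozen at
`(a, x)`, and the Fourier transform of the cut-off integrates to `χ 0 = 1`
(`integral_starRescaled_zero`). The remaining integral over `(a₁, ℓ₂)` is the twist of the tensor
product, by the substitution `ξ = (2ε/θ) sinh(2(a₁ - a))` (`twist_eq_integral`).

Uniqueness of the operator holds because pure tensors span a dense subspace
(`CompletedTensor.ext_of_tmul`).
-/

/-! ### Completeness of the Schwartz space -/

section SchwartzComplete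

variable {E F : Type*} [NormedAddCommGroup E] [NormedSpace ℝ E]
  [NormedAddCommGroup F] [NormedSpace ℝ F]

theorem SchwartzMap.seminorm_sub_lt_of_cauchySeq {u : ℕ → 𝓢(E, F)} (hu : CauchySeq u) (k n : ℕ)
    {ε : ℝ} (hε : 0 < ε) :
    ∃ N, ∀ i ≥ N, ∀ j ≥ N, SchwartzMap.seminorm ℝ k n (u i - u j) < ε := by
  have h : Tendsto (fun p : ℕ × ℕ => u p.2 - u p.1) atTop (𝓝 0) := by
    have := cauchySeq_iff_tendsto.1 hu
    rw [uniformity_eq_comap_nhds_zero, tendsto_comap_iff] at this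
    exact this
  rw [(schwartz_withSeminorms ℝ E F).tendsto_nhds] at h
  obtain ⟨⟨a, b⟩, hab⟩ := eventually_atTop.1 (h (k, n) ε hε)
  refine ⟨max a b, fun i hi j hj => ?_⟩
  have := hab (j, i) ⟨(le_max_left _ _).trans hj, (le_max_right _ _).trans hi⟩
  simpa [SchwartzMap.schwartzSeminormFamily_apply] using this

/-- A Cauchy sequence of Schwartz functions converges: all derivatives converge uniformly, so that
their limits are the derivatives of the limit. -/
theorem SchwartzMap.exists_tendsto_of_cauchySeq [CompleteSpace F] {u : ℕ → 𝓢(E, F)}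
    (hu : CauchySeq u) : ∃ f, Tendsto u atTop (𝓝 f) := by
  -- the Cauchy property, uniformly in `x` for each weighted derivative
  have key : ∀ (k n : ℕ) (ε : ℝ), 0 < ε → ∃ N, ∀ i ≥ N, ∀ j ≥ N, ∀ x,
      ‖x‖ ^ k * ‖iteratedFDeriv ℝ n (u i) x - iteratedFDeriv ℝ n (u j) x‖ < ε := by
    intro k n ε hε
    obtain ⟨N, hN⟩ := SchwartzMap.seminorm_sub_lt_of_cauchySeq hu k n hε
    refine ⟨N, fun i hi j hj x => lt_of_le_of_lt ?_ (hN i hi j hj)⟩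
    have h1 := SchwartzMap.le_seminorm ℝ k n (u i - u j) x
    have h2 : ⇑(u i - u j) = ⇑(u i) - ⇑(u j) := by ext; simp
    rwa [h2, iteratedFDeriv_sub ((u i).smooth n) ((u j).smooth n)] at h1
  have hC : ∀ n x, CauchySeq fun i => iteratedFDeriv ℝ n (u i) x := by
    intro n x
    rw [Metric.cauchySeq_iff]
    intro ε hε
    obtain ⟨N, hN⟩ := key 0 n ε hε
    refine ⟨N, fun i hi j hj => ?_⟩
    simpa [dist_eq_norm] using hN i hi j hj x
  -- `p n` is the pointwise limit of the `n`-th derivatives; it is the candidate for the `n`-th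
  -- derivative of the limit
  choose p hp using fun n x => cauchySeq_tendsto_of_complete (hC n x)
  -- letting `j → ∞` in `key`
  have hlim : ∀ (k n : ℕ) (ε : ℝ), 0 < ε → ∃ N, ∀ i ≥ N, ∀ x,
      ‖x‖ ^ k * ‖iteratedFDeriv ℝ n (u i) x - p n x‖ ≤ ε := by
    intro k n ε hε
    obtain ⟨N, hN⟩ := key k n ε hε
    refine ⟨N, fun i hi x => ?_⟩
    refine le_of_tendsto (((tendsto_const_nhds.sub (hp n x)).norm).const_mul _) ?_
    filter_upwards [eventually_ge_atTop N] with j hj using (hN i hi j hj x).le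
  have hunif : ∀ n, TendstoUniformly (fun i x => iteratedFDeriv ℝ n (u i) x) (p n) atTop := by
    intro n
    rw [Metric.tendstoUniformly_iff]
    intro ε hε
    obtain ⟨N, hN⟩ := hlim 0 n (ε / 2) (half_pos hε)
    filter_upwards [eventually_ge_atTop N] with i hi x
    rw [dist_comm, dist_eq_norm]
    have := hN i hi x
    simp only [pow_zero, one_mul] at this
    linarith
  have hder : ∀ n x, HasFDerivAt (p n) (p (n + 1) x).curryLeft x := by
    intro n x
    have hcl : Continuous fun q : E [×(n + 1)]→L[ℝ] F => q.curryLeft :=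
      (continuousMultilinearCurryLeftEquiv ℝ (fun _ : Fin (n + 1) => E) F).continuous
    have huc : UniformContinuous fun q : E [×(n + 1)]→L[ℝ] F => q.curryLeft :=
      (continuousMultilinearCurryLeftEquiv ℝ (fun _ : Fin (n + 1) => E) F).isometry.uniformContinuous
    refine hasFDerivAt_of_tendstoUniformly (𝕜 := ℝ) (l := atTop)
      (f := fun i x => iteratedFDeriv ℝ n (u i) x)
      (f' := fun i x => (iteratedFDeriv ℝ (n + 1) (u i) x).curryLeft)
      (g' := fun x => (p (n + 1) x).curryLeft) ?_ ?_ (hp n) x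
    · exact huc.comp_tendstoUniformly (hunif (n + 1))
    · intro i x
      exact ((u i).smooth ⊤).ftaylorSeries.fderiv n (mod_cast WithTop.coe_lt_top n) x
  have hT : HasFTaylorSeriesUpTo ∞ (fun x => (p 0 x).curry0) (fun x n => p n x) := by
    refine ⟨fun x => rfl, fun m _ x => hder m x, fun m _ => ?_⟩
    exact continuous_iff_continuousAt.2 fun x => (hder m x).continuousAt
  have heq : ∀ n x, iteratedFDeriv ℝ n (fun x => (p 0 x).curry0) x = p n x := fun n x =>
    (hT.eq_iteratedFDeriv (mod_cast le_top) x).symm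
  let f : 𝓢(E, F) :=
    { toFun := fun x => (p 0 x).curry0
      smooth' := hT.contDiff
      decay' := by
        intro k n
        obtain ⟨N, hN⟩ := hlim k n 1 one_pos
        refine ⟨SchwartzMap.seminorm ℝ k n (u N) + 1, fun x => ?_⟩
        rw [heq]
        have h1 := hN N le_rfl x
        have h2 := SchwartzMap.le_seminorm ℝ k n (u N) x
        have h3 : ‖p n x‖ ≤ ‖iteratedFDeriv ℝ n (u N) x‖
            + ‖iteratedFDeriv ℝ n (u N) x - p n x‖ := by
          simpa using norm_sub_le (iteratedFDeriv ℝ n (u N) x)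
            (iteratedFDeriv ℝ n (u N) x - p n x)
        calc ‖x‖ ^ k * ‖p n x‖ ≤ ‖x‖ ^ k * (‖iteratedFDeriv ℝ n (u N) x‖
            + ‖iteratedFDeriv ℝ n (u N) x - p n x‖) := by gcongr
          _ ≤ _ := by rw [mul_add]; exact add_le_add h2 h1 }
  refine ⟨f, ?_⟩
  rw [(schwartz_withSeminorms ℝ E F).tendsto_nhds_atTop]
  rintro ⟨k, n⟩ ε hε
  obtain ⟨N, hN⟩ := hlim k n (ε / 2) (half_pos hε)
  refine ⟨N, fun i hi => lt_of_le_of_lt ?_ (half_lt_self hε)⟩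
  refine SchwartzMap.seminorm_le_bound ℝ k n _ (half_pos hε).le fun x => ?_
  have h2 : ⇑(u i - f) = ⇑(u i) - ⇑f := by ext; simp
  rw [h2, iteratedFDeriv_sub ((u i).smooth n) (f.smooth n)]
  have := hN i hi x
  rwa [← heq n x] at this

instance SchwartzMap.instCompleteSpace [CompleteSpace F] : CompleteSpace 𝓢(E, F) := by
  have : (uniformity 𝓢(E, F)).IsCountablyGenerated :=
    IsUniformAddGroup.uniformity_countably_generated
  exact UniformSpace.complete_of_cauchySeq_tendsto fun u hu =>
    SchwartzMap.exists_tendsto_of_cauchySeq hu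

end SchwartzComplete

/-! ### Tensor products of Schwartz functions -/

section SchwartzTensor

variable {E W : Type*} [NormedAddCommGroup E] [NormedSpace ℝ E]
  [NormedAddCommGroup W] [NormedSpace ℝ W]

/-- Composition with a linear map of norm at most `1` does not increase the derivatives. -/
theorem norm_iteratedFDeriv_comp_clm_le {G : Type*} [NormedAddCommGroup G] [NormedSpace ℝ G]
    {f : W → G} (hf : ContDiff ℝ ∞ f) (L : E →L[ℝ] W) (hL : ‖L‖ ≤ 1) (n : ℕ) (x : E) :
    ‖iteratedFDeriv ℝ n (fun y => f (L y)) x‖ ≤ ‖iteratedFDeriv ℝ n f (L x)‖ := by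
  have h := L.iteratedFDeriv_comp_right (f := f) (hf) x (i := n) (mod_cast le_top)
  have h' : (fun y => f (L y)) = f ∘ L := rfl
  rw [h', h]
  refine (ContinuousMultilinearMap.norm_compContinuousLinearMap_le _ _).trans ?_
  refine mul_le_of_le_one_right (norm_nonneg _) ?_
  exact Finset.prod_le_one (fun _ _ => norm_nonneg _) fun _ _ => hL

/-- The sum of Schwartz seminorms that controls a factor of a tensor product. -/
noncomputable def tensorSeminorm (E : Type*) [NormedAddCommGroup E] [NormedSpace ℝ E] (k n : ℕ) :
    Seminorm ℂ 𝓢(E, ℂ) :=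
  ∑ i ∈ Finset.range (n + 1), (SchwartzMap.seminorm ℂ k i + SchwartzMap.seminorm ℂ 0 i)

theorem SchwartzMap.continuous_seminorm (k n : ℕ) :
    Continuous (SchwartzMap.seminorm ℂ k n : Seminorm ℂ 𝓢(E, ℂ)) :=
  (schwartz_withSeminorms ℂ E ℂ).continuous_seminorm (k, n)

theorem Seminorm.sum_apply' {X ι : Type*} [AddCommGroup X] [Module ℂ X] (s : Finset ι)
    (p : ι → Seminorm ℂ X) (x : X) : (∑ i ∈ s, p i) x = ∑ i ∈ s, p i x := by
  classical
  induction s using Finset.induction_on with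
  | empty => simp
  | insert a s ha ih => rw [Finset.sum_insert ha, Finset.sum_insert ha, add_apply, ih]

theorem continuous_tensorSeminorm (k n : ℕ) : Continuous (tensorSeminorm E k n) :=
  Seminorm.continuous_finsetSum fun i _ =>
    (SchwartzMap.continuous_seminorm k i).add (SchwartzMap.continuous_seminorm 0 i)

/-- A Leibniz term of `f ⊗ h` needs one factor weighted by `‖x‖ ^ k` and the other one unweighted;
`tensorSeminorm` dominates both. -/
theorem seminorm_le_tensorSeminorm (k n : ℕ) {i : ℕ} (hi : i ≤ n) (f : 𝓢(E, ℂ)) :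
    SchwartzMap.seminorm ℂ k i f + SchwartzMap.seminorm ℂ 0 i f ≤ tensorSeminorm E k n f := by
  rw [tensorSeminorm, Seminorm.sum_apply']
  refine (Finset.single_le_sum
    (f := fun i => (SchwartzMap.seminorm ℂ k i + SchwartzMap.seminorm ℂ 0 i : Seminorm ℂ 𝓢(E, ℂ)) f)
    (fun i _ => apply_nonneg _ _) (Finset.mem_range.2 (Nat.lt_succ_of_le hi)))

theorem norm_iteratedFDeriv_tensor_le (f : 𝓢(E, ℂ)) (h : 𝓢(W, ℂ)) (k n : ℕ) (p : E × W) :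
    ‖p‖ ^ k * ‖iteratedFDeriv ℝ n (fun p : E × W => f p.1 * h p.2) p‖ ≤
      2 ^ n * (tensorSeminorm E k n f * tensorSeminorm W k n h) := by
  have hf1 : ContDiff ℝ ∞ (fun p : E × W => f p.1) := (f.smooth ⊤).comp contDiff_fst
  have hh1 : ContDiff ℝ ∞ (fun p : E × W => h p.2) := (h.smooth ⊤).comp contDiff_snd
  have h1 := norm_iteratedFDeriv_mul_le hf1 hh1 p (n := n) (mod_cast le_top)
  -- the norm of the product is the maximum norm
  have hk : ‖p‖ ^ k ≤ ‖p.1‖ ^ k + ‖p.2‖ ^ k := by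
    rw [Prod.norm_def]
    rcases max_cases ‖p.1‖ ‖p.2‖ with ⟨h, _⟩ | ⟨h, _⟩ <;> rw [h]
    · exact le_add_of_nonneg_right (by positivity)
    · exact le_add_of_nonneg_left (by positivity)
  calc _ ≤ ‖p‖ ^ k * _ := mul_le_mul_of_nonneg_left h1 (by positivity)
    _ = ∑ i ∈ Finset.range (n + 1), (n.choose i : ℝ) * (‖p‖ ^ k *
        (‖iteratedFDeriv ℝ i (fun p : E × W => f p.1) p‖ *
        ‖iteratedFDeriv ℝ (n - i) (fun p : E × W => h p.2) p‖)) := by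
      rw [Finset.mul_sum]; exact Finset.sum_congr rfl fun i _ => by ring
    _ ≤ ∑ i ∈ Finset.range (n + 1), (n.choose i : ℝ) *
        (tensorSeminorm E k n f * tensorSeminorm W k n h) := by
      refine Finset.sum_le_sum fun i hi => ?_
      refine mul_le_mul_of_nonneg_left ?_ (by positivity)
      have hi' : i ≤ n := Nat.lt_succ_iff.1 (Finset.mem_range.1 hi)
      have e1 : ‖iteratedFDeriv ℝ i (fun p : E × W => f p.1) p‖ ≤ ‖iteratedFDeriv ℝ i f p.1‖ :=
        norm_iteratedFDeriv_comp_clm_le (f.smooth ⊤) (ContinuousLinearMap.fst ℝ E W)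
          (ContinuousLinearMap.norm_fst_le _ _ _) i p
      have e2 : ‖iteratedFDeriv ℝ (n - i) (fun p : E × W => h p.2) p‖ ≤
          ‖iteratedFDeriv ℝ (n - i) h p.2‖ :=
        norm_iteratedFDeriv_comp_clm_le (h.smooth ⊤) (ContinuousLinearMap.snd ℝ E W)
          (ContinuousLinearMap.norm_snd_le _ _ _) (n - i) p
      have a1 := SchwartzMap.le_seminorm ℂ k i f p.1
      have a2 := SchwartzMap.norm_iteratedFDeriv_le_seminorm ℂ f i p.1
      have b1 := SchwartzMap.le_seminorm ℂ k (n - i) h p.2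
      have b2 := SchwartzMap.norm_iteratedFDeriv_le_seminorm ℂ h (n - i) p.2
      have c1 := seminorm_le_tensorSeminorm k n hi' f
      have c2 := seminorm_le_tensorSeminorm k n (Nat.sub_le n i) h
      set A := ‖iteratedFDeriv ℝ i f p.1‖
      set B := ‖iteratedFDeriv ℝ (n - i) h p.2‖
      have p1 : 0 ≤ SchwartzMap.seminorm ℂ k i f := apply_nonneg _ _
      have p2 : 0 ≤ SchwartzMap.seminorm ℂ 0 i f := apply_nonneg _ _
      have p3 : 0 ≤ SchwartzMap.seminorm ℂ k (n - i) h := apply_nonneg _ _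
      have p4 : 0 ≤ SchwartzMap.seminorm ℂ 0 (n - i) h := apply_nonneg _ _
      calc _ ≤ (‖p.1‖ ^ k + ‖p.2‖ ^ k) * (A * B) := by gcongr
        _ = (‖p.1‖ ^ k * A) * B + A * (‖p.2‖ ^ k * B) := by ring
        _ ≤ SchwartzMap.seminorm ℂ k i f * SchwartzMap.seminorm ℂ 0 (n - i) h
          + SchwartzMap.seminorm ℂ 0 i f * SchwartzMap.seminorm ℂ k (n - i) h := by
          gcongr
        _ ≤ (SchwartzMap.seminorm ℂ k i f + SchwartzMap.seminorm ℂ 0 i f) *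
          (SchwartzMap.seminorm ℂ k (n - i) h + SchwartzMap.seminorm ℂ 0 (n - i) h) := by
          nlinarith [mul_nonneg p1 p3, mul_nonneg p2 p4]
        _ ≤ _ := by gcongr
    _ = _ := by
      rw [← Finset.sum_mul]
      congr 1
      exact_mod_cast Nat.sum_range_choose n

/-- The function `(x, w) ↦ f x * h w`. -/
noncomputable def SchwartzMap.tensor (f : 𝓢(E, ℂ)) (h : 𝓢(W, ℂ)) : 𝓢(E × W, ℂ) where
  toFun p := f p.1 * h p.2
  smooth' := ((f.smooth ⊤).comp contDiff_fst).mul ((h.smooth ⊤).comp contDiff_snd)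
  decay' k n := ⟨_, norm_iteratedFDeriv_tensor_le f h k n⟩

@[simp]
theorem SchwartzMap.tensor_apply (f : 𝓢(E, ℂ)) (h : 𝓢(W, ℂ)) (p : E × W) :
    f.tensor h p = f p.1 * h p.2 := rfl

theorem SchwartzMap.seminorm_tensor_le (f : 𝓢(E, ℂ)) (h : 𝓢(W, ℂ)) (k n : ℕ) :
    SchwartzMap.seminorm ℂ k n (f.tensor h) ≤
      2 ^ n * (tensorSeminorm E k n f * tensorSeminorm W k n h) :=
  SchwartzMap.seminorm_le_bound ℂ k n _
    (by have := apply_nonneg (tensorSeminorm E k n) f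
        have := apply_nonneg (tensorSeminorm W k n) h
        positivity) (norm_iteratedFDeriv_tensor_le f h k n)

end SchwartzTensor

/-! ### Partial integration of Schwartz functions -/

section PartialIntegral

variable {W : Type*} [NormedAddCommGroup W] [NormedSpace ℝ W]

open scoped BoundedContinuousFunction

/-- Two powers of the weight are spent on integrability in `s`. -/
theorem SchwartzMap.norm_iteratedFDeriv_le_inv_one_add_sq (F : 𝓢(ℝ × W, ℂ)) (k n : ℕ) (s : ℝ)
    (w : W) : ‖w‖ ^ k * ‖iteratedFDeriv ℝ n F (s, w)‖ ≤
      (SchwartzMap.seminorm ℂ k n F + SchwartzMap.seminorm ℂ (k + 2) n F) * (1 + s ^ 2)⁻¹ := by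
  have h1 := SchwartzMap.le_seminorm ℂ k n F (s, w)
  have h2 := SchwartzMap.le_seminorm ℂ (k + 2) n F (s, w)
  have hs : s ^ 2 ≤ ‖(s, w)‖ ^ 2 := by
    rw [← sq_abs]; gcongr; exact norm_fst_le (s, w)
  have hw : ‖w‖ ≤ ‖(s, w)‖ := norm_snd_le (s, w)
  rw [← div_eq_mul_inv, le_div_iff₀ (by positivity)]
  set A := ‖iteratedFDeriv ℝ n F (s, w)‖
  calc ‖w‖ ^ k * A * (1 + s ^ 2) ≤ ‖(s, w)‖ ^ k * A * (1 + ‖(s, w)‖ ^ 2) := by gcongr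
    _ = ‖(s, w)‖ ^ k * A + ‖(s, w)‖ ^ (k + 2) * A := by ring
    _ ≤ _ := add_le_add h1 h2

/-- The `n`-th derivative with respect to `w` of a function of `(s, w)`. -/
noncomputable def sndDeriv (F : 𝓢(ℝ × W, ℂ)) (n : ℕ) (s : ℝ) (w : W) : W [×n]→L[ℝ] ℂ :=
  (iteratedFDeriv ℝ n F (s, w)).compContinuousLinearMap fun _ => ContinuousLinearMap.inr ℝ ℝ W

theorem norm_sndDeriv_le (F : 𝓢(ℝ × W, ℂ)) (n : ℕ) (s : ℝ) (w : W) :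
    ‖sndDeriv F n s w‖ ≤ ‖iteratedFDeriv ℝ n F (s, w)‖ := by
  refine (ContinuousMultilinearMap.norm_compContinuousLinearMap_le _ _).trans ?_
  refine mul_le_of_le_one_right (norm_nonneg _) ?_
  exact Finset.prod_le_one (fun _ _ => norm_nonneg _)
    fun _ _ => ContinuousLinearMap.norm_inr_le_one _ _ _

theorem continuous_sndDeriv (F : 𝓢(ℝ × W, ℂ)) (n : ℕ) (w : W) :
    Continuous fun s => sndDeriv F n s w := by
  have h : Continuous fun s : ℝ => iteratedFDeriv ℝ n F (s, w) :=
    ((F.smooth n).continuous_iteratedFDeriv le_rfl).comp (by fun_prop)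
  exact (ContinuousMultilinearMap.compContinuousLinearMapL (F := ℂ) (E := fun _ : Fin n => W)
    (fun _ => ContinuousLinearMap.inr ℝ ℝ W)).continuous.comp h

theorem hasFDerivAt_sndDeriv (F : 𝓢(ℝ × W, ℂ)) (n : ℕ) (s : ℝ) (w : W) :
    HasFDerivAt (sndDeriv F n s) (sndDeriv F (n + 1) s w).curryLeft w := by
  have h : HasFDerivAt (fun p => iteratedFDeriv ℝ n F p)
      (iteratedFDeriv ℝ (n + 1) F (s, w)).curryLeft (s, w) :=
    (F.smooth ⊤).ftaylorSeries.fderiv n (mod_cast WithTop.coe_lt_top n) (s, w)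
  have h2 : HasFDerivAt (fun w : W => (s, w)) (ContinuousLinearMap.inr ℝ ℝ W) w :=
    hasFDerivAt_prodMk_right s w
  have h3 := (ContinuousMultilinearMap.compContinuousLinearMapL (𝕜 := ℝ) (F := ℂ)
    (E := fun _ : Fin n => W)
    (fun _ => ContinuousLinearMap.inr ℝ ℝ W)).hasFDerivAt.comp w (h.comp w h2)
  refine h3.congr_fderiv ?_
  ext v m
  simp only [sndDeriv, ContinuousLinearMap.comp_apply,
    ContinuousMultilinearMap.compContinuousLinearMapL_apply,
    ContinuousMultilinearMap.compContinuousLinearMap_apply,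
    ContinuousMultilinearMap.curryLeft_apply]
  congr 1
  ext i <;> refine Fin.cases ?_ (fun j => ?_) i <;> simp

theorem integrable_bcf_smul_sndDeriv (u : ℝ →ᵇ ℂ) (F : 𝓢(ℝ × W, ℂ)) (n : ℕ) (w : W) :
    Integrable fun s => u s • sndDeriv F n s w := by
  refine ((integrable_inv_one_add_sq.const_mul
    (SchwartzMap.seminorm ℂ 0 n F + SchwartzMap.seminorm ℂ (0 + 2) n F)).const_mul ‖u‖).mono'
    (u.continuous.smul (continuous_sndDeriv F n w)).aestronglyMeasurable
    (Eventually.of_forall fun s => ?_)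
  rw [norm_smul]
  have := SchwartzMap.norm_iteratedFDeriv_le_inv_one_add_sq F 0 n s w
  rw [pow_zero, one_mul] at this
  exact mul_le_mul (u.norm_coe_le_norm s) ((norm_sndDeriv_le F n s w).trans this)
    (norm_nonneg _) (norm_nonneg _)

/-- Currying of multilinear maps, with the topologies found by instance search. -/
noncomputable def curryLeftCLM (W : Type*) [NormedAddCommGroup W] [NormedSpace ℝ W] (n : ℕ) :
    (W [×(n + 1)]→L[ℝ] ℂ) →L[ℝ] (W →L[ℝ] W [×n]→L[ℝ] ℂ) where
  toFun p := p.curryLeft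
  map_add' _ _ := rfl
  map_smul' _ _ := rfl
  cont := (continuousMultilinearCurryLeftEquiv ℝ (fun _ : Fin (n + 1) => W) ℂ).continuous

theorem integral_curryLeft {n : ℕ} {f : ℝ → W [×(n + 1)]→L[ℝ] ℂ} (hf : Integrable f) :
    ∫ s, (f s).curryLeft = (∫ s, f s).curryLeft := by
  have h := ContinuousLinearMap.integral_comp_comm (𝕜 := ℝ) (Fₗ := W →L[ℝ] W [×n]→L[ℝ] ℂ)
    (by exact curryLeftCLM W n) hf
  exact h

/-- Differentiation under the integral sign, to all orders. -/
theorem hasFTaylorSeriesUpTo_partialIntegral (u : ℝ →ᵇ ℂ) (F : 𝓢(ℝ × W, ℂ)) :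
    HasFTaylorSeriesUpTo ∞ (fun w => ∫ s, u s * F (s, w))
      (fun w n => ∫ s, u s • sndDeriv F n s w) := by
  have hder : ∀ n w, HasFDerivAt (fun w => ∫ s, u s • sndDeriv F n s w)
      (∫ s, u s • sndDeriv F (n + 1) s w).curryLeft w := by
    intro n w
    have hL : (∫ s, u s • sndDeriv F (n + 1) s w).curryLeft
        = ∫ s, u s • (sndDeriv F (n + 1) s w).curryLeft := by
      exact (integral_curryLeft (integrable_bcf_smul_sndDeriv u F (n + 1) w)).symm
    rw [hL]
    refine hasFDerivAt_integral_of_dominated_of_fderiv_le (𝕜 := ℝ) (s := Set.univ)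
      (bound := fun s => ‖u‖ * ((SchwartzMap.seminorm ℂ 0 (n + 1) F
        + SchwartzMap.seminorm ℂ (0 + 2) (n + 1) F) * (1 + s ^ 2)⁻¹))
      (F' := fun w s => u s • (sndDeriv F (n + 1) s w).curryLeft)
      Filter.univ_mem ?_ (integrable_bcf_smul_sndDeriv u F n w) ?_ ?_ ?_ ?_
    · exact Eventually.of_forall fun w => (integrable_bcf_smul_sndDeriv u F n w).1
    · refine (u.continuous.smul ?_).aestronglyMeasurable
      exact (continuousMultilinearCurryLeftEquiv ℝ (fun _ : Fin (n + 1) => W)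
        ℂ).continuous.comp (continuous_sndDeriv F (n + 1) w)
    · refine Eventually.of_forall fun s w _ => ?_
      rw [norm_smul]
      have := SchwartzMap.norm_iteratedFDeriv_le_inv_one_add_sq F 0 (n + 1) s w
      rw [pow_zero, one_mul] at this
      refine mul_le_mul (u.norm_coe_le_norm s) ?_ (norm_nonneg _) (norm_nonneg _)
      rw [ContinuousMultilinearMap.curryLeft_norm]
      exact (norm_sndDeriv_le F (n + 1) s w).trans this
    · exact (integrable_inv_one_add_sq.const_mul _).const_mul _
    · exact Eventually.of_forall fun s w _ => (hasFDerivAt_sndDeriv F n s w).const_smul (u s)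
  refine ⟨fun w => ?_, fun n _ w => hder n w, fun n _ =>
    continuous_iff_continuousAt.2 fun w => (hder n w).continuousAt⟩
  have := (continuousMultilinearCurryFin0 ℝ W
    ℂ).toContinuousLinearEquiv.toContinuousLinearMap.integral_comp_comm
    (integrable_bcf_smul_sndDeriv u F 0 w)
  refine this.symm.trans ?_
  refine integral_congr_ae (Eventually.of_forall fun s => ?_)
  simp [sndDeriv, continuousMultilinearCurryFin0]

theorem norm_iteratedFDeriv_partialIntegral_le (u : ℝ →ᵇ ℂ) (F : 𝓢(ℝ × W, ℂ)) (k n : ℕ) (w : W) :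
    ‖w‖ ^ k * ‖iteratedFDeriv ℝ n (fun w => ∫ s, u s * F (s, w)) w‖ ≤
      ‖u‖ * (Real.pi * (SchwartzMap.seminorm ℂ k n F + SchwartzMap.seminorm ℂ (k + 2) n F)) := by
  rw [← (hasFTaylorSeriesUpTo_partialIntegral u F).eq_iteratedFDeriv (mod_cast le_top) w]
  set C := SchwartzMap.seminorm ℂ k n F + SchwartzMap.seminorm ℂ (k + 2) n F
  have h1 : ‖∫ s, (‖w‖ ^ k) • u s • sndDeriv F n s w‖ ≤
      ∫ s : ℝ, ‖u‖ * (C * (1 + s ^ 2)⁻¹) := by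
    refine norm_integral_le_of_norm_le ((integrable_inv_one_add_sq.const_mul _).const_mul _)
      (Eventually.of_forall fun s => ?_)
    rw [norm_smul, norm_smul, Real.norm_of_nonneg (by positivity)]
    have := SchwartzMap.norm_iteratedFDeriv_le_inv_one_add_sq F k n s w
    calc _ = ‖u s‖ * (‖w‖ ^ k * ‖sndDeriv F n s w‖) := by ring
      _ ≤ ‖u‖ * (‖w‖ ^ k * ‖iteratedFDeriv ℝ n F (s, w)‖) := by
        gcongr
        · exact u.norm_coe_le_norm s
        · exact norm_sndDeriv_le F n s w
      _ ≤ _ := by gcongr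
  rw [integral_smul, norm_smul, Real.norm_of_nonneg (by positivity)] at h1
  refine h1.trans (le_of_eq ?_)
  rw [integral_const_mul, integral_const_mul, integral_univ_inv_one_add_sq]
  ring

/-- Integration of a Schwartz function of `(s, w)` against a bounded continuous function of `s`. -/
noncomputable def SchwartzMap.partialIntegral (u : ℝ →ᵇ ℂ) (F : 𝓢(ℝ × W, ℂ)) : 𝓢(W, ℂ) where
  toFun w := ∫ s, u s * F (s, w)
  smooth' := (hasFTaylorSeriesUpTo_partialIntegral u F).contDiff
  decay' k n := ⟨_, norm_iteratedFDeriv_partialIntegral_le u F k n⟩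

/-- The bound depends on `u` through its supremum norm only. -/
theorem SchwartzMap.seminorm_partialIntegral_le (u : ℝ →ᵇ ℂ) (F : 𝓢(ℝ × W, ℂ)) (k n : ℕ) :
    SchwartzMap.seminorm ℂ k n (F.partialIntegral u) ≤
      ‖u‖ * (Real.pi * (SchwartzMap.seminorm ℂ k n F + SchwartzMap.seminorm ℂ (k + 2) n F)) :=
  SchwartzMap.seminorm_le_bound ℂ k n _ (by positivity)
    (norm_iteratedFDeriv_partialIntegral_le u F k n)

theorem SchwartzMap.integrable_bcf_mul (u : ℝ →ᵇ ℂ) (F : 𝓢(ℝ × W, ℂ)) (w : W) :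
    Integrable fun s => u s * F (s, w) := by
  refine ((integrable_inv_one_add_sq.const_mul
    (SchwartzMap.seminorm ℂ 0 0 F + SchwartzMap.seminorm ℂ (0 + 2) 0 F)).const_mul ‖u‖).mono'
    (u.continuous.mul (F.continuous.comp (by fun_prop))).aestronglyMeasurable
    (Eventually.of_forall fun s => ?_)
  rw [norm_mul]
  have := SchwartzMap.norm_iteratedFDeriv_le_inv_one_add_sq F 0 0 s w
  rw [pow_zero, one_mul, norm_iteratedFDeriv_zero] at this
  exact mul_le_mul (u.norm_coe_le_norm s) this (norm_nonneg _) (norm_nonneg _)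

end PartialIntegral

/-! ### Gabor coefficients and Gabor atoms -/

section Gabor

variable {W : Type*} [NormedAddCommGroup W] [NormedSpace ℝ W]

open scoped BoundedContinuousFunction LineDeriv

theorem hasTemperateGrowth_ofReal_fst :
    (fun p : ℝ × W => (p.1 : ℂ)).HasTemperateGrowth :=
  (Complex.ofRealCLM.comp (ContinuousLinearMap.fst ℝ ℝ W)).hasTemperateGrowth

theorem norm_cexp_int_mul (k : ℤ) (s : ℝ) :
    ‖Complex.exp (-(2 * Real.pi * Complex.I * k * s))‖ = 1 := by
  have : -(2 * Real.pi * Complex.I * k * s : ℂ) = ((-(2 * Real.pi * k * s) : ℝ) : ℂ) * Complex.I := by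
    push_cast; ring
  rw [this, Complex.norm_exp_ofReal_mul_I]

/-- The window `φ`, translated by `m / 4` and modulated by the character of frequency `-k`. -/
noncomputable def gaborWindow (φ : 𝓢(ℝ, ℂ)) (m k : ℤ) : ℝ →ᵇ ℂ :=
  BoundedContinuousFunction.ofNormedAddCommGroup
    (fun s : ℝ => φ (s - m / 4) * Complex.exp (-(2 * Real.pi * Complex.I * k * s)))
    (by have := φ.continuous; fun_prop) (SchwartzMap.seminorm ℂ 0 0 φ) fun s => by
      rw [norm_mul, norm_cexp_int_mul, mul_one]
      exact SchwartzMap.norm_le_seminorm ℂ φ _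

theorem gaborWindow_apply (φ : 𝓢(ℝ, ℂ)) (m k : ℤ) (s : ℝ) : gaborWindow φ m k s =
    φ (s - m / 4) * Complex.exp (-(2 * Real.pi * Complex.I * k * s)) := rfl

theorem norm_gaborWindow_le (φ : 𝓢(ℝ, ℂ)) (m k : ℤ) :
    ‖gaborWindow φ m k‖ ≤ SchwartzMap.seminorm ℂ 0 0 φ :=
  BoundedContinuousFunction.norm_ofNormedAddCommGroup_le _ (apply_nonneg _ _) _

/-- The Gabor coefficient `w ↦ ∫ φ(s - m/4) e^{-2πiks} F(s, w) ds`. -/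
noncomputable def gaborCoeff (φ : 𝓢(ℝ, ℂ)) (m k : ℤ) (F : 𝓢(ℝ × W, ℂ)) : 𝓢(W, ℂ) :=
  F.partialIntegral (gaborWindow φ m k)

theorem gaborCoeff_apply (φ : 𝓢(ℝ, ℂ)) (m k : ℤ) (F : 𝓢(ℝ × W, ℂ)) (w : W) :
    gaborCoeff φ m k F w = ∫ s, gaborWindow φ m k s * F (s, w) := rfl

/-- Multiplication by the translation parameter is `m / 4 = s - (s - m / 4)`: the first term acts on
`F`, the second one on the window. -/
theorem translation_smul_gaborCoeff (φ : 𝓢(ℝ, ℂ)) (m k : ℤ) (F : 𝓢(ℝ × W, ℂ)) :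
    ((m : ℂ) / 4) • gaborCoeff φ m k F =
      gaborCoeff φ m k (SchwartzMap.smulLeftCLM ℂ (fun p : ℝ × W => (p.1 : ℂ)) F)
        - gaborCoeff (SchwartzMap.smulLeftCLM ℂ (fun x : ℝ => (x : ℂ)) φ) m k F := by
  ext w
  have e1 : ∀ s : ℝ, SchwartzMap.smulLeftCLM ℂ (fun p : ℝ × W => (p.1 : ℂ)) F (s, w)
      = s * F (s, w) := fun s => by
    rw [SchwartzMap.smulLeftCLM_apply_apply hasTemperateGrowth_ofReal_fst]; rfl
  have e2 : ∀ s : ℝ, SchwartzMap.smulLeftCLM ℂ (fun x : ℝ => (x : ℂ)) φ s = s * φ s := fun s => by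
    rw [SchwartzMap.smulLeftCLM_apply_apply (g := fun x : ℝ => (x : ℂ))
      Complex.ofRealCLM.hasTemperateGrowth]; rfl
  rw [smul_apply, sub_apply, gaborCoeff_apply, gaborCoeff_apply, gaborCoeff_apply, smul_eq_mul,
    ← integral_sub (SchwartzMap.integrable_bcf_mul _ _ w) (SchwartzMap.integrable_bcf_mul _ _ w),
    ← integral_const_mul]
  refine integral_congr_ae (Eventually.of_forall fun s => ?_)
  simp only [gaborWindow_apply, e1, e2]
  push_cast
  ring

/-- Integration by parts in `s`; the boundary terms vanish because the integrand is integrable together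
with its derivative. -/
theorem frequency_smul_gaborCoeff (φ : 𝓢(ℝ, ℂ)) (m k : ℤ) (F : 𝓢(ℝ × W, ℂ)) :
    (2 * Real.pi * Complex.I * k : ℂ) • gaborCoeff φ m k F =
      gaborCoeff (SchwartzMap.derivCLM ℂ ℂ φ) m k F
        + gaborCoeff φ m k (∂_{((1 : ℝ), (0 : W))} F) := by
  ext w
  have hd : ∀ s : ℝ, HasDerivAt (fun s : ℝ => gaborWindow φ m k s * F (s, w))
      (gaborWindow (SchwartzMap.derivCLM ℂ ℂ φ) m k s * F (s, w)
        + gaborWindow φ m k s * (∂_{((1 : ℝ), (0 : W))} F) (s, w)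
        - (2 * Real.pi * Complex.I * k : ℂ) * (gaborWindow φ m k s * F (s, w))) s := by
    intro s
    have h1 : HasDerivAt (fun s : ℝ => φ (s - m / 4)) (deriv φ (s - m / 4)) s := by
      exact (φ.hasDerivAt (s - m / 4)).comp_sub_const s _
    have h2 : HasDerivAt (fun s : ℝ => Complex.exp (-(2 * Real.pi * Complex.I * k * s)))
        (Complex.exp (-(2 * Real.pi * Complex.I * k * s)) * (-(2 * Real.pi * Complex.I * k))) s := by
      have h := ((Complex.ofRealCLM.hasDerivAt (x := s)).const_mul
        (2 * Real.pi * Complex.I * k : ℂ)).neg.cexp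
      simpa using h
    have h3 : HasDerivAt (fun s : ℝ => F (s, w)) (fderiv ℝ F (s, w) (1, 0)) s := by
      have h := (F.hasFDerivAt (s, w)).comp_hasDerivAt s
        ((hasDerivAt_id s).prodMk (hasDerivAt_const s w))
      exact h
    refine ((h1.mul h2).mul h3).congr_deriv ?_
    simp only [gaborWindow_apply, SchwartzMap.derivCLM_apply,
      SchwartzMap.lineDerivOp_apply_eq_fderiv, Pi.mul_apply]
    ring
  have i1 := SchwartzMap.integrable_bcf_mul (gaborWindow φ m k) F w
  have i2 := SchwartzMap.integrable_bcf_mul (gaborWindow (SchwartzMap.derivCLM ℂ ℂ φ) m k) F w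
  have i3 := SchwartzMap.integrable_bcf_mul (gaborWindow φ m k) (∂_{((1 : ℝ), (0 : W))} F) w
  have h := integral_eq_zero_of_hasDerivAt_of_integrable hd
    ((i2.add i3).sub (i1.const_mul _)) i1
  rw [integral_sub (by exact i2.add i3) (i1.const_mul _), integral_add i2 i3, integral_const_mul, sub_eq_zero] at h
  rw [smul_apply, add_apply, gaborCoeff_apply, gaborCoeff_apply, gaborCoeff_apply, smul_eq_mul]
  exact h.symm

/-- The Gabor coefficients decrease rapidly in `𝓢(W)`: multiplication by the translation parameter
is moved to the window and to `F`, and multiplication by the frequency is integration by parts. -/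
theorem exists_seminorm_gaborCoeff_le (M N a n : ℕ) (φ : 𝓢(ℝ, ℂ)) :
    ∃ Q : Seminorm ℂ 𝓢(ℝ × W, ℂ), Continuous Q ∧ ∀ (F : 𝓢(ℝ × W, ℂ)) (m k : ℤ),
      (1 + |(m : ℝ)|) ^ M * (1 + |(k : ℝ)|) ^ N * SchwartzMap.seminorm ℂ a n (gaborCoeff φ m k F)
        ≤ Q F := by
  induction M generalizing φ with
  | zero =>
    induction N generalizing φ with
    | zero =>
      refine ⟨(SchwartzMap.seminorm ℂ 0 0 φ * Real.pi).toNNReal •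
        (SchwartzMap.seminorm ℂ a n + SchwartzMap.seminorm ℂ (a + 2) n), ?_, fun F m k => ?_⟩
      · exact ((SchwartzMap.continuous_seminorm a n).add
          (SchwartzMap.continuous_seminorm (a + 2) n)).const_smul
            (SchwartzMap.seminorm ℂ 0 0 φ * Real.pi).toNNReal
      · have h := SchwartzMap.seminorm_partialIntegral_le (gaborWindow φ m k) F a n
        have hp : 0 ≤ SchwartzMap.seminorm ℂ a n F + SchwartzMap.seminorm ℂ (a + 2) n F :=
          by positivity
        rw [pow_zero, pow_zero, one_mul, one_mul]
        refine h.trans ?_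
        have e : ((SchwartzMap.seminorm ℂ 0 0 φ * Real.pi).toNNReal •
          (SchwartzMap.seminorm ℂ a n + SchwartzMap.seminorm ℂ (a + 2) n :
            Seminorm ℂ 𝓢(ℝ × W, ℂ))) F = SchwartzMap.seminorm ℂ 0 0 φ * Real.pi *
            (SchwartzMap.seminorm ℂ a n F + SchwartzMap.seminorm ℂ (a + 2) n F) := by
          change ((SchwartzMap.seminorm ℂ 0 0 φ * Real.pi).toNNReal : ℝ) * _ = _
          rw [Real.coe_toNNReal _ (by positivity)]
          rfl
        rw [e, mul_assoc]
        gcongr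
        exact norm_gaborWindow_le φ m k
    | succ N ih =>
      obtain ⟨Q1, hQ1, h1⟩ := ih φ
      obtain ⟨Q2, hQ2, h2⟩ := ih (SchwartzMap.derivCLM ℂ ℂ φ)
      let D : 𝓢(ℝ × W, ℂ) →L[ℂ] 𝓢(ℝ × W, ℂ) :=
        LineDeriv.lineDerivOpCLM ℂ 𝓢(ℝ × W, ℂ) ((1 : ℝ), (0 : W))
      refine ⟨Q1 + (Q2 + Q1.comp D.toLinearMap), hQ1.add (hQ2.add (hQ1.comp D.continuous)),
        fun F m k => ?_⟩
      have h3 : |(k : ℝ)| * SchwartzMap.seminorm ℂ a n (gaborCoeff φ m k F) ≤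
          SchwartzMap.seminorm ℂ a n (gaborCoeff (SchwartzMap.derivCLM ℂ ℂ φ) m k F)
          + SchwartzMap.seminorm ℂ a n (gaborCoeff φ m k (D F)) := by
        have e := congrArg (SchwartzMap.seminorm ℂ a n) (frequency_smul_gaborCoeff φ m k F)
        rw [map_smul_eq_mul] at e
        have e' : ‖(2 * Real.pi * Complex.I * k : ℂ)‖ = 2 * Real.pi * |(k : ℝ)| := by
          simp [abs_of_pos Real.pi_pos]
        rw [e'] at e
        have h4 : |(k : ℝ)| ≤ 2 * Real.pi * |(k : ℝ)| :=
          le_mul_of_one_le_left (abs_nonneg _) (by linarith [Real.pi_gt_three])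
        calc _ ≤ 2 * Real.pi * |(k : ℝ)| * SchwartzMap.seminorm ℂ a n (gaborCoeff φ m k F) := by
              gcongr
          _ ≤ _ := by rw [e]; exact map_add_le_add _ _ _
      have h1F := h1 F m k
      have h2F := h2 F m k
      have h1D := h1 (D F) m k
      rw [pow_zero, one_mul] at h1F h2F h1D ⊢
      set X := SchwartzMap.seminorm ℂ a n (gaborCoeff φ m k F)
      calc (1 + |(k : ℝ)|) ^ (N + 1) * X
          = (1 + |(k : ℝ)|) ^ N * X + (1 + |(k : ℝ)|) ^ N * (|(k : ℝ)| * X) := by ring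
        _ ≤ Q1 F + (1 + |(k : ℝ)|) ^ N *
          (SchwartzMap.seminorm ℂ a n (gaborCoeff (SchwartzMap.derivCLM ℂ ℂ φ) m k F)
          + SchwartzMap.seminorm ℂ a n (gaborCoeff φ m k (D F))) := by gcongr
        _ ≤ Q1 F + (Q2 F + Q1 (D F)) := by
          rw [mul_add]
          exact add_le_add le_rfl (add_le_add h2F h1D)
  | succ M ih =>
    obtain ⟨Q1, hQ1, h1⟩ := ih φ
    obtain ⟨Q2, hQ2, h2⟩ := ih (SchwartzMap.smulLeftCLM ℂ (fun x : ℝ => (x : ℂ)) φ)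
    let D : 𝓢(ℝ × W, ℂ) →L[ℂ] 𝓢(ℝ × W, ℂ) :=
      SchwartzMap.smulLeftCLM ℂ (fun p : ℝ × W => (p.1 : ℂ))
    refine ⟨Q1 + (4 : NNReal) • (Q1.comp D.toLinearMap + Q2),
      hQ1.add (((hQ1.comp D.continuous).add hQ2).const_smul (4 : NNReal)), fun F m k => ?_⟩
    have h3 : |(m : ℝ)| * SchwartzMap.seminorm ℂ a n (gaborCoeff φ m k F) ≤
        4 * (SchwartzMap.seminorm ℂ a n (gaborCoeff φ m k (D F))
        + SchwartzMap.seminorm ℂ a n (gaborCoeff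
          (SchwartzMap.smulLeftCLM ℂ (fun x : ℝ => (x : ℂ)) φ) m k F)) := by
      have e := congrArg (SchwartzMap.seminorm ℂ a n) (translation_smul_gaborCoeff φ m k F)
      rw [map_smul_eq_mul] at e
      have e' : ‖(m : ℂ) / 4‖ = |(m : ℝ)| / 4 := by simp
      rw [e'] at e
      have h4 := map_sub_le_add (SchwartzMap.seminorm ℂ a n) (gaborCoeff φ m k (D F))
        (gaborCoeff (SchwartzMap.smulLeftCLM ℂ (fun x : ℝ => (x : ℂ)) φ) m k F)
      rw [← e] at h4
      linarith
    have h1F := h1 F m k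
    have h2F := h2 F m k
    have h1D := h1 (D F) m k
    set X := SchwartzMap.seminorm ℂ a n (gaborCoeff φ m k F)
    set c := (1 + |(m : ℝ)|) ^ M * (1 + |(k : ℝ)|) ^ N with hc
    calc (1 + |(m : ℝ)|) ^ (M + 1) * (1 + |(k : ℝ)|) ^ N * X
        = c * X + c * (|(m : ℝ)| * X) := by rw [hc]; ring
      _ ≤ Q1 F + c * (4 * (SchwartzMap.seminorm ℂ a n (gaborCoeff φ m k (D F))
        + SchwartzMap.seminorm ℂ a n (gaborCoeff
          (SchwartzMap.smulLeftCLM ℂ (fun x : ℝ => (x : ℂ)) φ) m k F))) := by gcongr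
      _ ≤ Q1 F + 4 * (Q1 (D F) + Q2 F) := by
        have := add_le_add h1D h2F
        rw [← mul_add] at this
        linarith

/-- The function `x ↦ χ(x - m/4) e^{2πikx}`. -/
noncomputable def gaborAtomFn (χ : 𝓢(ℝ, ℂ)) (m k : ℤ) (x : ℝ) : ℂ :=
  χ (x - m / 4) * Complex.exp (2 * Real.pi * Complex.I * k * x)

theorem contDiff_gaborAtomFn (χ : 𝓢(ℝ, ℂ)) (m k : ℤ) : ContDiff ℝ ∞ (gaborAtomFn χ m k) := by
  have h1 : ContDiff ℝ ∞ fun x : ℝ => χ (x - m / 4) := (χ.smooth ⊤).comp (by fun_prop)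
  have h2 : ContDiff ℝ ∞ fun x : ℝ => (2 * Real.pi * Complex.I * k : ℂ) * (x : ℂ) :=
    contDiff_const.mul Complex.ofRealCLM.contDiff
  exact h1.mul h2.cexp

theorem deriv_gaborAtomFn (χ : 𝓢(ℝ, ℂ)) (m k : ℤ) :
    deriv (gaborAtomFn χ m k) = gaborAtomFn (SchwartzMap.derivCLM ℂ ℂ χ) m k
      + (2 * Real.pi * Complex.I * k : ℂ) • gaborAtomFn χ m k := by
  ext s
  have h1 : HasDerivAt (fun s : ℝ => χ (s - m / 4)) (deriv χ (s - m / 4)) s := by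
    exact (χ.hasDerivAt (s - m / 4)).comp_sub_const s _
  have h2 : HasDerivAt (fun s : ℝ => Complex.exp (2 * Real.pi * Complex.I * k * s))
      (Complex.exp (2 * Real.pi * Complex.I * k * s) * (2 * Real.pi * Complex.I * k)) s := by
    have h := ((Complex.ofRealCLM.hasDerivAt (x := s)).const_mul
      (2 * Real.pi * Complex.I * k : ℂ)).cexp
    simpa using h
  refine (h1.mul h2).deriv.trans ?_
  simp only [gaborAtomFn, Pi.add_apply, Pi.smul_apply, smul_eq_mul, SchwartzMap.derivCLM_apply]
  ring

/-- The derivatives of the atoms grow at most polynomially in the translation and in the frequency. -/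
theorem exists_gaborAtomFn_le (a b : ℕ) (χ : 𝓢(ℝ, ℂ)) :
    ∃ C : ℝ, 0 ≤ C ∧ ∀ (m k : ℤ) (x : ℝ), |x| ^ a * ‖iteratedDeriv b (gaborAtomFn χ m k) x‖ ≤
      C * ((1 + |(m : ℝ)|) ^ a * (1 + |(k : ℝ)|) ^ b) := by
  induction b generalizing χ with
  | zero =>
    refine ⟨2 ^ a * ((Finset.Iic (a, 0)).sup fun m => SchwartzMap.seminorm ℝ m.1 m.2) χ,
      by positivity, fun m k x => ?_⟩
    have h1 : ‖gaborAtomFn χ m k x‖ = ‖χ (x - m / 4)‖ := by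
      have := norm_cexp_int_mul (-k) x
      rw [gaborAtomFn, norm_mul]
      simp only [Int.cast_neg, mul_neg, neg_mul, neg_neg] at this
      rw [this, mul_one]
    have h2 := SchwartzMap.one_add_le_sup_seminorm_apply (𝕜 := ℝ) (m := (a, 0)) (k := a) (n := 0)
      le_rfl le_rfl χ (x - m / 4)
    rw [norm_iteratedFDeriv_zero, Real.norm_eq_abs] at h2
    rw [iteratedDeriv_zero, h1, pow_zero, mul_one]
    have h3 : |x| ≤ (1 + |(m : ℝ)|) * (1 + |x - m / 4|) := by
      have h4 : |x| ≤ |x - m / 4| + |(m : ℝ) / 4| := by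
        simpa using abs_add_le (x - m / 4) ((m : ℝ) / 4)
      rw [abs_div, abs_of_pos (by norm_num : (0 : ℝ) < 4)] at h4
      nlinarith [abs_nonneg (m : ℝ), abs_nonneg (x - m / 4),
        mul_nonneg (abs_nonneg (m : ℝ)) (abs_nonneg (x - m / 4))]
    calc |x| ^ a * ‖χ (x - m / 4)‖
        ≤ ((1 + |(m : ℝ)|) * (1 + |x - m / 4|)) ^ a * ‖χ (x - m / 4)‖ := by gcongr
      _ = (1 + |(m : ℝ)|) ^ a * ((1 + |x - m / 4|) ^ a * ‖χ (x - m / 4)‖) := by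
        rw [mul_pow]; ring
      _ ≤ (1 + |(m : ℝ)|) ^ a * _ := mul_le_mul_of_nonneg_left h2 (by positivity)
      _ = _ := by ring
  | succ b ih =>
    obtain ⟨C1, hC1, h1⟩ := ih χ
    obtain ⟨C2, hC2, h2⟩ := ih (SchwartzMap.derivCLM ℂ ℂ χ)
    refine ⟨C2 + 2 * Real.pi * C1, by positivity, fun m k x => ?_⟩
    have e : iteratedDeriv (b + 1) (gaborAtomFn χ m k) x =
        iteratedDeriv b (gaborAtomFn (SchwartzMap.derivCLM ℂ ℂ χ) m k) x
        + (2 * Real.pi * Complex.I * k : ℂ) * iteratedDeriv b (gaborAtomFn χ m k) x := by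
      have c1 : ContDiffAt ℝ b (gaborAtomFn (SchwartzMap.derivCLM ℂ ℂ χ) m k) x :=
        ((contDiff_gaborAtomFn _ m k).of_le (mod_cast le_top)).contDiffAt
      have c2 : ContDiffAt ℝ b (gaborAtomFn χ m k) x :=
        ((contDiff_gaborAtomFn _ m k).of_le (mod_cast le_top)).contDiffAt
      have c3 : ContDiffAt ℝ b ((2 * Real.pi * Complex.I * k : ℂ) • gaborAtomFn χ m k) x :=
        (contDiffAt_const (c := (2 * Real.pi * Complex.I * k : ℂ))).smul c2
      rw [iteratedDeriv_succ', deriv_gaborAtomFn, iteratedDeriv_add c1 c3,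
        iteratedDeriv_const_smul c2, smul_eq_mul]
    have e' : ‖(2 * Real.pi * Complex.I * k : ℂ)‖ = 2 * Real.pi * |(k : ℝ)| := by
      simp [abs_of_pos Real.pi_pos]
    have e3 : ‖iteratedDeriv (b + 1) (gaborAtomFn χ m k) x‖ ≤
        ‖iteratedDeriv b (gaborAtomFn (SchwartzMap.derivCLM ℂ ℂ χ) m k) x‖ +
        2 * Real.pi * |(k : ℝ)| * ‖iteratedDeriv b (gaborAtomFn χ m k) x‖ := by
      rw [e]
      refine (norm_add_le _ _).trans ?_
      rw [norm_mul, e']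
    have h1x := h1 m k x
    have h2x := h2 m k x
    set A := ‖iteratedDeriv b (gaborAtomFn χ m k) x‖
    set B := ‖iteratedDeriv b (gaborAtomFn (SchwartzMap.derivCLM ℂ ℂ χ) m k) x‖
    set c := (1 + |(m : ℝ)|) ^ a * (1 + |(k : ℝ)|) ^ b with hc
    have hc0 : 0 ≤ c := by positivity
    have hk : |(k : ℝ)| ≤ 1 + |(k : ℝ)| := by linarith
    have hk1 : 1 ≤ 1 + |(k : ℝ)| := by linarith [abs_nonneg (k : ℝ)]
    calc |x| ^ a * ‖iteratedDeriv (b + 1) (gaborAtomFn χ m k) x‖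
        ≤ |x| ^ a * (B + 2 * Real.pi * |(k : ℝ)| * A) := by gcongr
      _ = |x| ^ a * B + 2 * Real.pi * |(k : ℝ)| * (|x| ^ a * A) := by ring
      _ ≤ C2 * c * (1 + |(k : ℝ)|) + 2 * Real.pi * (1 + |(k : ℝ)|) * (C1 * c) := by
        have : C2 * c ≤ C2 * c * (1 + |(k : ℝ)|) := le_mul_of_one_le_right (by positivity) hk1
        refine add_le_add (h2x.trans this) ?_
        gcongr
      _ = _ := by rw [hc]; ring

/-- The Gabor atom `x ↦ χ(x - m/4) e^{2πikx}` as a Schwartz function. -/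
noncomputable def gaborAtom (χ : 𝓢(ℝ, ℂ)) (m k : ℤ) : 𝓢(ℝ, ℂ) where
  toFun := gaborAtomFn χ m k
  smooth' := contDiff_gaborAtomFn χ m k
  decay' a b := by
    obtain ⟨C, _, h⟩ := exists_gaborAtomFn_le a b χ
    refine ⟨C * ((1 + |(m : ℝ)|) ^ a * (1 + |(k : ℝ)|) ^ b), fun x => ?_⟩
    rw [norm_iteratedFDeriv_eq_norm_iteratedDeriv, Real.norm_eq_abs]
    exact h m k x

theorem gaborAtom_apply (χ : 𝓢(ℝ, ℂ)) (m k : ℤ) (x : ℝ) : gaborAtom χ m k x =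
    χ (x - m / 4) * Complex.exp (2 * Real.pi * Complex.I * k * x) := rfl

theorem exists_seminorm_gaborAtom_le (χ : 𝓢(ℝ, ℂ)) (a b : ℕ) :
    ∃ C : ℝ, 0 ≤ C ∧ ∀ m k : ℤ, SchwartzMap.seminorm ℂ a b (gaborAtom χ m k) ≤
      C * ((1 + |(m : ℝ)|) ^ a * (1 + |(k : ℝ)|) ^ b) := by
  obtain ⟨C, hC, h⟩ := exists_gaborAtomFn_le a b χ
  refine ⟨C, hC, fun m k => ?_⟩
  refine SchwartzMap.seminorm_le_bound ℂ a b _ (by positivity) fun x => ?_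
  rw [norm_iteratedFDeriv_eq_norm_iteratedDeriv, Real.norm_eq_abs]
  exact h m k x

end Gabor

/-! ### The Gabor expansion of a Schwartz function -/

section GaborExpansion

variable {W : Type*} [NormedAddCommGroup W] [NormedSpace ℝ W]

theorem Seminorm.map_sum_le_sum {X α : Type*} [AddCommGroup X] [Module ℂ X] (q : Seminorm ℂ X)
    (x : α → X) (t : Finset α) : q (∑ a ∈ t, x a) ≤ ∑ a ∈ t, q (x a) := by
  classical
  induction t using Finset.induction_on with
  | empty => simp
  | insert a t ha ih =>
    rw [Finset.sum_insert ha, Finset.sum_insert ha]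
    exact (map_add_le_add q _ _).trans (add_le_add le_rfl ih)

/-- Absolute convergence with respect to every seminorm of a complete space implies convergence. -/
theorem WithSeminorms.summable_of_summable {X ι α : Type*} [AddCommGroup X] [Module ℂ X]
    [UniformSpace X] [IsUniformAddGroup X] [CompleteSpace X] {p : SeminormFamily ℂ X ι}
    (hp : WithSeminorms p) {x : α → X} (h : ∀ i, Summable fun a => p i (x a)) : Summable x := by
  rw [summable_iff_vanishing]
  intro e he
  obtain ⟨⟨s, r⟩, hr, hsub⟩ := hp.hasBasis_zero_ball.mem_iff.1 he
  have hs : Summable fun a => s.sup p (x a) := by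
    refine Summable.of_nonneg_of_le (fun a => apply_nonneg _ _) (fun a => ?_)
      (summable_sum (s := s) fun i _ => h i)
    refine Seminorm.finset_sup_apply_le (Finset.sum_nonneg fun i _ => apply_nonneg _ _)
      fun i hi => ?_
    exact Finset.single_le_sum (f := fun i => p i (x a)) (fun i _ => apply_nonneg _ _) hi
  obtain ⟨t, ht⟩ := summable_iff_vanishing_norm.1 hs r hr
  refine ⟨t, fun t' ht' => hsub ?_⟩
  rw [Seminorm.mem_ball_zero]
  refine lt_of_le_of_lt (Seminorm.map_sum_le_sum _ _ _) (lt_of_le_of_lt (le_abs_self _) (ht t' ht'))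

theorem Seminorm.le_tsum_of_hasSum {X α : Type*} [AddCommGroup X] [Module ℂ X]
    [TopologicalSpace X] {q : Seminorm ℂ X} (hq : Continuous q) {x : α → X} {y : X}
    (hx : HasSum x y) (hs : Summable fun a => q (x a)) : q y ≤ ∑' a, q (x a) := by
  refine le_of_tendsto ((hq.tendsto y).comp hx) (Eventually.of_forall fun t => ?_)
  exact (Seminorm.map_sum_le_sum q x t).trans
    (hs.sum_le_tsum t fun a _ => apply_nonneg _ _)

/-- Evaluation of Schwartz functions at a point. -/
noncomputable def SchwartzMap.evalPt {E : Type*} [NormedAddCommGroup E] [NormedSpace ℝ E] (x : E) :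
    𝓢(E, ℂ) →L[ℂ] ℂ :=
  SchwartzMap.mkCLMtoNormedSpace (fun f => f x) (fun _ _ => rfl) (fun _ _ => rfl)
    ⟨{0}, 1, zero_le_one, fun f => by
      simpa using SchwartzMap.norm_le_seminorm ℂ f x⟩

@[simp]
theorem SchwartzMap.evalPt_apply {E : Type*} [NormedAddCommGroup E] [NormedSpace ℝ E] (x : E)
    (f : 𝓢(E, ℂ)) : SchwartzMap.evalPt x f = f x := rfl

/-- The restriction `s ↦ F (s, w)` of a Schwartz function of two variables. -/
noncomputable def SchwartzMap.slice (w : W) : 𝓢(ℝ × W, ℂ) →L[ℂ] 𝓢(ℝ, ℂ) :=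
  SchwartzMap.compCLM ℂ (g := fun s : ℝ => (s, w))
    (by
      have h : (fun s : ℝ => (s, w)) = fun s =>
          ContinuousLinearMap.inl ℝ ℝ W s + (0, w) := by ext s <;> simp
      rw [h]
      exact (ContinuousLinearMap.hasTemperateGrowth _).add (.const _))
    ⟨1, 1, fun s => by
      have : ‖s‖ ≤ ‖(s, w)‖ := norm_fst_le (s, w)
      rw [one_mul, pow_one]; linarith⟩

@[simp]
theorem SchwartzMap.slice_apply (w : W) (F : 𝓢(ℝ × W, ℂ)) (s : ℝ) :
    SchwartzMap.slice w F s = F (s, w) := rfl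

theorem contDiff_smoothTransition : ContDiff ℝ ∞ Real.smoothTransition :=
  Real.smoothTransition.contDiff

theorem partitionFn_eq_zero {x : ℝ} (hx : x ≤ 0 ∨ 1 / 2 ≤ x) :
    Real.smoothTransition (4 * x) - Real.smoothTransition (4 * x - 1) = 0 := by
  rcases hx with hx | hx
  · rw [Real.smoothTransition.zero_of_nonpos (by linarith),
      Real.smoothTransition.zero_of_nonpos (by linarith), sub_zero]
  · rw [Real.smoothTransition.one_of_one_le (by linarith),
      Real.smoothTransition.one_of_one_le (by linarith), sub_self]

theorem cutoffFn_eq_zero {x : ℝ} (hx : x ≤ -(1 / 8) ∨ 5 / 8 ≤ x) :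
    Real.smoothTransition (8 * x + 1) * Real.smoothTransition (5 - 8 * x) = 0 := by
  rcases hx with hx | hx
  · rw [Real.smoothTransition.zero_of_nonpos (x := 8 * x + 1) (by linarith), zero_mul]
  · rw [Real.smoothTransition.zero_of_nonpos (x := 5 - 8 * x) (by linarith), mul_zero]

theorem cutoffFn_eq_one {x : ℝ} (hx : 0 ≤ x) (hx' : x ≤ 1 / 2) :
    Real.smoothTransition (8 * x + 1) * Real.smoothTransition (5 - 8 * x) = 1 := by
  rw [Real.smoothTransition.one_of_one_le (by linarith),
      Real.smoothTransition.one_of_one_le (by linarith), mul_one]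

/-- A smooth function with support in `[0, 1/2]` whose translates by `ℤ/4` form a partition of
unity. -/
noncomputable def partitionWindow : 𝓢(ℝ, ℂ) :=
  HasCompactSupport.toSchwartzMap
    (f := fun x : ℝ =>
      ((Real.smoothTransition (4 * x) - Real.smoothTransition (4 * x - 1) : ℝ) : ℂ))
    (HasCompactSupport.intro (isCompact_Icc (a := (0 : ℝ)) (b := 1 / 2)) fun x hx => by
      rw [partitionFn_eq_zero, Complex.ofReal_zero]
      by_contra! h
      exact hx ⟨h.1.le, h.2.le⟩)
    (Complex.ofRealCLM.contDiff.comp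
      ((contDiff_smoothTransition.comp (by fun_prop)).sub
        (contDiff_smoothTransition.comp (by fun_prop))))

/-- A smooth function with support in `[-1/8, 5/8]` that is `1` on the support of
`partitionWindow`. The length of the support is less than `1`, so that products with translates by
nonzero integers of `partitionWindow` vanish. -/
noncomputable def cutoffWindow : 𝓢(ℝ, ℂ) :=
  HasCompactSupport.toSchwartzMap
    (f := fun x : ℝ =>
      ((Real.smoothTransition (8 * x + 1) * Real.smoothTransition (5 - 8 * x) : ℝ) : ℂ))
    (HasCompactSupport.intro (isCompact_Icc (a := (-(1 / 8) : ℝ)) (b := 5 / 8)) fun x hx => by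
      rw [cutoffFn_eq_zero, Complex.ofReal_zero]
      by_contra! h
      exact hx ⟨h.1.le, h.2.le⟩)
    (Complex.ofRealCLM.contDiff.comp
      ((contDiff_smoothTransition.comp (by fun_prop)).mul
        (contDiff_smoothTransition.comp (by fun_prop))))

theorem partitionWindow_apply (x : ℝ) : partitionWindow x =
    ((Real.smoothTransition (4 * x) - Real.smoothTransition (4 * x - 1) : ℝ) : ℂ) := rfl

theorem cutoffWindow_apply (x : ℝ) : cutoffWindow x =
    ((Real.smoothTransition (8 * x + 1) * Real.smoothTransition (5 - 8 * x) : ℝ) : ℂ) := rfl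

theorem partitionWindow_eq_zero {x : ℝ} (hx : x ≤ 0 ∨ 1 / 2 ≤ x) : partitionWindow x = 0 := by
  rw [partitionWindow_apply, partitionFn_eq_zero hx, Complex.ofReal_zero]

/-- In the periodization of `partitionWindow` only the term `j = 0` meets the support of
`cutoffWindow`. -/
theorem cutoffWindow_mul_partitionWindow (x : ℝ) (j : ℤ) :
    cutoffWindow x * partitionWindow (x + j) = if j = 0 then partitionWindow x else 0 := by
  split_ifs with hj
  · rw [hj, Int.cast_zero, add_zero]
    by_cases hx : x ≤ 0 ∨ 1 / 2 ≤ x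
    · rw [partitionWindow_eq_zero hx, mul_zero]
    · push Not at hx
      rw [cutoffWindow_apply, cutoffFn_eq_one hx.1.le hx.2.le, Complex.ofReal_one, one_mul]
  · by_cases hx : x + j ≤ 0 ∨ 1 / 2 ≤ x + j
    · rw [partitionWindow_eq_zero hx, mul_zero]
    · push Not at hx
      rw [cutoffWindow_apply, cutoffFn_eq_zero, Complex.ofReal_zero, zero_mul]
      rcases lt_or_gt_of_ne hj with h | h
      · right
        have : (j : ℝ) ≤ -1 := by exact_mod_cast Int.le_sub_one_of_lt h
        linarith [hx.1]
      · left
        have : (1 : ℝ) ≤ j := by exact_mod_cast h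
        linarith [hx.2]

theorem hasSum_partitionWindow (x : ℝ) :
    HasSum (fun m : ℤ => partitionWindow (x - m / 4)) 1 := by
  -- only two translates are nonzero at `x`, and their sum telescopes
  have h0 : ∀ m ∉ ({⌊4 * x⌋ - 1, ⌊4 * x⌋} : Finset ℤ), partitionWindow (x - m / 4) = 0 := by
    intro m hm
    simp only [Finset.mem_insert, Finset.mem_singleton, not_or] at hm
    apply partitionWindow_eq_zero
    rcases lt_or_gt_of_ne hm.2 with h | h
    · right
      have h2 : m ≤ ⌊4 * x⌋ - 2 := by omega
      have h3 : (m : ℝ) ≤ ⌊4 * x⌋ - 2 := by exact_mod_cast h2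
      linarith [Int.floor_le (4 * x)]
    · left
      have h2 : ⌊4 * x⌋ + 1 ≤ m := by omega
      have h3 : (⌊4 * x⌋ : ℝ) + 1 ≤ m := by exact_mod_cast h2
      linarith [Int.lt_floor_add_one (4 * x)]
  have h := hasSum_sum_of_ne_finset_zero (L := SummationFilter.unconditional ℤ) h0
  rw [Finset.sum_pair (by omega)] at h
  convert h using 1
  rw [partitionWindow_apply, partitionWindow_apply, ← Complex.ofReal_add]
  have l1 := Int.floor_le (4 * x)
  have l2 := Int.lt_floor_add_one (4 * x)
  have e1 : 4 * (x - ((⌊4 * x⌋ - 1 : ℤ) : ℝ) / 4) = 4 * x - ⌊4 * x⌋ + 1 := by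
    push_cast; ring
  have e2 : 4 * (x - (⌊4 * x⌋ : ℝ) / 4) = 4 * x - ⌊4 * x⌋ := by ring
  rw [e1, e2, Real.smoothTransition.one_of_one_le (x := 4 * x - ⌊4 * x⌋ + 1) (by linarith),
    Real.smoothTransition.zero_of_nonpos (x := 4 * x - ⌊4 * x⌋ - 1) (by linarith)]
  push_cast
  ring_nf

/-- The product of a translate of `φ` with a slice of `F`. -/
noncomputable def windowedSlice (φ : 𝓢(ℝ, ℂ)) (m : ℤ) (F : 𝓢(ℝ × W, ℂ)) (w : W) : 𝓢(ℝ, ℂ) :=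
  SchwartzMap.smulLeftCLM ℂ (fun s => φ (s - m / 4)) (SchwartzMap.slice w F)

theorem windowedSlice_apply (φ : 𝓢(ℝ, ℂ)) (m : ℤ) (F : 𝓢(ℝ × W, ℂ)) (w : W) (s : ℝ) :
    windowedSlice φ m F w s = φ (s - m / 4) * F (s, w) := by
  have h : (fun s : ℝ => φ (s - m / 4)).HasTemperateGrowth :=
    (SchwartzMap.compSubConstCLM ℂ ((m : ℝ) / 4) φ).hasTemperateGrowth
  rw [windowedSlice, SchwartzMap.smulLeftCLM_apply_apply h]
  rfl

open scoped FourierTransform in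
theorem gaborCoeff_apply_eq_fourier (φ : 𝓢(ℝ, ℂ)) (m k : ℤ) (F : 𝓢(ℝ × W, ℂ)) (w : W) :
    gaborCoeff φ m k F w = 𝓕 (windowedSlice φ m F w) (k : ℝ) := by
  rw [SchwartzMap.fourier_coe, Real.fourier_real_eq_integral_exp_smul, gaborCoeff_apply]
  refine integral_congr_ae (Eventually.of_forall fun s => ?_)
  simp only [gaborWindow_apply, windowedSlice_apply, smul_eq_mul]
  have : ((-2 * Real.pi * s * (k : ℝ) : ℝ) : ℂ) * Complex.I
      = -(2 * Real.pi * Complex.I * k * s) := by push_cast; ring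
  rw [this]
  ring

/-- Poisson summation: the sum over the frequencies is the periodization of the `m`-th piece of `F`, and
the factor `cutoffWindow` cuts out one period. -/
theorem tsum_gaborAtom_mul_gaborCoeff (F : 𝓢(ℝ × W, ℂ)) (m : ℤ) (x : ℝ) (w : W) :
    ∑' k : ℤ, gaborAtom cutoffWindow m k x * gaborCoeff partitionWindow m k F w =
      partitionWindow (x - m / 4) * F (x, w) := by
  have h := SchwartzMap.tsum_eq_tsum_fourier (windowedSlice partitionWindow m F w) x
  have h2 : ∀ k : ℤ, gaborAtom cutoffWindow m k x * gaborCoeff partitionWindow m k F w =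
      cutoffWindow (x - m / 4) * (FourierTransform.fourier (windowedSlice partitionWindow m F w)
        (k : ℝ) * fourier k (x : UnitAddCircle)) := by
    intro k
    rw [gaborAtom_apply, gaborCoeff_apply_eq_fourier, fourier_coe_apply]
    simp only [Complex.ofReal_one, div_one]
    ring
  simp_rw [h2]
  rw [tsum_mul_left]
  rw [← h, ← tsum_mul_left, tsum_eq_single 0]
  · have := cutoffWindow_mul_partitionWindow (x - m / 4) 0
    rw [windowedSlice_apply]
    simp only [Int.cast_zero, add_zero, if_true] at this ⊢
    rw [← mul_assoc, this]
  · intro j hj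
    have := cutoffWindow_mul_partitionWindow (x - m / 4) j
    rw [if_neg hj] at this
    rw [windowedSlice_apply, ← mul_assoc, show x + (j : ℝ) - m / 4 = x - m / 4 + j by ring, this,
      zero_mul]

/-- The summable weight on `ℤ × ℤ`. -/
noncomputable def gaborWeight (i : ℤ × ℤ) : ℝ :=
  ((1 + |(i.1 : ℝ)|) ^ 2)⁻¹ * ((1 + |(i.2 : ℝ)|) ^ 2)⁻¹

theorem summable_gaborWeight : Summable gaborWeight := by
  have h : Summable fun m : ℤ => ((1 + |(m : ℝ)|) ^ 2)⁻¹ := by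
    have h1 : Summable fun m : ℤ => 1 / |(m : ℝ)| ^ 2 := by
      have := Real.summable_one_div_int_pow (p := 2)
      simpa [sq_abs] using this.2 one_lt_two
    refine Summable.of_nonneg_of_le (fun m => by positivity) (fun m => ?_)
      (h1.add (hasSum_ite_eq (0 : ℤ) (1 : ℝ)).summable)
    split_ifs with hm
    · simp [hm]
    · rw [add_zero, one_div]
      have : 0 < |(m : ℝ)| := abs_pos.2 (by exact_mod_cast hm)
      gcongr
      linarith
  exact h.mul_of_nonneg h (fun _ => by positivity) (fun _ => by positivity)

theorem exists_seminorm_le_sum {E : Type*} [NormedAddCommGroup E] [NormedSpace ℝ E]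
    {p : Seminorm ℂ 𝓢(E, ℂ)} (hp : Continuous p) :
    ∃ (s : Finset (ℕ × ℕ)) (C : ℝ), 0 ≤ C ∧
      ∀ f, p f ≤ C * ∑ i ∈ s, SchwartzMap.seminorm ℂ i.1 i.2 f := by
  obtain ⟨s, C, -, h⟩ := Seminorm.bound_of_continuous (schwartz_withSeminorms ℂ E ℂ) p hp
  refine ⟨s, C, C.2, fun f => (h f).trans ?_⟩
  change (C : ℝ) * _ ≤ _
  refine mul_le_mul_of_nonneg_left ?_ C.2
  refine Seminorm.finset_sup_apply_le (Finset.sum_nonneg fun i _ => apply_nonneg _ _) fun i hi => ?_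
  exact Finset.single_le_sum (f := fun i : ℕ × ℕ => SchwartzMap.seminorm ℂ i.1 i.2 f)
    (fun i _ => apply_nonneg _ _) hi

theorem exists_gaborAtom_le_of_continuous {p : Seminorm ℂ 𝓢(ℝ, ℂ)} (hp : Continuous p)
    (χ : 𝓢(ℝ, ℂ)) : ∃ (C : ℝ) (N : ℕ), 0 ≤ C ∧ ∀ m k : ℤ,
      p (gaborAtom χ m k) ≤ C * ((1 + |(m : ℝ)|) ^ N * (1 + |(k : ℝ)|) ^ N) := by
  obtain ⟨s, C, hC, h⟩ := exists_seminorm_le_sum hp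
  choose D hD h' using fun i : ℕ × ℕ => exists_seminorm_gaborAtom_le χ i.1 i.2
  refine ⟨C * ∑ i ∈ s, D i, s.sup fun i => max i.1 i.2,
    mul_nonneg hC (Finset.sum_nonneg fun i _ => hD i), fun m k => (h _).trans ?_⟩
  rw [mul_assoc, Finset.sum_mul]
  refine mul_le_mul_of_nonneg_left (Finset.sum_le_sum fun i hi => (h' i m k).trans ?_) hC
  have hi' : max i.1 i.2 ≤ s.sup fun i => max i.1 i.2 := Finset.le_sup (f := fun i => max i.1 i.2) hi
  refine mul_le_mul_of_nonneg_left ?_ (hD i)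
  have := hD i
  gcongr
  · linarith [abs_nonneg (m : ℝ)]
  · exact (le_max_left _ _).trans hi'
  · linarith [abs_nonneg (k : ℝ)]
  · exact (le_max_right _ _).trans hi'

theorem exists_gaborCoeff_le_of_continuous {q : Seminorm ℂ 𝓢(W, ℂ)} (hq : Continuous q)
    (φ : 𝓢(ℝ, ℂ)) (N : ℕ) : ∃ Q : Seminorm ℂ 𝓢(ℝ × W, ℂ), Continuous Q ∧
      ∀ (F : 𝓢(ℝ × W, ℂ)) (m k : ℤ),
      (1 + |(m : ℝ)|) ^ N * (1 + |(k : ℝ)|) ^ N * q (gaborCoeff φ m k F) ≤ Q F := by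
  obtain ⟨s, C, hC, h⟩ := exists_seminorm_le_sum hq
  choose Q hQ h' using fun i : ℕ × ℕ => exists_seminorm_gaborCoeff_le (W := W) N N i.1 i.2 φ
  refine ⟨C.toNNReal • ∑ i ∈ s, Q i,
    (Seminorm.continuous_finsetSum fun i _ => hQ i).const_smul C.toNNReal, fun F m k => ?_⟩
  have e : (C.toNNReal • ∑ i ∈ s, Q i) F = C * ∑ i ∈ s, Q i F := by
    change (C.toNNReal : ℝ) * (∑ i ∈ s, Q i) F = _
    rw [Real.coe_toNNReal _ hC, Seminorm.sum_apply']
  rw [e]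
  refine (mul_le_mul_of_nonneg_left (h _) (by positivity)).trans ?_
  rw [mul_left_comm, Finset.mul_sum]
  exact mul_le_mul_of_nonneg_left (Finset.sum_le_sum fun i _ => h' i F m k) hC

/-- The rapid decrease of the coefficients beats the polynomial growth of the atoms, in arbitrary
continuous seminorms of the two factors. With the exponent `N + 2` for the coefficients a summable weight is left. -/
theorem exists_seminorm_atom_mul_coeff_le {p : Seminorm ℂ 𝓢(ℝ, ℂ)} {q : Seminorm ℂ 𝓢(W, ℂ)}
    (hp : Continuous p) (hq : Continuous q) (χ φ : 𝓢(ℝ, ℂ)) :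
    ∃ Q : Seminorm ℂ 𝓢(ℝ × W, ℂ), Continuous Q ∧ ∀ (F : 𝓢(ℝ × W, ℂ)) (i : ℤ × ℤ),
      p (gaborAtom χ i.1 i.2) * q (gaborCoeff φ i.1 i.2 F) ≤ Q F * gaborWeight i := by
  obtain ⟨C, N, hC, hp'⟩ := exists_gaborAtom_le_of_continuous hp χ
  obtain ⟨Q, hQ, hq'⟩ := exists_gaborCoeff_le_of_continuous hq φ (N + 2)
  refine ⟨C.toNNReal • Q, hQ.const_smul C.toNNReal, fun F i => ?_⟩
  have e : (C.toNNReal • Q) F = C * Q F := by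
    change (C.toNNReal : ℝ) * Q F = _
    rw [Real.coe_toNNReal _ hC]
  rw [e, gaborWeight, ← mul_inv, ← div_eq_mul_inv, le_div_iff₀ (by positivity)]
  have h1 := hp' i.1 i.2
  have h2 := hq' F i.1 i.2
  set A := 1 + |(i.1 : ℝ)|
  set B := 1 + |(i.2 : ℝ)|
  calc p (gaborAtom χ i.1 i.2) * q (gaborCoeff φ i.1 i.2 F) * (A ^ 2 * B ^ 2)
      ≤ C * (A ^ N * B ^ N) * q (gaborCoeff φ i.1 i.2 F) * (A ^ 2 * B ^ 2) := by
        gcongr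
    _ = C * (A ^ (N + 2) * B ^ (N + 2) * q (gaborCoeff φ i.1 i.2 F)) := by ring
    _ ≤ C * Q F := by gcongr

/-- The expansion `F = ∑ (atom) ⊗ (coefficient)` converges in `𝓢(ℝ × W)`. -/
theorem hasSum_gaborAtom_tensor_gaborCoeff (F : 𝓢(ℝ × W, ℂ)) :
    HasSum (fun i : ℤ × ℤ => (gaborAtom cutoffWindow i.1 i.2).tensor
      (gaborCoeff partitionWindow i.1 i.2 F)) F := by
  have hs : Summable (fun i : ℤ × ℤ => (gaborAtom cutoffWindow i.1 i.2).tensor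
      (gaborCoeff partitionWindow i.1 i.2 F)) := by
    refine (schwartz_withSeminorms ℂ (ℝ × W) ℂ).summable_of_summable fun kn => ?_
    obtain ⟨Q, -, hQ⟩ := exists_seminorm_atom_mul_coeff_le (W := W)
      (continuous_tensorSeminorm kn.1 kn.2) (continuous_tensorSeminorm kn.1 kn.2)
      cutoffWindow partitionWindow
    refine Summable.of_nonneg_of_le (fun i => apply_nonneg _ _) (fun i => ?_)
      (summable_gaborWeight.mul_left (2 ^ kn.2 * Q F))
    refine (SchwartzMap.seminorm_tensor_le _ _ kn.1 kn.2).trans ?_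
    rw [mul_assoc]
    exact mul_le_mul_of_nonneg_left (hQ F i) (by positivity)
  obtain ⟨G, hG⟩ := hs
  have hGF : G = F := by
    ext ⟨x, w⟩
    have h1 := hG.mapL (SchwartzMap.evalPt (x, w))
    simp only [SchwartzMap.evalPt_apply, SchwartzMap.tensor_apply] at h1
    rw [← h1.tsum_eq, h1.summable.tsum_prod]
    simp_rw [tsum_gaborAtom_mul_gaborCoeff]
    rw [tsum_mul_right, (hasSum_partitionWindow x).tsum_eq, one_mul]
  rwa [hGF] at hG

end GaborExpansion

/-! ### Completed tensor products of Schwartz spaces -/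

instance SchwartzMap.instUniformContinuousConstSMul {E : Type*} [NormedAddCommGroup E]
    [NormedSpace ℝ E] : UniformContinuousConstSMul ℂ 𝓢(E, ℂ) :=
  uniformContinuousConstSMul_of_continuousConstSMul ℂ _

section TensorIso

variable {E W : Type*} [AddCommGroup E] [Module ℂ E] [TopologicalSpace E]
  [NormedAddCommGroup W] [NormedSpace ℝ W]

/-- The linear functional `f ↦ ∫ φ(s - m/4) e^{-2πiks} f(s) ds`. -/
noncomputable def gaborFunctional (φ : 𝓢(ℝ, ℂ)) (m k : ℤ) (f : 𝓢(ℝ, ℂ)) : ℂ :=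
  ∫ s, gaborWindow φ m k s * f s

theorem gaborCoeff_tensor (φ f : 𝓢(ℝ, ℂ)) (m k : ℤ) (h : 𝓢(W, ℂ)) :
    gaborCoeff φ m k (f.tensor h) = gaborFunctional φ m k f • h := by
  ext w
  rw [gaborCoeff_apply, smul_apply, smul_eq_mul, gaborFunctional, ← integral_mul_const]
  simp only [SchwartzMap.tensor_apply, mul_assoc]

theorem gaborCoeff_add (φ : 𝓢(ℝ, ℂ)) (m k : ℤ) (F G : 𝓢(ℝ × W, ℂ)) :
    gaborCoeff φ m k (F + G) = gaborCoeff φ m k F + gaborCoeff φ m k G := by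
  ext w
  rw [add_apply, gaborCoeff_apply, gaborCoeff_apply, gaborCoeff_apply,
    ← integral_add (SchwartzMap.integrable_bcf_mul _ F w) (SchwartzMap.integrable_bcf_mul _ G w)]
  simp only [add_apply, mul_add]

/-- The Gabor expansion of a function of one variable, obtained by restricting the expansion of
`f ⊗ h` to a point where `h` is `1`. -/
theorem hasSum_gaborFunctional_smul (f : 𝓢(ℝ, ℂ)) :
    HasSum (fun i : ℤ × ℤ => gaborFunctional partitionWindow i.1 i.2 f •
      gaborAtom cutoffWindow i.1 i.2) f := by
  have h := (hasSum_gaborAtom_tensor_gaborCoeff (f.tensor cutoffWindow)).mapL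
    (SchwartzMap.slice (0 : ℝ))
  have h0 : cutoffWindow 0 = 1 := by
    rw [cutoffWindow_apply, cutoffFn_eq_one le_rfl (by norm_num), Complex.ofReal_one]
  have e1 : SchwartzMap.slice (0 : ℝ) (f.tensor cutoffWindow) = f := by
    ext s; simp [h0]
  rw [e1] at h
  refine h.congr_fun fun i => ?_
  ext s
  simp [gaborCoeff_tensor, h0, mul_comm]

theorem continuous_projSeminorm {F : Type*} [AddCommGroup F] [Module ℂ F] [TopologicalSpace F]
    (s : Seminorm ℂ (ProjTensor E F)) (p : Seminorm ℂ E) (q : Seminorm ℂ F) (hp : Continuous p)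
    (hq : Continuous q) (h : ∀ x y, s (ProjTensor.tmul x y) ≤ p x * q y) : Continuous s :=
  (projTensor_withSeminorms E F).continuous_seminorm ⟨s, p, q, hp, hq, h⟩

omit [TopologicalSpace E] in
theorem ProjTensor.induction_on {F : Type*} [AddCommGroup F] [Module ℂ F]
    {P : ProjTensor E F → Prop} (t : ProjTensor E F) (zero : P 0)
    (tmul : ∀ x y, P (ProjTensor.tmul x y)) (add : ∀ x y, P x → P y → P (x + y)) : P t :=
  TensorProduct.induction_on (motive := P) t zero tmul add

omit [TopologicalSpace E] in
theorem ProjTensor.smul_tmul' {F : Type*} [AddCommGroup F] [Module ℂ F] (c : ℂ) (x : E) (y : F) :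
    ProjTensor.tmul (c • x) y = c • ProjTensor.tmul x y :=
  (TensorProduct.smul_tmul' c x y).symm

omit [TopologicalSpace E] in
theorem ProjTensor.tmul_smul' {F : Type*} [AddCommGroup F] [Module ℂ F] (c : ℂ) (x : E) (y : F) :
    ProjTensor.tmul x (c • y) = c • ProjTensor.tmul x y :=
  TensorProduct.tmul_smul c x y

/-- The continuous linear map `x ↦ x ⊗ y`. -/
noncomputable def ProjTensor.mkLeft [IsTopologicalAddGroup E] [ContinuousSMul ℂ E] {F : Type*}
    [AddCommGroup F] [Module ℂ F] [TopologicalSpace F] (y : F) : E →L[ℂ] ProjTensor E F where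
  toFun x := ProjTensor.tmul x y
  map_add' x x' := TensorProduct.add_tmul x x' y
  map_smul' c x := ProjTensor.smul_tmul' c x y
  cont := by
    refine WithSeminorms.continuous_of_continuous_comp (projTensor_withSeminorms E F)
      ({ toFun := fun x => ProjTensor.tmul x y
         map_add' := fun x x' => TensorProduct.add_tmul x x' y
         map_smul' := fun c x => ProjTensor.smul_tmul' c x y } : E →ₗ[ℂ] ProjTensor E F) ?_
    rintro ⟨s, p, q, hp, hq, h⟩
    refine Seminorm.continuous_of_le (q := (q y).toNNReal • p) (hp.const_smul (q y).toNNReal)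
      fun x => ?_
    change s (ProjTensor.tmul x y) ≤ ((q y).toNNReal : ℝ) * p x
    rw [Real.coe_toNNReal _ (apply_nonneg _ _), mul_comm]
    exact h x y

/-- The linear map `x ⊗ h ↦ (e x) ⊗ h` to the Schwartz functions of two variables, for a
topological isomorphism `e` from `E` to `𝓢(ℝ)`. -/
noncomputable def tensorToSchwartzLM (e : E ≃L[ℂ] 𝓢(ℝ, ℂ)) :
    ProjTensor E 𝓢(W, ℂ) →ₗ[ℂ] 𝓢(ℝ × W, ℂ) :=
  TensorProduct.lift (LinearMap.mk₂ ℂ (fun x h => (e x).tensor h)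
    (fun x x' h => by ext p; simp [add_mul]) (fun c x h => by ext p; simp [mul_assoc])
    (fun x h h' => by ext p; simp [mul_add]) (fun c x h => by ext p; simp [mul_left_comm]))

theorem tensorToSchwartzLM_tmul (e : E ≃L[ℂ] 𝓢(ℝ, ℂ)) (x : E) (h : 𝓢(W, ℂ)) :
    tensorToSchwartzLM e (ProjTensor.tmul x h) = (e x).tensor h :=
  TensorProduct.lift.tmul x h

theorem continuous_tensorToSchwartzLM (e : E ≃L[ℂ] 𝓢(ℝ, ℂ)) :
    Continuous (tensorToSchwartzLM (W := W) e) := by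
  refine WithSeminorms.continuous_of_continuous_comp (schwartz_withSeminorms ℂ (ℝ × W) ℂ) _ ?_
  rintro ⟨k, n⟩
  refine continuous_projSeminorm _
    (((2 : NNReal) ^ n) • (tensorSeminorm ℝ k n).comp e.toLinearEquiv.toLinearMap)
    (tensorSeminorm W k n)
    (((continuous_tensorSeminorm k n).comp e.continuous).const_smul ((2 : NNReal) ^ n))
    (continuous_tensorSeminorm k n) fun x h => ?_
  change SchwartzMap.seminorm ℂ k n (tensorToSchwartzLM e (ProjTensor.tmul x h)) ≤
    ((2 ^ n : NNReal) : ℝ) * tensorSeminorm ℝ k n (e x) * _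
  rw [tensorToSchwartzLM_tmul, mul_assoc]
  exact_mod_cast SchwartzMap.seminorm_tensor_le (e x) h k n

/-- `tensorToSchwartzLM` as a continuous linear map. -/
noncomputable def tensorToSchwartz (e : E ≃L[ℂ] 𝓢(ℝ, ℂ)) :
    ProjTensor E 𝓢(W, ℂ) →L[ℂ] 𝓢(ℝ × W, ℂ) :=
  ⟨tensorToSchwartzLM e, continuous_tensorToSchwartzLM e⟩

theorem tensorToSchwartz_tmul (e : E ≃L[ℂ] 𝓢(ℝ, ℂ)) (x : E) (h : 𝓢(W, ℂ)) :
    tensorToSchwartz e (ProjTensor.tmul x h) = (e x).tensor h :=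
  tensorToSchwartzLM_tmul e x h

/-- Every tensor is the sum, in the projective topology, of the Gabor expansion of the function it
defines. -/
theorem hasSum_tmul_gaborAtom (e : E ≃L[ℂ] 𝓢(ℝ, ℂ)) (t : ProjTensor E 𝓢(W, ℂ)) :
    HasSum (fun i : ℤ × ℤ => ProjTensor.tmul (e.symm (gaborAtom cutoffWindow i.1 i.2))
      (gaborCoeff partitionWindow i.1 i.2 (tensorToSchwartz e t))) t := by
  have : IsTopologicalAddGroup E := e.toHomeomorph.isInducing.topologicalAddGroup e
  have : ContinuousSMul ℂ E := e.toHomeomorph.isInducing.continuousSMul continuous_id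
    (fun {c x} => map_smul e c x)
  induction t using ProjTensor.induction_on with
  | zero =>
    have h : ∀ i : ℤ × ℤ, ProjTensor.tmul (e.symm (gaborAtom cutoffWindow i.1 i.2))
      (gaborCoeff partitionWindow i.1 i.2 (tensorToSchwartz (W := W) e 0)) = 0 := fun i => by
      have : gaborCoeff partitionWindow i.1 i.2 (0 : 𝓢(ℝ × W, ℂ)) = 0 := by
        ext w; simp [gaborCoeff_apply]
      rw [map_zero, this]
      exact TensorProduct.tmul_zero _ _
    simp_rw [h]
    exact hasSum_zero
  | tmul x h =>
    have h1 := (hasSum_gaborFunctional_smul (e x)).mapL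
      ((ProjTensor.mkLeft h).comp (e.symm : 𝓢(ℝ, ℂ) →L[ℂ] E))
    have e1 : ((ProjTensor.mkLeft h).comp (e.symm : 𝓢(ℝ, ℂ) →L[ℂ] E)) (e x)
        = ProjTensor.tmul x h := by
      change ProjTensor.tmul (e.symm (e x)) h = _
      rw [e.symm_apply_apply]
    rw [e1] at h1
    refine h1.congr_fun fun i => ?_
    change _ = ProjTensor.tmul (e.symm (_ • _)) h
    rw [tensorToSchwartz_tmul, gaborCoeff_tensor, map_smul, ProjTensor.smul_tmul',
      ProjTensor.tmul_smul']
  | add x y hx hy =>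
    refine (hx.add hy).congr_fun fun i => ?_
    rw [map_add, gaborCoeff_add]
    exact TensorProduct.tmul_add _ _ _

/-- The projective seminorms are continuous for the topology induced by `𝓢(ℝ × W)`: sum the
estimates for the terms of the Gabor expansion. -/
theorem exists_projSeminorm_le (e : E ≃L[ℂ] 𝓢(ℝ, ℂ)) (s : ProjIndex E 𝓢(W, ℂ)) :
    ∃ Q : Seminorm ℂ 𝓢(ℝ × W, ℂ), Continuous Q ∧ ∀ t, s.1 t ≤ Q (tensorToSchwartz e t) := by
  obtain ⟨s, p, q, hp, hq, h⟩ := s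
  obtain ⟨Q, hQ, hle⟩ := exists_seminorm_atom_mul_coeff_le (W := W)
    (p := p.comp e.symm.toLinearEquiv.toLinearMap) (hp.comp e.symm.continuous) hq
    cutoffWindow partitionWindow
  have hw : 0 ≤ ∑' i, gaborWeight i :=
    tsum_nonneg fun i => by unfold gaborWeight; positivity
  refine ⟨(∑' i, gaborWeight i).toNNReal • Q, hQ.const_smul (∑' i, gaborWeight i).toNNReal,
    fun t => ?_⟩
  have hi : ∀ i : ℤ × ℤ, s (ProjTensor.tmul (e.symm (gaborAtom cutoffWindow i.1 i.2))
      (gaborCoeff partitionWindow i.1 i.2 (tensorToSchwartz e t))) ≤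
      Q (tensorToSchwartz e t) * gaborWeight i := fun i => (h _ _).trans (hle _ i)
  have hsum := Summable.of_nonneg_of_le (fun i => apply_nonneg _ _) hi
    (summable_gaborWeight.mul_left _)
  refine (Seminorm.le_tsum_of_hasSum (continuous_projSeminorm s p q hp hq h)
    (hasSum_tmul_gaborAtom e t) hsum).trans ?_
  change _ ≤ ((∑' i, gaborWeight i).toNNReal : ℝ) * Q _
  rw [Real.coe_toNNReal _ hw, mul_comm, ← tsum_mul_left]
  exact hsum.tsum_le_tsum hi (summable_gaborWeight.mul_left _)

/-- The projective topology is the one induced by `𝓢(ℝ × W)`. -/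
theorem isUniformInducing_tensorToSchwartz (e : E ≃L[ℂ] 𝓢(ℝ, ℂ)) :
    IsUniformInducing (tensorToSchwartz (W := W) e) := by
  refine AddMonoidHom.isUniformInducing_of_isInducing (f := tensorToSchwartz (W := W) e) ?_
  rw [IsTopologicalAddGroup.isInducing_iff_nhds_zero]
  have h0 : Tendsto (tensorToSchwartz (W := W) e) (𝓝 0) (𝓝 0) := by
    simpa using (tensorToSchwartz (W := W) e).continuous.tendsto 0
  refine le_antisymm h0.le_comap ?_
  rw [← tendsto_id', (projTensor_withSeminorms E 𝓢(W, ℂ)).tendsto_nhds id 0]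
  intro i ε hε
  obtain ⟨Q, hQ, hle⟩ := exists_projSeminorm_le (W := W) e i
  have hQ0 : ∀ᶠ F in 𝓝 (0 : 𝓢(ℝ × W, ℂ)), Q F < ε :=
    hQ.tendsto 0 |>.eventually (gt_mem_nhds (by rwa [map_zero]))
  refine (hQ0.comap _).mono fun t ht => ?_
  rw [id, sub_zero]
  exact (hle t).trans_lt ht

/-- The partial sums of the Gabor expansion are images of tensors. -/
theorem denseRange_tensorToSchwartz (e : E ≃L[ℂ] 𝓢(ℝ, ℂ)) :
    DenseRange (tensorToSchwartz (W := W) e) := by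
  intro F
  refine mem_closure_of_tendsto (hasSum_gaborAtom_tensor_gaborCoeff F)
    (Eventually.of_forall fun t => ?_)
  refine ⟨∑ i ∈ t, ProjTensor.tmul (e.symm (gaborAtom cutoffWindow i.1 i.2))
      (gaborCoeff partitionWindow i.1 i.2 F), ?_⟩
  rw [map_sum]
  refine Finset.sum_congr rfl fun i _ => ?_
  rw [tensorToSchwartz_tmul, e.apply_symm_apply]

/-- The isomorphism `E ⊗̂ 𝓢(W) ≅ 𝓢(ℝ × W)`. -/
noncomputable def completedTensorEquiv (e : E ≃L[ℂ] 𝓢(ℝ, ℂ)) :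
    CompletedTensor E 𝓢(W, ℂ) ≃L[ℂ] 𝓢(ℝ × W, ℂ) :=
  have hi : IsUniformInducing (tensorToSchwartz (W := W) e).fromCompletion := by
    rw [ContinuousLinearMap.coe_fromCompletion]
    exact UniformSpace.Completion.isUniformInducing_extension
      (isUniformInducing_tensorToSchwartz e)
  have hs : Function.Surjective (tensorToSchwartz (W := W) e).fromCompletion := by
    -- a uniform embedding of a complete space has closed range
    have hc : IsClosed (Set.range (tensorToSchwartz (W := W) e).fromCompletion) :=
      hi.isComplete_range.isClosed
    have hd : DenseRange (tensorToSchwartz (W := W) e).fromCompletion := by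
      refine (denseRange_tensorToSchwartz (W := W) e).mono ?_
      rintro _ ⟨t, rfl⟩
      exact ⟨t, ContinuousLinearMap.fromCompletion_apply_coe _ t⟩
    rw [← Set.range_eq_univ, ← hc.closure_eq]
    exact hd.closure_range
  { LinearEquiv.ofBijective (tensorToSchwartz (W := W) e).fromCompletion.toLinearMap
      ⟨hi.injective, hs⟩ with
    continuous_toFun := (tensorToSchwartz (W := W) e).fromCompletion.continuous
    continuous_invFun := by
      refine hi.isInducing.continuous_iff.2 (continuous_id.congr fun F => ?_)
      exact (LinearEquiv.apply_symm_apply (LinearEquiv.ofBijective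
        (tensorToSchwartz (W := W) e).fromCompletion.toLinearMap ⟨hi.injective, hs⟩) F).symm }

theorem completedTensorEquiv_coe (e : E ≃L[ℂ] 𝓢(ℝ, ℂ)) (t : ProjTensor E 𝓢(W, ℂ)) :
    completedTensorEquiv e (t : CompletedTensor E 𝓢(W, ℂ)) = tensorToSchwartz e t :=
  ContinuousLinearMap.fromCompletion_apply_coe _ t

theorem completedTensorEquiv_tmul (e : E ≃L[ℂ] 𝓢(ℝ, ℂ)) (x : E) (h : 𝓢(W, ℂ)) :
    completedTensorEquiv e (CompletedTensor.tmul x h) = (e x).tensor h :=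
  (completedTensorEquiv_coe e _).trans (tensorToSchwartz_tmul e x h)

/-- The pure tensors span a dense subspace of the completed tensor product. -/
theorem CompletedTensor.ext_of_tmul {F X : Type*} [AddCommGroup F] [Module ℂ F]
    [TopologicalSpace F] [AddCommGroup X] [Module ℂ X] [TopologicalSpace X] [T2Space X]
    {S T : CompletedTensor E F →L[ℂ] X}
    (h : ∀ x y, S (CompletedTensor.tmul x y) = T (CompletedTensor.tmul x y)) : S = T := by
  ext z
  induction z using UniformSpace.Completion.induction_on with
  | hp => exact isClosed_eq S.continuous T.continuous
  | ih t =>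
    induction t using ProjTensor.induction_on with
    | zero => rw [UniformSpace.Completion.coe_zero, map_zero, map_zero]
    | tmul x y => exact h x y
    | add x y hx hy => rw [UniformSpace.Completion.coe_add, map_add, map_add, hx, hy]

end TensorIso

/-! ### Operators acting on one variable -/

section OneVariable

variable {W : Type*} [NormedAddCommGroup W] [NormedSpace ℝ W]

/-- The operator `T ⊗ 1` on the algebraic tensor product. -/
noncomputable def ProjTensor.mapLeft (T : 𝓢(ℝ, ℂ) →L[ℂ] 𝓢(ℝ, ℂ)) :
    ProjTensor 𝓢(ℝ, ℂ) 𝓢(W, ℂ) →L[ℂ] ProjTensor 𝓢(ℝ, ℂ) 𝓢(W, ℂ) where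
  toLinearMap := (TensorProduct.map T.toLinearMap (LinearMap.id : 𝓢(W, ℂ) →ₗ[ℂ] 𝓢(W, ℂ)) :
    𝓢(ℝ, ℂ) ⊗[ℂ] 𝓢(W, ℂ) →ₗ[ℂ] 𝓢(ℝ, ℂ) ⊗[ℂ] 𝓢(W, ℂ))
  cont := by
    refine WithSeminorms.continuous_of_continuous_comp
      (projTensor_withSeminorms 𝓢(ℝ, ℂ) 𝓢(W, ℂ)) _ ?_
    rintro ⟨s, p, q, hp, hq, h⟩
    exact continuous_projSeminorm _ (p.comp T.toLinearMap) q (hp.comp T.continuous) hq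
      fun x y => h (T x) y

/-- A continuous operator `T` on `𝓢(ℝ)` acts continuously on the first variable of a Schwartz
function, because it does so on tensors. -/
noncomputable def SchwartzMap.mapFst (T : 𝓢(ℝ, ℂ) →L[ℂ] 𝓢(ℝ, ℂ)) :
    𝓢(ℝ × W, ℂ) →L[ℂ] 𝓢(ℝ × W, ℂ) :=
  ((completedTensorEquiv (W := W) (ContinuousLinearEquiv.refl ℂ 𝓢(ℝ, ℂ)) :
    CompletedTensor 𝓢(ℝ, ℂ) 𝓢(W, ℂ) →L[ℂ] 𝓢(ℝ × W, ℂ)).comp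
    (ProjTensor.mapLeft (W := W) T).completion).comp
    ((completedTensorEquiv (W := W) (ContinuousLinearEquiv.refl ℂ 𝓢(ℝ, ℂ))).symm :
      𝓢(ℝ × W, ℂ) →L[ℂ] CompletedTensor 𝓢(ℝ, ℂ) 𝓢(W, ℂ))

theorem SchwartzMap.mapFst_apply (T : 𝓢(ℝ, ℂ) →L[ℂ] 𝓢(ℝ, ℂ)) (F : 𝓢(ℝ × W, ℂ)) (s : ℝ) (w : W) :
    SchwartzMap.mapFst T F (s, w) = T (SchwartzMap.slice w F) s := by
  set J := completedTensorEquiv (W := W) (ContinuousLinearEquiv.refl ℂ 𝓢(ℝ, ℂ)) with hJ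
  -- both sides are continuous and linear in `F`, so that pure tensors suffice
  have h : (SchwartzMap.evalPt (s, w)).comp ((SchwartzMap.mapFst T).comp
      (J : CompletedTensor 𝓢(ℝ, ℂ) 𝓢(W, ℂ) →L[ℂ] 𝓢(ℝ × W, ℂ))) =
      (SchwartzMap.evalPt s).comp (T.comp ((SchwartzMap.slice w).comp
      (J : CompletedTensor 𝓢(ℝ, ℂ) 𝓢(W, ℂ) →L[ℂ] 𝓢(ℝ × W, ℂ)))) := by
    refine CompletedTensor.ext_of_tmul fun f h => ?_
    change J ((ProjTensor.mapLeft T).completion (J.symm (J (CompletedTensor.tmul f h)))) (s, w) =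
      T (SchwartzMap.slice w (J (CompletedTensor.tmul f h))) s
    rw [J.symm_apply_apply, completedTensorEquiv_tmul, CompletedTensor.tmul,
      ContinuousLinearMap.completion_apply_coe]
    have e1 : ProjTensor.mapLeft T (ProjTensor.tmul f h) = ProjTensor.tmul (T f) h := rfl
    have e2 : J ((ProjTensor.tmul (T f) h : ProjTensor 𝓢(ℝ, ℂ) 𝓢(W, ℂ)) :
        CompletedTensor 𝓢(ℝ, ℂ) 𝓢(W, ℂ)) = (T f).tensor h :=
      completedTensorEquiv_tmul (ContinuousLinearEquiv.refl ℂ 𝓢(ℝ, ℂ)) (T f) h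
    have e3 : SchwartzMap.slice w (((ContinuousLinearEquiv.refl ℂ 𝓢(ℝ, ℂ)) f).tensor h)
        = h w • f := by
      ext x; simp [mul_comm]
    rw [e1, e2, e3, map_smul, SchwartzMap.tensor_apply, smul_apply, smul_eq_mul, mul_comm]
  have h2 := DFunLike.congr_fun h (J.symm F)
  change SchwartzMap.mapFst T (J (J.symm F)) (s, w) = T (SchwartzMap.slice w (J (J.symm F))) s at h2
  rwa [J.apply_symm_apply] at h2

end OneVariable

/-! ### The Schwartz space of `A` -/

theorem sinh_two_mul_surjective : Function.Surjective fun a : ℝ => Real.sinh (2 * a) := fun r =>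
  ⟨Real.arsinh r / 2, by
    change Real.sinh (2 * (Real.arsinh r / 2)) = r
    rw [mul_div_cancel₀ _ two_ne_zero, Real.sinh_arsinh]⟩

theorem gammaPullback_injective : Function.Injective gammaPullback := fun F G h => by
  ext r
  obtain ⟨a, rfl⟩ := sinh_two_mul_surjective r
  exact congr_fun h a

theorem SchwartzA.continuous_mk :
    Continuous (Y := SchwartzA) fun F : 𝓢(ℝ, ℂ) => gammaPullback.rangeRestrict F :=
  continuous_coinduced_rng

/-- The isomorphism of `𝓢(A)` with `𝓢(ℝ)`. -/
noncomputable def schwartzAEquiv : SchwartzA ≃L[ℂ] 𝓢(ℝ, ℂ) where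
  toLinearEquiv := (LinearEquiv.ofInjective gammaPullback gammaPullback_injective).symm
  continuous_toFun := by
    refine continuous_coinduced_dom.2 (continuous_id.congr fun F => ?_)
    exact ((LinearEquiv.ofInjective gammaPullback gammaPullback_injective).symm_apply_apply F).symm
  continuous_invFun := SchwartzA.continuous_mk

theorem schwartzAEquiv_apply_sinh (f : SchwartzA) (a : ℝ) :
    schwartzAEquiv f (Real.sinh (2 * a)) = f a :=
  congr_fun (congr_arg Subtype.val
    ((LinearEquiv.ofInjective gammaPullback gammaPullback_injective).apply_symm_apply f)) a

section SchwartzGroup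

/-! ### The coordinates `(sinh 2a, x, ℓ)` -/

section Coordinates

variable {V : Type*} [NormedAddCommGroup V] [NormedSpace ℝ V]

theorem hasFDerivAt_rCoord (g : JGroup V) :
    HasFDerivAt (rCoord : JGroup V → JGroup V)
      (((2 * Real.cosh (2 * g.1)) • ContinuousLinearMap.fst ℝ ℝ (V × ℝ)).prod
        (ContinuousLinearMap.snd ℝ ℝ (V × ℝ))) g := by
  have h1 : HasFDerivAt (fun g : JGroup V => Real.sinh (2 * g.1))
      ((2 * Real.cosh (2 * g.1)) • ContinuousLinearMap.fst ℝ ℝ (V × ℝ)) g := by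
    have h := ((hasFDerivAt_fst (𝕜 := ℝ) (p := g)).const_mul 2).sinh
    rwa [smul_smul, mul_comm (Real.cosh _)] at h
  exact h1.prodMk hasFDerivAt_snd

theorem contDiff_rCoord : ContDiff ℝ ∞ (rCoord : JGroup V → JGroup V) :=
  ((contDiff_const.mul contDiff_fst).sinh).prodMk contDiff_snd

/-- The inverse of `rCoord`. -/
noncomputable def rInv (p : JGroup V) : JGroup V := (Real.arsinh p.1 / 2, p.2)

omit [NormedAddCommGroup V] [NormedSpace ℝ V] in
theorem rCoord_rInv (p : JGroup V) : rCoord (rInv p) = p := by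
  simp [rCoord, rInv, mul_div_cancel₀]

omit [NormedAddCommGroup V] [NormedSpace ℝ V] in
theorem rInv_rCoord (g : JGroup V) : rInv (rCoord g) = g := by
  simp [rCoord, rInv]

theorem contDiff_rInv : ContDiff ℝ ∞ (rInv : JGroup V → JGroup V) :=
  (contDiff_fst.arsinh.div_const 2).prodMk contDiff_snd

theorem cosh_two_mul_eq_sqrt (a : ℝ) :
    Real.cosh (2 * a) = √(1 + Real.sinh (2 * a) ^ 2) := by
  rw [← Real.cosh_sq', Real.sqrt_sq (Real.cosh_pos _).le]

/-- The square root is smooth here because its argument is at least `1`. -/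
theorem hasTemperateGrowth_sqrt_one_add_sq :
    (fun r : ℝ => √(1 + r ^ 2)).HasTemperateGrowth := by
  have h := Function.hasTemperateGrowth_one_add_norm_sq_rpow ℝ (1 / 2)
  simpa only [Real.norm_eq_abs, sq_abs, ← Real.sqrt_eq_rpow] using h

end Coordinates

variable {V : Type*} [NormedAddCommGroup V] [NormedSpace ℝ V] [FiniteDimensional ℝ V]
  (ω₀ : LinearMap.BilinForm ℝ V)

/-- The composition of a Schwartz function with the coordinates `rCoord`. -/
noncomputable def pullbackSmooth : 𝓢(JGroup V, ℂ) →ₗ[ℂ] SmoothFn V where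
  toFun F := ⟨fun g => F (rCoord g), (F.smooth ⊤).comp contDiff_rCoord⟩
  map_add' _ _ := rfl
  map_smul' _ _ := rfl

/-- The linear part of `coordField`. -/
noncomputable def coordFieldLin (X : JGroup V) : JGroup V →L[ℝ] JGroup V :=
  LinearMap.toContinuousLinearMap
    { toFun := fun p => (0, -(X.1 • p.2.1), -(2 * X.1 * p.2.2) + 1 / 2 * ω₀ p.2.1 X.2.1)
      map_add' := fun p q => by
        ext <;> simp <;> [abel; ring]
      map_smul' := fun c p => by
        ext <;> simp <;> [rw [smul_comm]; ring] }

/-- The left-invariant vector field of `X` in the coordinates `(sinh 2a, x, ℓ)`. -/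
noncomputable def coordField (X p : JGroup V) : JGroup V :=
  √(1 + p.1 ^ 2) • ((2 * X.1, 0, 0) : JGroup V) + (0, X.2) + coordFieldLin ω₀ X p

theorem coordField_rCoord (X g : JGroup V) :
    coordField ω₀ X (rCoord g) = ((2 * Real.cosh (2 * g.1)) * (leftField ω₀ X g).1,
      (leftField ω₀ X g).2) := by
  have h : coordFieldLin ω₀ X (rCoord g) = (0, -(X.1 • g.2.1),
    -(2 * X.1 * g.2.2) + 1 / 2 * ω₀ g.2.1 X.2.1) := rfl
  rw [leftField_eq, coordField, h, cosh_two_mul_eq_sqrt]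
  ext
  · simp [rCoord]; ring
  · simp [rCoord]; abel
  · simp [rCoord]; ring

theorem hasTemperateGrowth_coordField (X : JGroup V) :
    (coordField ω₀ X).HasTemperateGrowth := by
  have h := hasTemperateGrowth_sqrt_one_add_sq.comp
    (ContinuousLinearMap.fst ℝ ℝ (V × ℝ)).hasTemperateGrowth
  exact ((h.smul (.const _)).add (.const _)).add (coordFieldLin ω₀ X).hasTemperateGrowth

/-- The left-invariant vector field of `X`, acting on Schwartz functions of `(sinh 2a, x, ℓ)`. -/
noncomputable def coordDeriv (X : JGroup V) : 𝓢(JGroup V, ℂ) →L[ℝ] 𝓢(JGroup V, ℂ) :=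
  (SchwartzMap.bilinLeftCLM (ContinuousLinearMap.id ℝ (JGroup V →L[ℝ] ℂ))
    (hasTemperateGrowth_coordField ω₀ X)).comp (SchwartzMap.fderivCLM ℝ (JGroup V) ℂ)

theorem coordDeriv_apply (X : JGroup V) (F : 𝓢(JGroup V, ℂ)) (p : JGroup V) :
    coordDeriv ω₀ X F p = fderiv ℝ F p (coordField ω₀ X p) := rfl

theorem leftInv_pullbackSmooth (X : JGroup V) (F : 𝓢(JGroup V, ℂ)) :
    leftInv ω₀ X (pullbackSmooth F) = pullbackSmooth (coordDeriv ω₀ X F) := by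
  ext g
  change fderiv ℝ (fun g => F (rCoord g)) g (leftField ω₀ X g) = coordDeriv ω₀ X F (rCoord g)
  have h := (F.hasFDerivAt (rCoord g)).comp g (hasFDerivAt_rCoord g)
  rw [coordDeriv_apply, coordField_rCoord]
  exact congr_arg (fun L : JGroup V →L[ℝ] ℂ => L (leftField ω₀ X g)) h.fderiv

/-- The product of the operators `coordDeriv` of a list of Lie algebra elements. -/
noncomputable def coordDerivWord (P : List (JGroup V)) : 𝓢(JGroup V, ℂ) →L[ℝ] 𝓢(JGroup V, ℂ) :=
  P.foldr (fun X T => (coordDeriv ω₀ X).comp T) (ContinuousLinearMap.id ℝ _)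

theorem leftInvWord_pullbackSmooth (P : List (JGroup V)) (F : 𝓢(JGroup V, ℂ)) :
    leftInvWord ω₀ P (pullbackSmooth F) = pullbackSmooth (coordDerivWord ω₀ P F) := by
  induction P with
  | nil => rfl
  | cons X P ih =>
    change leftInv ω₀ X (leftInvWord ω₀ P (pullbackSmooth F)) = _
    rw [ih, leftInv_pullbackSmooth]
    rfl

/-! ### The weights `α^j` -/

/-- The functions `α_X` have polynomial growth in the coordinates `(sinh 2a, x, ℓ)`. -/
theorem exists_alphaFn_isBigO (X : JGroup V) : ∃ K : ℕ,
    alphaFn ω₀ X =O[⊤] fun g => (1 + ‖rCoord g‖) ^ K := by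
  refine ⟨2, Asymptotics.isBigO_top.2 ⟨|X.1| * 2 +
    ‖LinearMap.toContinuousLinearMap (ω₀ X.2.1)‖ + |X.2.2|, fun g => ?_⟩⟩
  have h1 : |Real.sinh (2 * g.1)| ≤ ‖rCoord g‖ := norm_fst_le (rCoord g)
  have h2 : ‖g.2.1‖ ≤ ‖rCoord g‖ := (norm_fst_le g.2).trans (norm_snd_le (rCoord g))
  have h3 : |g.2.2| ≤ ‖rCoord g‖ := (norm_snd_le g.2).trans (norm_snd_le (rCoord g))
  have h4 : Real.cosh g.1 ≤ 1 + ‖rCoord g‖ := by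
    -- `cosh a` is bounded by `cosh 2a = √(1 + sinh² 2a)`, hence by a linear function of `|sinh 2a|`
    have h5 : Real.cosh g.1 ≤ Real.cosh (2 * g.1) := by
      rw [Real.cosh_le_cosh, abs_mul, abs_two]
      linarith [abs_nonneg g.1]
    refine (h5.trans ?_).trans (add_le_add_right h1 1)
    rw [cosh_two_mul_eq_sqrt, ← sq_abs]
    exact Real.sqrt_le_left (by positivity) |>.2 (by nlinarith [abs_nonneg (Real.sinh (2 * g.1))])
  have h6 : |ω₀ X.2.1 g.2.1| ≤ ‖LinearMap.toContinuousLinearMap (ω₀ X.2.1)‖ * ‖rCoord g‖ :=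
    ((LinearMap.toContinuousLinearMap (ω₀ X.2.1)).le_opNorm g.2.1).trans
      (mul_le_mul_of_nonneg_left h2 (norm_nonneg _))
  set A := ‖LinearMap.toContinuousLinearMap (ω₀ X.2.1)‖
  have hA : 0 ≤ A := norm_nonneg _
  set t := ‖rCoord g‖
  have ht : 0 ≤ t := norm_nonneg _
  have h7 : |Real.cosh g.1 * ω₀ X.2.1 g.2.1| ≤ (1 + t) * (A * t) := by
    rw [abs_mul, abs_of_pos (Real.cosh_pos _)]
    exact mul_le_mul h4 h6 (abs_nonneg _) (by positivity)
  rw [Real.norm_of_nonneg (by positivity : 0 ≤ (1 + t) ^ 2), Real.norm_eq_abs, alphaFn]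
  have h8 : |X.1 * (2 * g.2.2)| ≤ |X.1| * 2 * t := by
    rw [abs_mul, abs_mul, abs_two, ← mul_assoc]
    exact mul_le_mul_of_nonneg_left h3 (by positivity)
  have h9 : |X.2.2 * -Real.sinh (2 * g.1)| ≤ |X.2.2| * t := by
    rw [abs_mul, abs_neg]
    exact mul_le_mul_of_nonneg_left h1 (abs_nonneg _)
  refine (abs_add_three _ _ _).trans ((add_le_add_three h8 h7 h9).trans ?_)
  have hX : 0 ≤ |X.1| := abs_nonneg _
  have hX' : 0 ≤ |X.2.2| := abs_nonneg _
  have e1 : t ≤ (1 + t) ^ 2 := by nlinarith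
  have e2 : (1 + t) * t ≤ (1 + t) ^ 2 := by nlinarith
  nlinarith [mul_le_mul_of_nonneg_left e1 hX, mul_le_mul_of_nonneg_left e1 hX',
    mul_le_mul_of_nonneg_left e2 hA]

theorem exists_alphaPow_le (j : AlphaIndex V) : ∃ (K : ℕ) (C : ℝ), 0 ≤ C ∧
    ∀ g, |alphaPow ω₀ j g| ≤ C * (1 + ‖rCoord g‖) ^ K := by
  have hp : ∀ (X : JGroup V) (m : ℕ), ∃ K : ℕ,
      (fun g => alphaFn ω₀ X g ^ m) =O[⊤] fun g => (1 + ‖rCoord g‖) ^ K := fun X m => by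
    obtain ⟨K, hK⟩ := exists_alphaFn_isBigO ω₀ X
    refine ⟨K * m, ?_⟩
    simp_rw [pow_mul]
    exact hK.pow m
  obtain ⟨K₁, h₁⟩ := hp (1, 0, 0) j.1
  choose K₂ h₂ using fun i => hp (0, Module.finBasis ℝ V i, 0) (j.2.1 i)
  obtain ⟨K₃, h₃⟩ := hp (0, 0, 1) j.2.2
  have h := (h₁.mul (Asymptotics.IsBigO.finsetProd fun i (_ : i ∈ Finset.univ) => h₂ i)).mul h₃
  simp_rw [Finset.prod_pow_eq_pow_sum, ← pow_add] at h
  obtain ⟨C, hC, hb⟩ := h.exists_nonneg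
  refine ⟨K₁ + ∑ i, K₂ i + K₃, C, hC, fun g => ?_⟩
  have := Asymptotics.isBigOWith_top.1 hb g
  rwa [Real.norm_eq_abs, Real.norm_of_nonneg (by positivity)] at this

/-! ### The isomorphism of `𝓢(𝕊)` with the Schwartz space of the coordinates -/

theorem SchwartzS.withSeminorms : WithSeminorms (schwartzSFamily ω₀) := ⟨rfl⟩

instance SchwartzS.instIsTopologicalAddGroup : IsTopologicalAddGroup (SchwartzS ω₀) :=
  (SchwartzS.withSeminorms ω₀).topologicalAddGroup

theorem weighted_le_schwartzSSeminorm (j : AlphaIndex V) (P : List (JGroup V)) (φ : SchwartzS ω₀)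
    (g : JGroup V) : ‖weighted ω₀ j P φ.1 g‖ ≤ schwartzSSeminorm ω₀ j P φ :=
  le_ciSup (φ.2 j P) g

theorem exists_weighted_pullbackSmooth_le (j : AlphaIndex V) (P : List (JGroup V)) :
    ∃ (C : ℝ) (m : ℕ × ℕ), ∀ (F : 𝓢(JGroup V, ℂ)) (g : JGroup V),
      ‖weighted ω₀ j P (pullbackSmooth F) g‖ ≤
        C * (Finset.Iic m).sup (schwartzSeminormFamily ℝ (JGroup V) ℂ) (coordDerivWord ω₀ P F) := by
  obtain ⟨K, C, hC, h⟩ := exists_alphaPow_le ω₀ j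
  refine ⟨C * 2 ^ K, (K, 0), fun F g => ?_⟩
  have h1 := SchwartzMap.one_add_le_sup_seminorm_apply (𝕜 := ℝ) (m := (K, 0)) le_rfl le_rfl
    (coordDerivWord ω₀ P F) (rCoord g)
  rw [norm_iteratedFDeriv_zero] at h1
  change ‖(alphaPow ω₀ j g : ℂ) * (leftInvWord ω₀ P (pullbackSmooth F)).1 g‖ ≤ _
  rw [leftInvWord_pullbackSmooth, norm_mul, Complex.norm_real, Real.norm_eq_abs]
  change |alphaPow ω₀ j g| * ‖coordDerivWord ω₀ P F (rCoord g)‖ ≤ _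
  calc _ ≤ C * (1 + ‖rCoord g‖) ^ K * ‖coordDerivWord ω₀ P F (rCoord g)‖ :=
        mul_le_mul_of_nonneg_right (h g) (norm_nonneg _)
    _ ≤ _ := by
        rw [mul_assoc, mul_assoc]
        exact mul_le_mul_of_nonneg_left h1 hC

/-- The map `F ↦ F ∘ rCoord` from the Schwartz functions of `(sinh 2a, x, ℓ)` to `𝓢(𝕊)`. -/
noncomputable def fromCoordLM : 𝓢(JGroup V, ℂ) →ₗ[ℂ] SchwartzS ω₀ :=
  pullbackSmooth.codRestrict (schwartzSub ω₀) fun F j P => by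
    obtain ⟨C, m, h⟩ := exists_weighted_pullbackSmooth_le ω₀ j P
    exact ⟨_, by rintro _ ⟨g, rfl⟩; exact h F g⟩

theorem continuous_fromCoordLM : Continuous (fromCoordLM ω₀) := by
  refine WithSeminorms.continuous_of_continuous_comp (SchwartzS.withSeminorms ω₀) _ ?_
  rintro ⟨j, P⟩
  refine Seminorm.continuous_of_continuousAt_zero ?_
  obtain ⟨C, m, h⟩ := exists_weighted_pullbackSmooth_le ω₀ j P
  have hs : Continuous ((Finset.Iic m).sup (schwartzSeminormFamily ℝ (JGroup V) ℂ) :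
      Seminorm ℝ 𝓢(JGroup V, ℂ)) :=
    Seminorm.continuous_finsetSup fun i _ =>
      (schwartz_withSeminorms ℝ (JGroup V) ℂ).continuous_seminorm i
  have hc : Continuous fun F : 𝓢(JGroup V, ℂ) =>
      C * (Finset.Iic m).sup (schwartzSeminormFamily ℝ (JGroup V) ℂ) (coordDerivWord ω₀ P F) :=
    continuous_const.mul (hs.comp (coordDerivWord ω₀ P).continuous)
  have h0 := hc.tendsto 0
  simp only [map_zero, mul_zero] at h0
  rw [ContinuousAt, map_zero]
  refine squeeze_zero (fun F => apply_nonneg _ _) (fun F => ?_) h0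
  exact ciSup_le fun g => h F g

/-- The operators of a word and of a letter compose to the operator of the concatenated word. -/
theorem leftInvWord_leftInv (P : List (JGroup V)) (X : JGroup V) (f : SmoothFn V) :
    leftInvWord ω₀ P (leftInv ω₀ X f) = leftInvWord ω₀ (P ++ [X]) f := by
  induction P with
  | nil => rfl
  | cons Y P ih => exact congr_arg (leftInv ω₀ Y) ih

theorem weighted_leftInv (j : AlphaIndex V) (P : List (JGroup V)) (X : JGroup V)
    (f : SmoothFn V) : weighted ω₀ j P (leftInv ω₀ X f) = weighted ω₀ j (P ++ [X]) f := by
  ext g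
  change (alphaPow ω₀ j g : ℂ) * (leftInvWord ω₀ P (leftInv ω₀ X f)).1 g = _
  rw [leftInvWord_leftInv]
  rfl

/-- A left-invariant vector field as an operator on `𝓢(𝕊)`. -/
noncomputable def leftInvSLM (X : JGroup V) : SchwartzS ω₀ →ₗ[ℂ] SchwartzS ω₀ where
  toFun φ := ⟨leftInv ω₀ X φ.1, fun j P => by
    rw [weighted_leftInv]
    exact φ.2 j (P ++ [X])⟩
  map_add' φ ψ := Subtype.ext (map_add (leftInv ω₀ X) φ.1 ψ.1)
  map_smul' c φ := Subtype.ext (map_smul (leftInv ω₀ X) c φ.1)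

theorem continuous_leftInvSLM (X : JGroup V) : Continuous (leftInvSLM ω₀ X) := by
  refine WithSeminorms.continuous_of_continuous_comp (SchwartzS.withSeminorms ω₀) _ ?_
  rintro ⟨j, P⟩
  refine ((SchwartzS.withSeminorms ω₀).continuous_seminorm (j, P ++ [X])).congr fun φ => ?_
  change (⨆ g, ‖weighted ω₀ j (P ++ [X]) φ.1 g‖) = ⨆ g, ‖weighted ω₀ j P (leftInv ω₀ X φ.1) g‖
  rw [weighted_leftInv]

variable {ω₀} in
/-- Since `ω₀` is nondegenerate and `cosh a ≥ 1`, the functions `α_H`, `α_{e_i}`, `α_E` control the coordinates. -/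
theorem exists_norm_rCoord_le (hω : ω₀.Nondegenerate) : ∃ C : ℝ, 0 ≤ C ∧ ∀ g : JGroup V,
    1 + ‖rCoord g‖ ≤ C * (1 + |alphaFn ω₀ (1, 0, 0) g| +
      ∑ i, |alphaFn ω₀ (0, Module.finBasis ℝ V i, 0) g| + |alphaFn ω₀ (0, 0, 1) g|) := by
  set L : V →ₗ[ℝ] (Fin (Module.finrank ℝ V) → ℝ) :=
    LinearMap.pi fun i => ω₀ (Module.finBasis ℝ V i) with hL
  have hker : LinearMap.ker L = ⊥ := by
    rw [LinearMap.ker_eq_bot']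
    intro x hx
    refine hω.2 x fun y => ?_
    have : ω₀.flip x = 0 := (Module.finBasis ℝ V).ext fun i => congr_fun hx i
    exact LinearMap.congr_fun this y
  obtain ⟨K, -, hK⟩ := L.exists_antilipschitzWith hker
  refine ⟨1 + K, by positivity, fun g => ?_⟩
  have h1 : |alphaFn ω₀ (1, 0, 0) g| = 2 * |g.2.2| := by
    simp [alphaFn, abs_mul]
  have h2 : |alphaFn ω₀ (0, 0, 1) g| = |Real.sinh (2 * g.1)| := by
    simp [alphaFn]
  have h3 : ‖g.2.1‖ ≤ K * ∑ i, |alphaFn ω₀ (0, Module.finBasis ℝ V i, 0) g| := by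
    have h4 : ‖g.2.1‖ ≤ K * ‖L g.2.1‖ := by
      simpa using hK.le_mul_dist g.2.1 0
    refine h4.trans (mul_le_mul_of_nonneg_left ?_ K.2)
    rw [pi_norm_le_iff_of_nonneg (Finset.sum_nonneg fun i _ => abs_nonneg _)]
    intro i
    refine le_trans ?_ (Finset.single_le_sum
      (f := fun i => |alphaFn ω₀ (0, Module.finBasis ℝ V i, 0) g|)
      (fun i _ => abs_nonneg _) (Finset.mem_univ i))
    change |ω₀ _ _| ≤ _
    simp only [alphaFn, zero_mul, zero_add, add_zero, abs_mul]
    exact le_mul_of_one_le_left (abs_nonneg _) ((Real.one_le_cosh _).trans (le_abs_self _))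
  have h5 : ‖rCoord g‖ ≤ |Real.sinh (2 * g.1)| + ‖g.2.1‖ + |g.2.2| := by
    refine (norm_prod_le_iff).2 ⟨?_, norm_prod_le_iff.2 ⟨?_, ?_⟩⟩
    · change |Real.sinh (2 * g.1)| ≤ _
      linarith [norm_nonneg g.2.1, abs_nonneg g.2.2]
    · change ‖g.2.1‖ ≤ _
      linarith [abs_nonneg (Real.sinh (2 * g.1)), abs_nonneg g.2.2]
    · change |g.2.2| ≤ _
      linarith [norm_nonneg g.2.1, abs_nonneg (Real.sinh (2 * g.1))]
  rw [h1, h2]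
  have hs : 0 ≤ ∑ i, |alphaFn ω₀ (0, Module.finBasis ℝ V i, 0) g| :=
    Finset.sum_nonneg fun i _ => abs_nonneg _
  set s := ∑ i, |alphaFn ω₀ (0, Module.finBasis ℝ V i, 0) g|
  have hK0 : (0 : ℝ) ≤ K := K.2
  nlinarith [abs_nonneg (Real.sinh (2 * g.1)), abs_nonneg g.2.2,
    mul_nonneg hK0 (abs_nonneg (Real.sinh (2 * g.1))), mul_nonneg hK0 (abs_nonneg g.2.2)]

theorem alphaPow_succ_fst (j : AlphaIndex V) (g : JGroup V) :
    alphaPow ω₀ (j.1 + 1, j.2) g = alphaFn ω₀ (1, 0, 0) g * alphaPow ω₀ j g := by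
  simp only [alphaPow, pow_succ]; ring

theorem alphaPow_succ_last (j : AlphaIndex V) (g : JGroup V) :
    alphaPow ω₀ (j.1, j.2.1, j.2.2 + 1) g = alphaFn ω₀ (0, 0, 1) g * alphaPow ω₀ j g := by
  simp only [alphaPow, pow_succ]; ring

theorem alphaPow_succ_mid (j : AlphaIndex V) (i : Fin (Module.finrank ℝ V)) (g : JGroup V) :
    alphaPow ω₀ (j.1, j.2.1 + Pi.single i 1, j.2.2) g =
      alphaFn ω₀ (0, Module.finBasis ℝ V i, 0) g * alphaPow ω₀ j g := by
  have h : ∏ k, alphaFn ω₀ (0, Module.finBasis ℝ V k, 0) g ^ (Pi.single i 1 :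
      Fin (Module.finrank ℝ V) → ℕ) k = alphaFn ω₀ (0, Module.finBasis ℝ V i, 0) g := by
    rw [Finset.prod_eq_single i (fun k _ hk => by rw [Pi.single_eq_of_ne hk, pow_zero])
      (fun hi => (hi (Finset.mem_univ i)).elim), Pi.single_eq_same, pow_one]
  simp only [alphaPow, Pi.add_apply, pow_add, Finset.prod_mul_distrib, h]; ring

variable {ω₀} in
/-- By induction on `k`: a factor `1 + ‖rCoord g‖` is replaced by a sum of the functions `α`, each of
which raises one entry of `j`. -/
theorem exists_seminorm_pow_mul_alphaPow_le (hω : ω₀.Nondegenerate) (k : ℕ) :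
    ∀ j : AlphaIndex V, ∃ Q : Seminorm ℂ (SchwartzS ω₀), Continuous Q ∧
      ∀ (φ : SchwartzS ω₀) (g : JGroup V),
        (1 + ‖rCoord g‖) ^ k * (|alphaPow ω₀ j g| * ‖φ g‖) ≤ Q φ := by
  induction k with
  | zero =>
    intro j
    refine ⟨schwartzSSeminorm ω₀ j [], (SchwartzS.withSeminorms ω₀).continuous_seminorm (j, []),
      fun φ g => ?_⟩
    have h := weighted_le_schwartzSSeminorm ω₀ j [] φ g
    change ‖(alphaPow ω₀ j g : ℂ) * φ g‖ ≤ _ at h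
    rwa [norm_mul, Complex.norm_real, Real.norm_eq_abs, ← one_mul (|_| * _),
      ← pow_zero (1 + ‖rCoord g‖)] at h
  | succ k ih =>
    intro j
    obtain ⟨C, hC, hle⟩ := exists_norm_rCoord_le hω
    obtain ⟨Q₀, hQ₀, h₀⟩ := ih j
    obtain ⟨Q₁, hQ₁, h₁⟩ := ih (j.1 + 1, j.2)
    choose Q₂ hQ₂ h₂ using fun i => ih (j.1, j.2.1 + Pi.single i 1, j.2.2)
    obtain ⟨Q₃, hQ₃, h₃⟩ := ih (j.1, j.2.1, j.2.2 + 1)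
    refine ⟨C.toNNReal • (Q₀ + Q₁ + ∑ i, Q₂ i + Q₃), Continuous.const_smul
      (((hQ₀.add hQ₁).add (Seminorm.continuous_finsetSum fun i _ => hQ₂ i)).add hQ₃) C.toNNReal,
      fun φ g => ?_⟩
    change _ ≤ (C.toNNReal : ℝ) * (Q₀ φ + Q₁ φ + (∑ i, Q₂ i) φ + Q₃ φ)
    rw [Real.coe_toNNReal _ hC, Seminorm.sum_apply']
    have e₁ := h₁ φ g
    have e₂ := Finset.sum_le_sum fun i (_ : i ∈ Finset.univ) => h₂ i φ g
    have e₃ := h₃ φ g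
    simp only [alphaPow_succ_mid, abs_mul, mul_assoc] at e₂
    rw [alphaPow_succ_fst, abs_mul, mul_assoc] at e₁
    rw [alphaPow_succ_last, abs_mul, mul_assoc] at e₃
    have e := add_le_add (add_le_add (add_le_add (h₀ φ g) e₁) e₂) e₃
    refine le_trans ?_ (mul_le_mul_of_nonneg_left e hC)
    rw [← Finset.mul_sum, ← Finset.sum_mul, pow_succ]
    have := mul_le_mul_of_nonneg_left (hle g) (by positivity :
      0 ≤ (1 + ‖rCoord g‖) ^ k * (|alphaPow ω₀ j g| * ‖φ g‖))
    refine le_trans (le_of_eq (by ring)) (this.trans (le_of_eq (by ring)))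

end SchwartzGroup

/-! ### Left-invariant fields as a moving frame -/

section Coframe

variable {V : Type*} [NormedAddCommGroup V] [NormedSpace ℝ V] [FiniteDimensional ℝ V]
  (ω₀ : LinearMap.BilinForm ℝ V)

theorem coordField_eq (X p : JGroup V) : coordField ω₀ X p = (2 * √(1 + p.1 ^ 2) * X.1,
    X.2.1 - X.1 • p.2.1, X.2.2 - 2 * X.1 * p.2.2 + 1 / 2 * ω₀ p.2.1 X.2.1) := by
  have h : coordFieldLin ω₀ X p = (0, -(X.1 • p.2.1),
    -(2 * X.1 * p.2.2) + 1 / 2 * ω₀ p.2.1 X.2.1) := rfl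
  rw [coordField, h]
  ext
  · simp; ring
  · simp; abel
  · simp; ring

/-- The Lie algebra element `X` for which the left-invariant field of `X` has a given value `w` at
`p`, in the coordinates `(sinh 2a, x, ℓ)`; it is linear in `w`. -/
noncomputable def coframe (p : JGroup V) : JGroup V →L[ℝ] JGroup V :=
  (ContinuousLinearMap.inr ℝ ℝ (V × ℝ)).comp (ContinuousLinearMap.snd ℝ ℝ (V × ℝ)) +
  (1 / 2 * (1 + p.1 ^ 2) ^ (-(1 / 2) : ℝ)) •
    ((ContinuousLinearMap.inl ℝ ℝ (V × ℝ)).comp (ContinuousLinearMap.fst ℝ ℝ (V × ℝ)) +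
      (LinearMap.mk₂ ℝ (fun p w : JGroup V => ((0, w.1 • p.2.1, w.1 * (2 * p.2.2)) : JGroup V))
        (fun p q w => by ext <;> simp; ring) (fun c p w => by ext <;> simp [smul_comm w.1 c]; ring)
        (fun p v w => by ext <;> simp [add_smul]; ring)
        (fun c p w => by ext <;> simp [mul_smul]; ring)).toContinuousBilinearMap p) +
  (LinearMap.mk₂ ℝ (fun p w : JGroup V => ((0, 0, -(1 / 2 * ω₀ p.2.1 w.2.1)) : JGroup V))
    (fun p q w => by ext <;> simp; ring) (fun c p w => by ext <;> simp; ring)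
    (fun p v w => by ext <;> simp; ring)
    (fun c p w => by ext <;> simp; ring)).toContinuousBilinearMap p

theorem coframe_apply (p w : JGroup V) : coframe ω₀ p w =
    (0, w.2) + (1 / 2 * (1 + p.1 ^ 2) ^ (-(1 / 2) : ℝ)) • ((w.1, 0) +
      (0, w.1 • p.2.1, w.1 * (2 * p.2.2))) + (0, 0, -(1 / 2 * ω₀ p.2.1 w.2.1)) := rfl

variable {ω₀} in
theorem coordField_coframe (hω : ω₀.IsAlt) (p w : JGroup V) :
    coordField ω₀ (coframe ω₀ p w) p = w := by
  have h0 : (0 : ℝ) ≤ 1 + p.1 ^ 2 := by positivity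
  have h1 : √(1 + p.1 ^ 2) * (1 + p.1 ^ 2) ^ (-(1 / 2) : ℝ) = 1 := by
    rw [Real.rpow_neg h0, ← Real.sqrt_eq_rpow]
    exact mul_inv_cancel₀ (Real.sqrt_pos.2 (by positivity)).ne'
  rw [coordField_eq, coframe_apply]
  set ρ := (1 + p.1 ^ 2) ^ (-(1 / 2) : ℝ)
  ext
  · simp only [Prod.fst_add, Prod.smul_fst, smul_eq_mul]
    linear_combination w.1 * h1
  · simp [smul_smul]
  · simp [hω p.2.1]
    ring

theorem hasTemperateGrowth_coframe : (coframe ω₀).HasTemperateGrowth := by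
  have h1 : (fun r : ℝ => (1 + r ^ 2) ^ (-(1 / 2) : ℝ)).HasTemperateGrowth := by
    have h := Function.hasTemperateGrowth_one_add_norm_sq_rpow ℝ (-(1 / 2))
    simpa only [Real.norm_eq_abs, sq_abs] using h
  have h2 := (Function.HasTemperateGrowth.const (E := JGroup V) (1 / 2 : ℝ)).mul
    (h1.comp (ContinuousLinearMap.fst ℝ ℝ (V × ℝ)).hasTemperateGrowth)
  exact ((Function.HasTemperateGrowth.const _).add (h2.smul
    ((Function.HasTemperateGrowth.const _).add (ContinuousLinearMap.hasTemperateGrowth _)))).add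
    (ContinuousLinearMap.hasTemperateGrowth _)

/-- A function on the group in the coordinates `(sinh 2a, x, ℓ)`. -/
noncomputable def toCoordFn (φ : SchwartzS ω₀) (p : JGroup V) : ℂ := φ (rInv p)

theorem contDiff_toCoordFn (φ : SchwartzS ω₀) : ContDiff ℝ ∞ (toCoordFn ω₀ φ) :=
  (SmoothFn.contDiff φ.1).comp contDiff_rInv

theorem toCoordFn_leftInvSLM (X : JGroup V) (φ : SchwartzS ω₀) (p : JGroup V) :
    toCoordFn ω₀ (leftInvSLM ω₀ X φ) p = fderiv ℝ (toCoordFn ω₀ φ) p (coordField ω₀ X p) := by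
  have h0 : φ.1.1 = toCoordFn ω₀ φ ∘ rCoord := by
    funext g
    simp [toCoordFn, rInv_rCoord]
  set g := rInv p with hg
  have hp : p = rCoord g := (rCoord_rInv p).symm
  have h := ((contDiff_toCoordFn ω₀ φ).differentiable (by simp) (rCoord g)).hasFDerivAt.comp g
    (hasFDerivAt_rCoord g)
  change fderiv ℝ φ.1.1 (rInv p) (leftField ω₀ X (rInv p)) = _
  rw [← hg, hp, coordField_rCoord, h0, h.fderiv]
  rfl

/-- The coefficients of the derivative in the moving frame of left-invariant fields. -/
noncomputable def coframeCoeff (i : Fin (Module.finrank ℝ (JGroup V))) (p : JGroup V) :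
    JGroup V →L[ℝ] ℂ :=
  (Complex.ofRealCLM.comp (LinearMap.toContinuousLinearMap
    ((Module.finBasis ℝ (JGroup V)).coord i))).comp (coframe ω₀ p)

theorem hasTemperateGrowth_coframeCoeff (i : Fin (Module.finrank ℝ (JGroup V))) :
    (coframeCoeff ω₀ i).HasTemperateGrowth :=
  (ContinuousLinearMap.compL ℝ (JGroup V) (JGroup V) ℂ (Complex.ofRealCLM.comp
    (LinearMap.toContinuousLinearMap
      ((Module.finBasis ℝ (JGroup V)).coord i)))).hasTemperateGrowth.comp
    (hasTemperateGrowth_coframe ω₀)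

variable {ω₀} in
/-- The derivative of `φ` in the coordinates `(sinh 2a, x, ℓ)` is a combination of left-invariant
derivatives, with coefficients of temperate growth. -/
theorem fderiv_toCoordFn (hω : ω₀.IsAlt) (φ : SchwartzS ω₀) : fderiv ℝ (toCoordFn ω₀ φ) =
    fun p => ∑ i, toCoordFn ω₀ (leftInvSLM ω₀ (Module.finBasis ℝ (JGroup V) i) φ) p •
      coframeCoeff ω₀ i p := by
  funext p
  refine ContinuousLinearMap.ext fun w => ?_
  set X := coframe ω₀ p w with hX
  let L : JGroup V →ₗ[ℝ] JGroup V :=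
    { toFun := fun X => coordField ω₀ X p
      map_add' := fun X Y => by
        simp only [coordField_eq]
        ext <;> simp [add_smul] <;> [ring; abel; ring]
      map_smul' := fun c X => by
        simp only [coordField_eq]
        ext <;> simp [mul_smul, smul_sub] <;> ring }
  have h1 : w = ∑ i, (Module.finBasis ℝ (JGroup V)).coord i X •
      coordField ω₀ (Module.finBasis ℝ (JGroup V) i) p := by
    conv_lhs => rw [← coordField_coframe hω p w, ← hX]
    change L X = _
    conv_lhs => rw [← (Module.finBasis ℝ (JGroup V)).sum_repr X, map_sum]
    simp only [map_smul]
    rfl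
  conv_lhs => rw [h1, map_sum]
  rw [sum_apply]
  refine Finset.sum_congr rfl fun i _ => ?_
  rw [map_smul, ← toCoordFn_leftInvSLM, smul_apply, smul_eq_mul, mul_comm]
  rfl

variable {ω₀} in
/-- By induction on `n`: the derivative of a function is a combination of its derivatives along
left-invariant fields, which belong to `𝓢(𝕊)` again. -/
theorem exists_seminorm_iteratedFDeriv_toCoordFn_le (hω : ω₀.Nondegenerate) (ha : ω₀.IsAlt)
    (n : ℕ) : ∀ k : ℕ, ∃ Q : Seminorm ℂ (SchwartzS ω₀), Continuous Q ∧
      ∀ (φ : SchwartzS ω₀) (p : JGroup V),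
        (1 + ‖p‖) ^ k * ‖iteratedFDeriv ℝ n (toCoordFn ω₀ φ) p‖ ≤ Q φ := by
  induction n using Nat.strong_induction_on with
  | _ n ih =>
  rcases n with - | n
  · intro k
    obtain ⟨Q, hQ, h⟩ := exists_seminorm_pow_mul_alphaPow_le hω k 0
    refine ⟨Q, hQ, fun φ p => ?_⟩
    have := h φ (rInv p)
    have h1 : alphaPow ω₀ 0 (rInv p) = 1 := by simp [alphaPow]
    rw [rCoord_rInv, h1, abs_one, one_mul] at this
    rwa [norm_iteratedFDeriv_zero]
  · intro k
    choose K C hC hc using fun i =>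
      (hasTemperateGrowth_coframeCoeff ω₀ i).norm_iteratedFDeriv_le_uniform n
    choose! Q hQ hle using ih
    have hm : ∀ {m}, m ∈ Finset.range (n + 1) → m < n + 1 := fun h => Finset.mem_range.1 h
    refine ⟨∑ i, ∑ m ∈ Finset.range (n + 1), (n.choose m * C i).toNNReal •
      (Q m (k + K i)).comp (leftInvSLM ω₀ (Module.finBasis ℝ (JGroup V) i)),
      Seminorm.continuous_finsetSum fun i _ => Seminorm.continuous_finsetSum fun m h =>
        Continuous.const_smul ((hQ m (hm h) _).comp (continuous_leftInvSLM ω₀ _)) _,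
      fun φ p => ?_⟩
    rw [← norm_iteratedFDeriv_fderiv, fderiv_toCoordFn ha]
    have hs : ∀ i, ContDiff ℝ n fun p => toCoordFn ω₀
        (leftInvSLM ω₀ (Module.finBasis ℝ (JGroup V) i) φ) p • coframeCoeff ω₀ i p := fun i =>
      ((contDiff_toCoordFn ω₀ _).smul (hasTemperateGrowth_coframeCoeff ω₀ i).1).of_le
        (by exact_mod_cast le_top)
    rw [iteratedFDeriv_fun_sum_apply fun i _ => (hs i).contDiffAt, Seminorm.sum_apply']
    refine (mul_le_mul_of_nonneg_left (norm_sum_le _ _) (by positivity)).trans ?_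
    rw [Finset.mul_sum]
    refine Finset.sum_le_sum fun i _ => ?_
    rw [Seminorm.sum_apply']
    have h1 := norm_iteratedFDeriv_smul_le (𝕜 := ℝ) (n := n) (contDiff_toCoordFn ω₀
      (leftInvSLM ω₀ (Module.finBasis ℝ (JGroup V) i) φ))
      (hasTemperateGrowth_coframeCoeff ω₀ i).1 p (by exact_mod_cast le_top)
    refine (mul_le_mul_of_nonneg_left h1 (by positivity)).trans ?_
    rw [Finset.mul_sum]
    refine Finset.sum_le_sum fun m h => ?_
    change _ ≤ ((n.choose m * C i).toNNReal : ℝ) *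
      Q m (k + K i) (leftInvSLM ω₀ (Module.finBasis ℝ (JGroup V) i) φ)
    have hC' := hC i
    rw [Real.coe_toNNReal _ (by positivity)]
    have h2 := hle m (hm h) (k + K i) (leftInvSLM ω₀ (Module.finBasis ℝ (JGroup V) i) φ) p
    have h3 := hc i (n - m) (Nat.sub_le _ _) p
    set A := ‖iteratedFDeriv ℝ m (toCoordFn ω₀
      (leftInvSLM ω₀ (Module.finBasis ℝ (JGroup V) i) φ)) p‖
    have hA : 0 ≤ A := norm_nonneg _
    calc (1 + ‖p‖) ^ k * (n.choose m * A * ‖iteratedFDeriv ℝ (n - m) (coframeCoeff ω₀ i) p‖)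
        ≤ (1 + ‖p‖) ^ k * (n.choose m * A * (C i * (1 + ‖p‖) ^ K i)) := by gcongr
      _ = n.choose m * C i * ((1 + ‖p‖) ^ (k + K i) * A) := by rw [pow_add]; ring
      _ ≤ _ := by gcongr

/-- The function `φ ∘ rInv` of `(sinh 2a, x, ℓ)` as a Schwartz function. -/
noncomputable def toCoordLM (hω : ω₀.Nondegenerate) (ha : ω₀.IsAlt) :
    SchwartzS ω₀ →ₗ[ℂ] 𝓢(JGroup V, ℂ) where
  toFun φ :=
    { toFun := toCoordFn ω₀ φ
      smooth' := contDiff_toCoordFn ω₀ φ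
      decay' := fun k n => by
        obtain ⟨Q, -, h⟩ := exists_seminorm_iteratedFDeriv_toCoordFn_le hω ha n k
        refine ⟨Q φ, fun p => le_trans ?_ (h φ p)⟩
        gcongr
        linarith }
  map_add' _ _ := rfl
  map_smul' _ _ := rfl

theorem continuous_toCoordLM (hω : ω₀.Nondegenerate) (ha : ω₀.IsAlt) :
    Continuous (toCoordLM ω₀ hω ha) := by
  refine WithSeminorms.continuous_of_continuous_comp (schwartz_withSeminorms ℂ (JGroup V) ℂ) _ ?_
  rintro ⟨k, n⟩
  obtain ⟨Q, hQ, h⟩ := exists_seminorm_iteratedFDeriv_toCoordFn_le hω ha n k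
  refine Seminorm.continuous_of_le hQ fun φ => ?_
  refine SchwartzMap.seminorm_le_bound ℂ k n _ (apply_nonneg _ _) fun p => le_trans ?_ (h φ p)
  change ‖p‖ ^ k * ‖iteratedFDeriv ℝ n (toCoordFn ω₀ φ) p‖ ≤ _
  gcongr
  linarith

/-- The isomorphism of the Schwartz functions of `(sinh 2a, x, ℓ)` with `𝓢(𝕊)`, given by
composition with `rCoord`. -/
noncomputable def coordEquiv (hω : ω₀.Nondegenerate) (ha : ω₀.IsAlt) :
    𝓢(JGroup V, ℂ) ≃L[ℂ] SchwartzS ω₀ where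
  toFun := fromCoordLM ω₀
  map_add' := map_add _
  map_smul' := map_smul _
  invFun := toCoordLM ω₀ hω ha
  left_inv F := by
    ext p
    change F (rCoord (rInv p)) = F p
    rw [rCoord_rInv]
  right_inv φ := by
    refine Subtype.ext (Subtype.ext (funext fun g => ?_))
    change φ (rInv (rCoord g)) = φ g
    rw [rInv_rCoord]
  continuous_toFun := continuous_fromCoordLM ω₀
  continuous_invFun := continuous_toCoordLM ω₀ hω ha

theorem coordEquiv_apply (hω : ω₀.Nondegenerate) (ha : ω₀.IsAlt) (F : 𝓢(JGroup V, ℂ))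
    (g : JGroup V) : coordEquiv ω₀ hω ha F g = F (rCoord g) := rfl

end Coframe

/-! ### The twist -/

section Twist

open FourierTransform

/-- The number `r'` with `r' = sinh (u + ε v)` if `r = sinh u`, `s = sinh v` and `ε = ±1`. -/
noncomputable def sinhShift (ε s r : ℝ) : ℝ := r * √(1 + s ^ 2) + ε * s * √(1 + r ^ 2)

theorem sinhShift_neg_sinhShift {ε : ℝ} (hε : ε = 1 ∨ ε = -1) (s r : ℝ) :
    sinhShift (-ε) s (sinhShift ε s r) = r := by
  obtain ⟨u, rfl⟩ := Real.sinh_surjective r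
  obtain ⟨v, rfl⟩ := Real.sinh_surjective s
  have h : ∀ ε : ℝ, ε = 1 ∨ ε = -1 → ∀ u, sinhShift ε (Real.sinh v) (Real.sinh u) =
      Real.sinh (u + ε * v) := fun ε hε u => by
    have hc : ∀ x, √(1 + Real.sinh x ^ 2) = Real.cosh x := fun x => by
      rw [← Real.cosh_sq', Real.sqrt_sq (Real.cosh_pos _).le]
    rw [sinhShift, hc, hc, Real.sinh_add]
    rcases hε with rfl | rfl <;> simp <;> ring
  rw [h ε hε, h (-ε) (by rcases hε with rfl | rfl <;> simp)]
  congr 1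
  ring

variable {W : Type*} [NormedAddCommGroup W] [NormedSpace ℝ W]

/-- The map `(η, r, x) ↦ (η, r', x)` with `r' = sinhShift ε (c η) r`. -/
noncomputable def shiftMap (W : Type*) (c ε : ℝ) (p : ℝ × ℝ × W) : ℝ × ℝ × W :=
  (p.1, sinhShift ε (c * p.1) p.2.1, p.2.2)

omit [NormedAddCommGroup W] [NormedSpace ℝ W] in
theorem shiftMap_neg_shiftMap (c : ℝ) {ε : ℝ} (hε : ε = 1 ∨ ε = -1) (p : ℝ × ℝ × W) :
    shiftMap W c (-ε) (shiftMap W c ε p) = p := by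
  simp [shiftMap, sinhShift_neg_sinhShift hε]

theorem hasTemperateGrowth_shiftMap (c ε : ℝ) : (shiftMap W c ε).HasTemperateGrowth := by
  have h1 : (fun p : ℝ × ℝ × W => c * p.1).HasTemperateGrowth :=
    (c • ContinuousLinearMap.fst ℝ ℝ (ℝ × W)).hasTemperateGrowth
  have h2 : (fun p : ℝ × ℝ × W => p.2.1).HasTemperateGrowth :=
    ((ContinuousLinearMap.fst ℝ ℝ W).comp (ContinuousLinearMap.snd ℝ ℝ _)).hasTemperateGrowth
  have h3 : (fun p : ℝ × ℝ × W => sinhShift ε (c * p.1) p.2.1).HasTemperateGrowth :=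
    (h2.mul (hasTemperateGrowth_sqrt_one_add_sq.comp h1)).add
      (((Function.HasTemperateGrowth.const ε).mul h1).mul
        (hasTemperateGrowth_sqrt_one_add_sq.comp h2))
  have h4 := (h3.smul (.const ((0, 1, 0) : ℝ × ℝ × W))).add
    ((ContinuousLinearMap.fst ℝ ℝ (ℝ × W)).prod ((0 : ℝ × ℝ × W →L[ℝ] ℝ).prod
      ((ContinuousLinearMap.snd ℝ ℝ W).comp
        (ContinuousLinearMap.snd ℝ ℝ (ℝ × W))))).hasTemperateGrowth
  convert h4 using 1
  ext p <;> simp [shiftMap]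

/-- Composition with `shiftMap`. -/
noncomputable def shiftCLM (W : Type*) [NormedAddCommGroup W] [NormedSpace ℝ W] (c : ℝ) {ε : ℝ}
    (hε : ε = 1 ∨ ε = -1) : 𝓢(ℝ × ℝ × W, ℂ) →L[ℂ] 𝓢(ℝ × ℝ × W, ℂ) :=
  SchwartzMap.compCLM ℂ (hasTemperateGrowth_shiftMap (W := W) c ε) (by
    -- the inverse map is of temperate growth as well
    obtain ⟨k, C, -, h⟩ :=
      (hasTemperateGrowth_shiftMap (W := W) c (-ε)).norm_iteratedFDeriv_le_uniform 0
    refine ⟨k, C, fun p => ?_⟩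
    have := h 0 le_rfl (shiftMap W c ε p)
    rwa [norm_iteratedFDeriv_zero, shiftMap_neg_shiftMap c hε] at this)

theorem shiftCLM_apply (c : ℝ) {ε : ℝ} (hε : ε = 1 ∨ ε = -1) (F : 𝓢(ℝ × ℝ × W, ℂ))
    (p : ℝ × ℝ × W) : shiftCLM W c hε F p = F (shiftMap W c ε p) := rfl

theorem SchwartzMap.mapFst_mapFst (S T : 𝓢(ℝ, ℂ) →L[ℂ] 𝓢(ℝ, ℂ)) (F : 𝓢(ℝ × W, ℂ)) :
    SchwartzMap.mapFst S (SchwartzMap.mapFst T F) = SchwartzMap.mapFst (S.comp T) F := by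
  ext ⟨s, w⟩
  have h : SchwartzMap.slice w (SchwartzMap.mapFst T F) = T (SchwartzMap.slice w F) := by
    ext s
    exact SchwartzMap.mapFst_apply T F s w
  rw [SchwartzMap.mapFst_apply, SchwartzMap.mapFst_apply, h]
  rfl

theorem SchwartzMap.mapFst_eq_self {T : 𝓢(ℝ, ℂ) →L[ℂ] 𝓢(ℝ, ℂ)} (hT : ∀ f, T f = f)
    (F : 𝓢(ℝ × W, ℂ)) : SchwartzMap.mapFst T F = F := by
  ext ⟨s, w⟩
  rw [SchwartzMap.mapFst_apply, hT]
  rfl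

/-- The operator `𝓕⁻¹ σ 𝓕`, where `𝓕` is the Fourier transform in the first variable and `σ` is
the composition with `shiftMap`. -/
noncomputable def fourierShift (W : Type*) [NormedAddCommGroup W] [NormedSpace ℝ W] (c : ℝ) {ε : ℝ}
    (hε : ε = 1 ∨ ε = -1) : 𝓢(ℝ × ℝ × W, ℂ) →L[ℂ] 𝓢(ℝ × ℝ × W, ℂ) :=
  (SchwartzMap.mapFst (fourierInvCLM ℂ 𝓢(ℝ, ℂ))).comp
    ((shiftCLM W c hε).comp (SchwartzMap.mapFst (fourierCLM ℂ 𝓢(ℝ, ℂ))))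

/-- The inner Fourier transforms cancel, and the shifts for `ε` and `-ε` are inverse to each other. -/
theorem fourierShift_neg_fourierShift (c : ℝ) {ε : ℝ} (hε : ε = 1 ∨ ε = -1)
    (hε' : -ε = 1 ∨ -ε = -1) (F : 𝓢(ℝ × ℝ × W, ℂ)) :
    fourierShift W c hε' (fourierShift W c hε F) = F := by
  change SchwartzMap.mapFst _ (shiftCLM W c hε' (SchwartzMap.mapFst _ (SchwartzMap.mapFst _
    (shiftCLM W c hε (SchwartzMap.mapFst _ F))))) = F
  rw [SchwartzMap.mapFst_mapFst, SchwartzMap.mapFst_eq_self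
    (T := (fourierCLM ℂ 𝓢(ℝ, ℂ)).comp (fourierInvCLM ℂ 𝓢(ℝ, ℂ)))
    (fun f => by
      rw [ContinuousLinearMap.comp_apply, fourierInvCLM_apply, fourierCLM_apply,
        FourierTransform.fourier_fourierInv_eq])]
  have h : ∀ G : 𝓢(ℝ × ℝ × W, ℂ), shiftCLM W c hε' (shiftCLM W c hε G) = G := fun G => by
    ext p
    have := shiftMap_neg_shiftMap c hε' p
    rw [neg_neg] at this
    rw [shiftCLM_apply, shiftCLM_apply, this]
  rw [h, SchwartzMap.mapFst_mapFst]
  refine SchwartzMap.mapFst_eq_self (fun f => ?_) F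
  rw [ContinuousLinearMap.comp_apply, fourierInvCLM_apply, fourierCLM_apply,
    FourierTransform.fourierInv_fourier_eq]

theorem fourierShift_apply (c : ℝ) {ε : ℝ} (hε : ε = 1 ∨ ε = -1) (F : 𝓢(ℝ × ℝ × W, ℂ))
    (l r : ℝ) (x : W) : fourierShift W c hε F (l, r, x) =
      ∫ η : ℝ, Complex.exp (↑(2 * Real.pi * η * l) * Complex.I) *
        ∫ s : ℝ, Complex.exp (↑(-2 * Real.pi * s * η) * Complex.I) *
          F (s, sinhShift ε (c * η) r, x) := by
  change SchwartzMap.mapFst (fourierInvCLM ℂ 𝓢(ℝ, ℂ)) (shiftCLM W c hε (SchwartzMap.mapFst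
    (fourierCLM ℂ 𝓢(ℝ, ℂ)) F)) (l, r, x) = _
  rw [SchwartzMap.mapFst_apply, fourierInvCLM_apply, SchwartzMap.fourierInv_coe,
    Real.fourierInv_eq']
  congr 1
  funext η
  rw [smul_eq_mul, SchwartzMap.slice_apply, shiftCLM_apply, shiftMap, SchwartzMap.mapFst_apply,
    fourierCLM_apply, SchwartzMap.fourier_coe, Real.fourier_real_eq_integral_exp_smul]
  simp only [smul_eq_mul, SchwartzMap.slice_apply]
  congr 4
  simp
  ring

section Group

variable {V : Type*} [NormedAddCommGroup V] [NormedSpace ℝ V]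

/-- The reordering `(ℓ, r, x) ↦ (r, x, ℓ)` of the coordinates. -/
noncomputable def reorder (V : Type*) [NormedAddCommGroup V] [NormedSpace ℝ V] :
    (ℝ × ℝ × V) ≃L[ℝ] JGroup V :=
  (ContinuousLinearEquiv.prodComm ℝ ℝ (ℝ × V)).trans (ContinuousLinearEquiv.prodAssoc ℝ ℝ V ℝ)

/-- The operator `fourierShift` for functions of `(r, x, ℓ)`, with the Fourier transform in `ℓ`. The
constant `πθ` comes from the frequency `ξ = 2πη`, for which `θξ / 2 = πθη`. -/
noncomputable def twistCLM (V : Type*) [NormedAddCommGroup V] [NormedSpace ℝ V] (θ : ℝ) {ε : ℝ}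
    (hε : ε = 1 ∨ ε = -1) : 𝓢(JGroup V, ℂ) →L[ℂ] 𝓢(JGroup V, ℂ) :=
  (SchwartzMap.compCLMOfContinuousLinearEquiv ℂ (reorder V).symm).comp
    ((fourierShift V (Real.pi * θ) hε).comp
      (SchwartzMap.compCLMOfContinuousLinearEquiv ℂ (reorder V)))

theorem twistCLM_neg_twistCLM (θ : ℝ) {ε : ℝ} (hε : ε = 1 ∨ ε = -1) (hε' : -ε = 1 ∨ -ε = -1)
    (F : 𝓢(JGroup V, ℂ)) : twistCLM V θ hε' (twistCLM V θ hε F) = F := by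
  have h : ∀ G : 𝓢(ℝ × ℝ × V, ℂ), SchwartzMap.compCLMOfContinuousLinearEquiv ℂ (reorder V)
      (SchwartzMap.compCLMOfContinuousLinearEquiv ℂ (reorder V).symm G) = G := fun G => by
    ext p
    exact congr_arg G ((reorder V).symm_apply_apply p)
  change SchwartzMap.compCLMOfContinuousLinearEquiv ℂ (reorder V).symm (fourierShift V _ hε'
    (SchwartzMap.compCLMOfContinuousLinearEquiv ℂ (reorder V)
      (SchwartzMap.compCLMOfContinuousLinearEquiv ℂ (reorder V).symm (fourierShift V _ hε
        (SchwartzMap.compCLMOfContinuousLinearEquiv ℂ (reorder V) F))))) = F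
  rw [h, fourierShift_neg_fourierShift]
  ext p
  exact congr_arg F ((reorder V).apply_symm_apply p)

/-- In the group coordinates the operator is `twist`, by the substitution `ξ = 2πη`. -/
theorem twistCLM_apply (θ : ℝ) {ε : ℝ} (hε : ε = 1 ∨ ε = -1) (F : 𝓢(JGroup V, ℂ))
    (g : JGroup V) : twistCLM V θ hε F (rCoord g) = twist θ ε (fun g => F (rCoord g)) g := by
  have h : twistCLM V θ hε F (rCoord g) =
      fourierShift V (Real.pi * θ) hε (SchwartzMap.compCLMOfContinuousLinearEquiv ℂ (reorder V) F)
        (g.2.2, Real.sinh (2 * g.1), g.2.1) := rfl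
  rw [h, fourierShift_apply, twist]
  have hint := Measure.integral_comp_mul_left (fun ξ : ℝ => partialFourier
    (fun g : JGroup V => F (rCoord g)) (shiftA θ ε g.1 ξ) g.2.1 ξ *
      Complex.exp (Complex.I * (g.2.2 : ℂ) * (ξ : ℂ))) (2 * Real.pi)
  have hπ : (0 : ℝ) < 2 * Real.pi := by positivity
  rw [abs_of_pos (inv_pos.2 hπ), Complex.real_smul] at hint
  have e : ((((2 * Real.pi)⁻¹ : ℝ)) : ℂ) = 1 / (2 * (Real.pi : ℂ)) := by push_cast; rw [one_div]
  rw [e] at hint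
  rw [← hint]
  congr 1
  funext η
  rw [mul_comm, partialFourier]
  congr 1
  · congr 1
    funext s
    congr 1
    · congr 1
      push_cast
      ring
    · have h1 : Real.sinh (2 * shiftA θ ε g.1 (2 * Real.pi * η)) =
          sinhShift ε (Real.pi * θ * η) (Real.sinh (2 * g.1)) := by
        rw [shiftA, mul_div_cancel₀ _ two_ne_zero, Real.sinh_arsinh, sinhShift]
        congr 2
        · congr 1
          congr 1
          ring
        · ring
      change F (sinhShift ε (Real.pi * θ * η) (Real.sinh (2 * g.1)), g.2.1, s) =
        F (Real.sinh (2 * shiftA θ ε g.1 (2 * Real.pi * η)), g.2.1, s)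
      rw [h1]
  · congr 1
    push_cast
    ring

/-- The operator `twistCLM` is invertible, with inverse the operator for `-ε`. -/
noncomputable def twistEquiv (V : Type*) [NormedAddCommGroup V] [NormedSpace ℝ V] (θ : ℝ) {ε : ℝ}
    (hε : ε = 1 ∨ ε = -1) (hε' : -ε = 1 ∨ -ε = -1) : 𝓢(JGroup V, ℂ) ≃L[ℂ] 𝓢(JGroup V, ℂ) :=
  ContinuousLinearEquiv.equivOfInverse (twistCLM V θ hε) (twistCLM V θ hε')
    (twistCLM_neg_twistCLM θ hε hε') (fun F => by
      have h : ∀ (ε' : ℝ) (h' : ε' = 1 ∨ ε' = -1) (e : ε' = - -ε),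
          twistCLM V θ h' (twistCLM V θ hε' F) = F := fun ε' h' e => by
        subst e
        exact twistCLM_neg_twistCLM θ hε' _ F
      exact h ε hε (neg_neg ε).symm)

end Group

end Twist

/-! ### The Fourier transform of a nondegenerate bilinear form -/

section BilinFourier

variable {Y ι : Type*} [NormedAddCommGroup Y] [NormedSpace ℝ Y] [FiniteDimensional ℝ Y]
  [MeasurableSpace Y] [BorelSpace Y]
  [Fintype ι] [DecidableEq ι]

/-- The Haar measure of volume `√|det B(bᵢ, bⱼ)|` on the parallelepiped of the basis `b`. -/
noncomputable def basisMeasure (b : Module.Basis ι ℝ Y) (B : LinearMap.BilinForm ℝ Y) : Measure Y :=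
  ENNReal.ofReal (√|(Matrix.of fun i j => B (b i) (b j)).det|) • b.addHaar

theorem map_equivFunL_symm_volume (b : Module.Basis ι ℝ Y) :
    (volume : Measure (EuclideanSpace ℝ ι)).map
      ((EuclideanSpace.equiv ι ℝ).trans b.equivFunL.symm) = b.addHaar := by
  rw [← (EuclideanSpace.basisFun ι ℝ).addHaar_eq_volume, Module.Basis.map_addHaar]
  congr 1
  ext i
  change b.equivFun.symm (EuclideanSpace.basisFun ι ℝ i).ofLp = b i
  rw [Module.Basis.equivFun_symm_apply]
  simp

/-- The Fourier transform `ψ ↦ ∫ e^{-2πi B(y,·)} ψ(y) dy` of a nondegenerate bilinear form `B`. With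
the normalization of the measure by `B`, the integral of the transform of `ψ` is `ψ 0`, as follows
from the Fourier inversion formula of a Euclidean space. -/
theorem exists_bilinFourier (b : Module.Basis ι ℝ Y) (B : LinearMap.BilinForm ℝ Y)
    (hB : (Matrix.of fun i j => B (b i) (b j)).det ≠ 0) :
    ∃ T : 𝓢(Y, ℂ) →L[ℂ] 𝓢(Y, ℂ),
      (∀ ψ η, T ψ η = ∫ y, Complex.exp (↑(-2 * Real.pi * B y η) * Complex.I) * ψ y
        ∂(basisMeasure b B)) ∧ ∀ ψ, ∫ η, T ψ η ∂(basisMeasure b B) = ψ 0 := by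
  set M : Matrix ι ι ℝ := Matrix.of fun i j => B (b i) (b j) with hM
  set c : ℝ := √|M.det| with hc
  have hc0 : 0 < c := Real.sqrt_pos.2 (abs_pos.2 hB)
  have hcc : c * c = |M.det| := Real.mul_self_sqrt (abs_nonneg _)
  -- in the coordinates of the basis, `B (e u) (e v)` is the inner product of `u` and `M v`, so that
  -- the transform is the Euclidean one, evaluated at `M v`
  set e : EuclideanSpace ℝ ι ≃L[ℝ] Y := (EuclideanSpace.equiv ι ℝ).trans b.equivFunL.symm with he
  have hmap : (volume : Measure (EuclideanSpace ℝ ι)).map e = b.addHaar :=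
    map_equivFunL_symm_volume b
  have he_apply : ∀ u, e u = ∑ i, u i • b i := fun u => by
    exact b.equivFun_symm_apply u.ofLp
  set S : EuclideanSpace ℝ ι →ₗ[ℝ] EuclideanSpace ℝ ι := Matrix.toEuclideanLin M with hS
  have hdet : LinearMap.det S = M.det := by
    rw [hS, Matrix.toEuclideanLin_eq_toLin_orthonormal, LinearMap.det_toLin]
  have hinner : ∀ u v, inner ℝ u (S v) = B (e u) (e v) := fun u v => by
    simp only [he_apply, map_sum, map_smul, LinearMap.sum_apply, LinearMap.smul_apply,
      smul_eq_mul, Finset.mul_sum]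
    rw [PiLp.inner_apply, Finset.sum_comm]
    refine Finset.sum_congr rfl fun i _ => ?_
    rw [hS, Matrix.toLpLin_apply]
    simp only [Matrix.mulVec, dotProduct, hM, Matrix.of_apply, RCLike.inner_apply, conj_trivial,
      Finset.sum_mul]
    exact Finset.sum_congr rfl fun j _ => by ring
  have hSdet : LinearMap.det S ≠ 0 := hdet ▸ hB
  set S' : EuclideanSpace ℝ ι ≃L[ℝ] EuclideanSpace ℝ ι :=
    (LinearMap.equivOfIsUnitDet (isUnit_iff_ne_zero.2 hSdet)).toContinuousLinearEquiv with hS'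
  have hS'S : ∀ u, S' u = S u := fun u =>
    LinearMap.equivOfIsUnitDet_apply (isUnit_iff_ne_zero.2 hSdet) u
  set R : Y ≃L[ℝ] EuclideanSpace ℝ ι := e.symm.trans S' with hR
  have hemb := e.toHomeomorph.measurableEmbedding
  have hint : ∀ G : Y → ℂ, ∫ y, G y ∂(basisMeasure b B) = c * ∫ u, G (e u) := fun G => by
    rw [basisMeasure, integral_smul_measure, ENNReal.toReal_ofReal hc0.le, ← hmap,
      Complex.real_smul]
    exact congr_arg _ (hemb.integral_map G)
  have hTval : ∀ (ψ : 𝓢(Y, ℂ)) (η : Y), (c : ℂ) * FourierTransform.fourier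
      (SchwartzMap.compCLMOfContinuousLinearEquiv ℂ e ψ) (R η) =
      ∫ y, Complex.exp (↑(-2 * Real.pi * B y η) * Complex.I) * ψ y ∂(basisMeasure b B) := by
    intro ψ η
    rw [hint, SchwartzMap.fourier_coe, Real.fourier_eq']
    congr 2
    funext u
    have : inner ℝ u (R η) = B (e u) η := by
      change inner ℝ u (S' (e.symm η)) = _
      rw [hS'S, hinner, e.apply_symm_apply]
    rw [this, smul_eq_mul]
    rfl
  refine ⟨(c : ℂ) • (SchwartzMap.compCLMOfContinuousLinearEquiv ℂ R).comp
    ((FourierTransform.fourierCLM ℂ 𝓢(EuclideanSpace ℝ ι, ℂ)).comp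
      (SchwartzMap.compCLMOfContinuousLinearEquiv ℂ e)), hTval, fun ψ => ?_⟩
  set ψ' := SchwartzMap.compCLMOfContinuousLinearEquiv ℂ e ψ with hψ'
  change ∫ η, (c : ℂ) * FourierTransform.fourier ψ' (R η) ∂(basisMeasure b B) = ψ 0
  rw [hint, integral_const_mul]
  have h1 : ∀ u, R (e u) = S u := fun u => by
    change S' (e.symm (e u)) = _
    rw [e.symm_apply_apply, hS'S]
  simp only [h1]
  -- the Jacobian `|det M|⁻¹` cancels the two factors `c = √|det M|`
  have h2 : ∫ u, FourierTransform.fourier ψ' (S u) = (|M.det|⁻¹ : ℝ) *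
      ∫ w, FourierTransform.fourier ψ' w := by
    have := S'.toHomeomorph.measurableEmbedding.integral_map (μ := volume)
      (fun w => FourierTransform.fourier ψ' w)
    have h6 : (volume : Measure (EuclideanSpace ℝ ι)).map S'.toHomeomorph =
        ENNReal.ofReal |M.det⁻¹| • volume := by
      rw [← hdet, ← Measure.map_linearMap_addHaar_eq_smul_addHaar volume hSdet]
      exact congr_arg (fun f => Measure.map f volume) (funext hS'S)
    rw [h6, integral_smul_measure, ENNReal.toReal_ofReal (abs_nonneg _), abs_inv,
      Complex.real_smul] at this
    rw [this]
    exact integral_congr_ae (Eventually.of_forall fun u => by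
      change _ = FourierTransform.fourier ψ' (S' u)
      rw [hS'S])
  have h3 : ∫ w, FourierTransform.fourier ψ' w = ψ 0 := by
    have h4 : FourierTransform.fourierInv (FourierTransform.fourier ψ') = ψ' :=
      FourierTransform.fourierInv_fourier_eq ψ'
    have h5 : (FourierTransform.fourierInv (FourierTransform.fourier ψ') :
        𝓢(EuclideanSpace ℝ ι, ℂ)) 0 = ψ' 0 := by rw [h4]
    rw [SchwartzMap.fourierInv_coe, Real.fourierInv_eq'] at h5
    simpa [hψ'] using h5
  rw [h2, h3, ← mul_assoc, ← mul_assoc, ← Complex.ofReal_mul, hcc, ← Complex.ofReal_mul,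
    mul_inv_cancel₀ (abs_ne_zero.2 hB), Complex.ofReal_one, one_mul]

end BilinFourier

section Symplectic

variable {V : Type*} [NormedAddCommGroup V] [NormedSpace ℝ V]

/-- The bilinear form `((x, ℓ), (z, s)) ↦ ω₀(x, z) + ℓ s` on `V × ℝ`. -/
noncomputable def prodForm (ω₀ : LinearMap.BilinForm ℝ V) : LinearMap.BilinForm ℝ (V × ℝ) :=
  LinearMap.mk₂ ℝ (fun y η => ω₀ y.1 η.1 + y.2 * η.2)
    (fun y y' η => by simp; ring) (fun c y η => by simp; ring)
    (fun y η η' => by simp; ring) (fun c y η => by simp; ring)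

theorem prodForm_apply (ω₀ : LinearMap.BilinForm ℝ V) (y η : V × ℝ) :
    prodForm ω₀ y η = ω₀ y.1 η.1 + y.2 * η.2 := rfl

variable [FiniteDimensional ℝ V]

/-- A basis of `V × ℝ`. -/
noncomputable def prodBasis (V : Type*) [NormedAddCommGroup V] [NormedSpace ℝ V]
    [FiniteDimensional ℝ V] : Module.Basis (Fin (Module.finrank ℝ V) ⊕ Unit) ℝ (V × ℝ) :=
  (Module.finBasis ℝ V).prod (Module.Basis.singleton Unit ℝ)

theorem det_prodForm (ω₀ : LinearMap.BilinForm ℝ V) :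
    (Matrix.of fun i j => prodForm ω₀ (prodBasis V i) (prodBasis V j)).det =
      (Matrix.of fun i j => ω₀ (Module.finBasis ℝ V i) (Module.finBasis ℝ V j)).det := by
  have h : (Matrix.of fun i j => prodForm ω₀ (prodBasis V i) (prodBasis V j)) =
      Matrix.fromBlocks (Matrix.of fun i j => ω₀ (Module.finBasis ℝ V i) (Module.finBasis ℝ V j))
        0 0 1 := by
    ext i j
    rcases i with i | i <;> rcases j with j | j <;> simp [prodForm_apply, prodBasis]
  rw [h, Matrix.det_fromBlocks_zero₂₁, Matrix.det_one, mul_one]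

theorem det_ne_zero_of_nondegenerate {ω₀ : LinearMap.BilinForm ℝ V} (hω : ω₀.Nondegenerate) :
    (Matrix.of fun i j => ω₀ (Module.finBasis ℝ V i) (Module.finBasis ℝ V j)).det ≠ 0 := by
  have h := (LinearMap.BilinForm.nondegenerate_iff_det_ne_zero (Module.finBasis ℝ V)).1 hω
  convert h using 2
  ext i j
  simp [LinearMap.BilinForm.toMatrix_apply]

variable [MeasurableSpace V] [BorelSpace V]

theorem isAddHaarMeasure_liouville {ω₀ : LinearMap.BilinForm ℝ V} (hω : ω₀.Nondegenerate) :
    (liouville ω₀).IsAddHaarMeasure :=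
  Measure.IsAddHaarMeasure.smul _
    (ENNReal.ofReal_pos.2 (Real.sqrt_pos.2 (abs_pos.2 (det_ne_zero_of_nondegenerate hω)))).ne'
    ENNReal.ofReal_ne_top

theorem basisMeasure_prodBasis (ω₀ : LinearMap.BilinForm ℝ V) :
    basisMeasure (prodBasis V) (prodForm ω₀) = (liouville ω₀).prod volume := by
  have h : (Module.Basis.singleton Unit ℝ).addHaar = volume := by
    rw [← (OrthonormalBasis.singleton Unit ℝ).addHaar_eq_volume,
      OrthonormalBasis.toBasis_singleton]
  rw [basisMeasure, det_prodForm, prodBasis, Module.Basis.prod_addHaar, h, liouville,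
    Measure.prod_smul_left]

/-- The Fourier transform of `V × ℝ` defined by the symplectic form. -/
theorem exists_symplFourier {ω₀ : LinearMap.BilinForm ℝ V} (hω : ω₀.Nondegenerate) :
    ∃ T : 𝓢(V × ℝ, ℂ) →L[ℂ] 𝓢(V × ℝ, ℂ),
      (∀ ψ η, T ψ η = ∫ y, Complex.exp (↑(-2 * Real.pi * prodForm ω₀ y η) * Complex.I) * ψ y
        ∂((liouville ω₀).prod volume)) ∧
      ∀ ψ, ∫ η, T ψ η ∂((liouville ω₀).prod volume) = ψ 0 := by
  rw [← basisMeasure_prodBasis]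
  exact exists_bilinFourier _ _ (by
    rw [det_prodForm]; exact det_ne_zero_of_nondegenerate hω)

end Symplectic

/-! ### The partial symplectic Fourier transform of the cut-off function -/

/-- An integrable weight on a finite-dimensional space. -/
noncomputable def decayWeight (E : Type*) [NormedAddCommGroup E] [NormedSpace ℝ E] (x : E) : ℝ :=
  ((1 + ‖x‖) ^ (Module.finrank ℝ E + 1))⁻¹

section Decay

variable {E : Type*} [NormedAddCommGroup E] [NormedSpace ℝ E]

theorem decayWeight_pos (x : E) : 0 < decayWeight E x := by
  unfold decayWeight; positivity

theorem integrable_decayWeight [FiniteDimensional ℝ E] [MeasurableSpace E] [BorelSpace E]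
    (μ : Measure E) [μ.IsAddHaarMeasure] : Integrable (decayWeight E) μ := by
  have h := integrable_one_add_norm (E := E) (μ := μ) (r := (Module.finrank ℝ E + 1 : ℕ))
    (by push_cast; linarith)
  refine h.congr (Eventually.of_forall fun x => ?_)
  simp only [decayWeight]
  rw [Real.rpow_neg (by positivity), Real.rpow_natCast]

theorem SchwartzMap.exists_one_add_pow_mul_le (F : 𝓢(E, ℂ)) (N : ℕ) :
    ∃ C : ℝ, 0 ≤ C ∧ ∀ x, (1 + ‖x‖) ^ N * ‖F x‖ ≤ C := by
  have h := fun x => SchwartzMap.one_add_le_sup_seminorm_apply (𝕜 := ℝ) (m := (N, 0)) le_rfl le_rfl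
    F x
  simp only [norm_iteratedFDeriv_zero] at h
  exact ⟨_, le_trans (by positivity) (h 0), h⟩

theorem SchwartzMap.exists_norm_le_decayWeight (F : 𝓢(E, ℂ)) :
    ∃ C : ℝ, 0 ≤ C ∧ ∀ x, ‖F x‖ ≤ C * decayWeight E x := by
  obtain ⟨C, hC, h⟩ := F.exists_one_add_pow_mul_le (Module.finrank ℝ E + 1)
  refine ⟨C, hC, fun x => ?_⟩
  rw [decayWeight, ← div_eq_mul_inv, le_div_iff₀ (by positivity), mul_comm]
  exact h x

end Decay

section PartialSympl

variable {V : Type*} [NormedAddCommGroup V] [NormedSpace ℝ V]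

/-- The function `y ↦ χ((r₁, y), g₂)` for `q = (r₁, g₂)`. -/
noncomputable def slicePair (q : ℝ × JGroup V) :
    𝓢(JGroup V × JGroup V, ℂ) →L[ℂ] 𝓢(V × ℝ, ℂ) :=
  SchwartzMap.compCLM ℂ (g := fun y : V × ℝ => ((q.1, y), q.2))
    (by
      have h : (fun y : V × ℝ => (((q.1, y), q.2) : JGroup V × JGroup V)) = fun y =>
          ((ContinuousLinearMap.inl ℝ (JGroup V) (JGroup V)).comp
            (ContinuousLinearMap.inr ℝ ℝ (V × ℝ))) y + ((q.1, 0), q.2) := by ext y <;> simp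
      rw [h]
      exact (ContinuousLinearMap.hasTemperateGrowth _).add (.const _))
    ⟨1, 1, fun y => by
      have h : ‖y‖ ≤ ‖(((q.1, y), q.2) : JGroup V × JGroup V)‖ :=
        (norm_snd_le (q.1, y)).trans (norm_fst_le (((q.1, y), q.2) : JGroup V × JGroup V))
      rw [one_mul, pow_one]; linarith⟩

theorem slicePair_apply (q : ℝ × JGroup V) (χ : 𝓢(JGroup V × JGroup V, ℂ)) (y : V × ℝ) :
    slicePair q χ y = χ ((q.1, y), q.2) := rfl

theorem seminorm_slicePair_le (q : ℝ × JGroup V) (χ : 𝓢(JGroup V × JGroup V, ℂ)) (k n : ℕ) :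
    SchwartzMap.seminorm ℂ k n (slicePair q χ) ≤ SchwartzMap.seminorm ℂ k n χ := by
  refine SchwartzMap.seminorm_le_bound ℂ k n _ (apply_nonneg _ _) fun y => ?_
  set L : V × ℝ →L[ℝ] JGroup V × JGroup V :=
    (ContinuousLinearMap.inl ℝ (JGroup V) (JGroup V)).comp (ContinuousLinearMap.inr ℝ ℝ (V × ℝ))
    with hL
  set c : JGroup V × JGroup V := ((q.1, 0), q.2)
  have hLn : ‖L‖ ≤ 1 := L.opNorm_le_bound zero_le_one fun y => by
    rw [one_mul]
    simp [hL, Prod.norm_def]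
  have h1 : (slicePair q χ : V × ℝ → ℂ) = (fun p => χ (p + c)) ∘ L := by
    funext y
    rw [slicePair_apply]
    simp [hL, c]
  have hy : ‖y‖ ≤ ‖L y + c‖ := by
    have e : L y + c = ((q.1, y), q.2) := by simp [hL, c]
    rw [e]
    exact (norm_snd_le (q.1, y)).trans (norm_fst_le (((q.1, y), q.2) : JGroup V × JGroup V))
  have h2 : ‖iteratedFDeriv ℝ n (slicePair q χ) y‖ ≤ ‖iteratedFDeriv ℝ n χ (L y + c)‖ := by
    rw [h1]
    have := norm_iteratedFDeriv_comp_clm_le (f := fun p => χ (p + c))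
      (χ.smooth'.comp (contDiff_id.add contDiff_const)) L hLn n y
    rwa [iteratedFDeriv_comp_add_right] at this
  calc ‖y‖ ^ k * ‖iteratedFDeriv ℝ n (slicePair q χ) y‖
      ≤ ‖L y + c‖ ^ k * ‖iteratedFDeriv ℝ n χ (L y + c)‖ := by gcongr
    _ ≤ _ := SchwartzMap.le_seminorm ℂ k n χ _

variable [FiniteDimensional ℝ V] [MeasurableSpace V] [BorelSpace V]
  (ω₀ : LinearMap.BilinForm ℝ V)

/-- The symplectic Fourier transform of `y ↦ χ((r₁, y), g₂)`, for `q = (r₁, g₂)`. -/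
noncomputable def partialSympl (χ : 𝓢(JGroup V × JGroup V, ℂ)) (q : ℝ × JGroup V) (η : V × ℝ) : ℂ :=
  ∫ y, Complex.exp (↑(-2 * Real.pi * prodForm ω₀ y η) * Complex.I) * χ ((q.1, y), q.2)
    ∂((liouville ω₀).prod volume)

theorem isAddHaarMeasure_liouville_prod {ω₀ : LinearMap.BilinForm ℝ V} (hω : ω₀.Nondegenerate) :
    ((liouville ω₀).prod (volume : Measure ℝ)).IsAddHaarMeasure := by
  have := isAddHaarMeasure_liouville hω
  infer_instance

/-- The bound is uniform in the parameter `q`, on which the transform depends through a slice of `χ`. -/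
theorem exists_norm_partialSympl_le {ω₀ : LinearMap.BilinForm ℝ V} (hω : ω₀.Nondegenerate)
    (χ : 𝓢(JGroup V × JGroup V, ℂ)) : ∃ C : ℝ, 0 ≤ C ∧ ∀ q η,
      ‖partialSympl ω₀ χ q η‖ ≤ C * decayWeight (V × ℝ) η := by
  obtain ⟨T, hT, -⟩ := exists_symplFourier hω
  set N := Module.finrank ℝ (V × ℝ) + 1 with hN
  set p : Seminorm ℂ 𝓢(V × ℝ, ℂ) := ((Finset.Iic (N, 0)).sup
    (fun m => SchwartzMap.seminorm ℂ m.1 m.2)).comp T.toLinearMap with hp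
  have hpc : Continuous p := by
    refine Continuous.comp (g := ((Finset.Iic (N, 0)).sup
      (fun m => SchwartzMap.seminorm ℂ m.1 m.2) : Seminorm ℂ 𝓢(V × ℝ, ℂ))) ?_ T.continuous
    exact Seminorm.continuous_finsetSup fun i _ => SchwartzMap.continuous_seminorm i.1 i.2
  obtain ⟨s, C, hC, hle⟩ := exists_seminorm_le_sum hpc
  refine ⟨2 ^ N * (C * ∑ i ∈ s, SchwartzMap.seminorm ℂ i.1 i.2 χ), by positivity, fun q η => ?_⟩
  have h1 := SchwartzMap.one_add_le_sup_seminorm_apply (𝕜 := ℂ) (m := (N, 0)) le_rfl le_rfl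
    (T (slicePair q χ)) η
  rw [norm_iteratedFDeriv_zero, hT] at h1
  have h2 : p (slicePair q χ) ≤ C * ∑ i ∈ s, SchwartzMap.seminorm ℂ i.1 i.2 χ :=
    (hle _).trans (mul_le_mul_of_nonneg_left (Finset.sum_le_sum fun i _ =>
      seminorm_slicePair_le q χ i.1 i.2) hC)
  rw [decayWeight, ← div_eq_mul_inv, le_div_iff₀ (by positivity), mul_comm]
  exact h1.trans (mul_le_mul_of_nonneg_left h2 (by positivity))

/-- Fourier inversion at the origin: this turns the regularization into the factor `χ 0 = 1` in the
limit. -/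
theorem integral_partialSympl_zero {ω₀ : LinearMap.BilinForm ℝ V} (hω : ω₀.Nondegenerate)
    (χ : 𝓢(JGroup V × JGroup V, ℂ)) :
    ∫ η, partialSympl ω₀ χ 0 η ∂((liouville ω₀).prod volume) = χ 0 := by
  obtain ⟨T, hT, hT0⟩ := exists_symplFourier hω
  have h := hT0 (slicePair 0 χ)
  simp only [hT] at h
  exact h

omit [MeasurableSpace V] [BorelSpace V] in
theorem continuous_prodForm : Continuous fun p : (V × ℝ) × (V × ℝ) => prodForm ω₀ p.1 p.2 :=
  (prodForm ω₀).toContinuousBilinearMap.continuous₂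

omit [MeasurableSpace V] [BorelSpace V] in
theorem continuous_partialSympl_integrand (χ : 𝓢(JGroup V × JGroup V, ℂ)) :
    Continuous fun p : ((ℝ × JGroup V) × (V × ℝ)) × (V × ℝ) =>
      Complex.exp (↑(-2 * Real.pi * prodForm ω₀ p.2 p.1.2) * Complex.I) *
        χ ((p.1.1.1, p.2), p.1.1.2) := by
  have h1 : Continuous fun p : ((ℝ × JGroup V) × (V × ℝ)) × (V × ℝ) => prodForm ω₀ p.2 p.1.2 :=
    (continuous_prodForm ω₀).comp (continuous_snd.prodMk (continuous_snd.comp continuous_fst))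
  have h2 : Continuous fun p : ((ℝ × JGroup V) × (V × ℝ)) × (V × ℝ) =>
      (((p.1.1.1, p.2), p.1.1.2) : JGroup V × JGroup V) :=
    ((continuous_fst.comp (continuous_fst.comp continuous_fst)).prodMk continuous_snd).prodMk
      (continuous_snd.comp (continuous_fst.comp continuous_fst))
  exact (Complex.continuous_exp.comp ((Complex.continuous_ofReal.comp
    (continuous_const.mul h1)).mul continuous_const)).mul (χ.continuous.comp h2)

theorem continuous_partialSympl {ω₀ : LinearMap.BilinForm ℝ V} (hω : ω₀.Nondegenerate)
    (χ : 𝓢(JGroup V × JGroup V, ℂ)) :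
    Continuous fun p : (ℝ × JGroup V) × (V × ℝ) => partialSympl ω₀ χ p.1 p.2 := by
  have := isAddHaarMeasure_liouville_prod hω
  obtain ⟨C, hC, h⟩ := χ.exists_one_add_pow_mul_le (Module.finrank ℝ (V × ℝ) + 1)
  have hc := continuous_partialSympl_integrand ω₀ χ
  unfold partialSympl
  refine continuous_of_dominated (μ := (liouville ω₀).prod volume)
    (F := fun p : (ℝ × JGroup V) × (V × ℝ) => fun y : V × ℝ =>
      Complex.exp (↑(-2 * Real.pi * prodForm ω₀ y p.2) * Complex.I) * χ ((p.1.1, y), p.1.2))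
    (bound := fun y => C * decayWeight (V × ℝ) y)
    ?_ ?_ ?_ ?_
  · intro p
    exact (hc.comp (Continuous.prodMk_right p)).aestronglyMeasurable
  · refine fun p => Eventually.of_forall fun y => ?_
    have hy : ‖y‖ ≤ ‖(((p.1.1, y), p.1.2) : JGroup V × JGroup V)‖ :=
      (norm_snd_le (p.1.1, y)).trans (norm_fst_le (((p.1.1, y), p.1.2) : JGroup V × JGroup V))
    rw [norm_mul, Complex.norm_exp_ofReal_mul_I, one_mul, decayWeight, ← div_eq_mul_inv,
      le_div_iff₀ (by positivity), mul_comm]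
    exact le_trans (mul_le_mul_of_nonneg_right (pow_le_pow_left₀ (by positivity)
      (add_le_add_right hy 1) _) (norm_nonneg _)) (h ((p.1.1, y), p.1.2))
  · exact (integrable_decayWeight ((liouville ω₀).prod volume)).const_mul C
  · refine Eventually.of_forall fun y => ?_
    have hp : Continuous fun p : (ℝ × JGroup V) × (V × ℝ) => (p, y) :=
      Continuous.prodMk_left y
    have h3 := hc.comp hp
    simp only [Function.comp_def] at h3
    exact h3

end PartialSympl

/-! ### Absolute convergence of the regularized star-product -/

theorem cosh_sub_le (u v : ℝ) : Real.cosh (u - v) ≤ 2 * (Real.cosh u * Real.cosh v) := by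
  rw [Real.cosh_sub]
  have h : |Real.sinh u * Real.sinh v| ≤ Real.cosh u * Real.cosh v := by
    rw [abs_mul, Real.abs_sinh, Real.abs_sinh, ← Real.cosh_abs u, ← Real.cosh_abs v]
    exact mul_le_mul (Real.sinh_lt_cosh _).le (Real.sinh_lt_cosh _).le
      (Real.sinh_nonneg_iff.2 (abs_nonneg v)) (Real.cosh_pos _).le
  linarith [neg_abs_le (Real.sinh u * Real.sinh v)]

theorem cosh_le_cosh_two_mul (u : ℝ) : Real.cosh u ≤ Real.cosh (2 * u) := by
  rw [Real.cosh_le_cosh, abs_mul, abs_two]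
  linarith [abs_nonneg u]

theorem one_add_sq_le_cosh_two_mul (u : ℝ) : 1 + u ^ 2 ≤ Real.cosh (2 * u) := by
  rw [Real.cosh_two_mul, Real.cosh_sq]
  have h : |u| ≤ |Real.sinh u| := by
    rw [Real.abs_sinh]; exact Real.self_le_sinh_iff.2 (abs_nonneg u)
  have := sq_le_sq.2 h
  nlinarith [sq_nonneg u]

theorem cosh_two_mul_le (u : ℝ) : Real.cosh (2 * u) ≤ 1 + |Real.sinh (2 * u)| := by
  rw [cosh_two_mul_eq_sqrt, ← sq_abs]
  exact (Real.sqrt_le_left (by positivity)).2 (by nlinarith [abs_nonneg (Real.sinh (2 * u))])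

section Star

variable {V : Type*} [NormedAddCommGroup V] [NormedSpace ℝ V]

omit [NormedAddCommGroup V] [NormedSpace ℝ V] in
theorem starAmp_nonneg (n : ℕ) (g g₁ g₂ : JGroup V) : 0 ≤ starAmp n g g₁ g₂ := by
  unfold starAmp
  have := Real.cosh_pos (g₂.1 - g.1)
  have := Real.cosh_pos (g₁.1 - g.1)
  have := Real.cosh_pos (g₁.1 - g₂.1)
  positivity

omit [NormedAddCommGroup V] [NormedSpace ℝ V] in
/-- The amplitude is bounded by powers of `cosh 2a₁` and `cosh 2a₂`, for fixed `g`. -/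
theorem starAmp_le (n : ℕ) (g g₁ g₂ : JGroup V) : starAmp n g g₁ g₂ ≤
    4 * (8 * Real.cosh (2 * g.1) ^ 2) ^ (n + 1) * Real.cosh (2 * g₁.1) ^ (2 * n + 2) *
      Real.cosh (2 * g₂.1) ^ (2 * n + 2) := by
  set c := Real.cosh (2 * g.1)
  set c₁ := Real.cosh (2 * g₁.1)
  set c₂ := Real.cosh (2 * g₂.1)
  have hc : 0 < c := Real.cosh_pos _
  have hc₁ : 0 < c₁ := Real.cosh_pos _
  have hc₂ : 0 < c₂ := Real.cosh_pos _
  have h2 : ∀ u v : ℝ, Real.cosh (2 * (u - v)) ≤ 2 * (Real.cosh (2 * u) * Real.cosh (2 * v)) :=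
    fun u v => by rw [mul_sub]; exact cosh_sub_le _ _
  have h1 : ∀ u v : ℝ, Real.cosh (u - v) ≤ 2 * (Real.cosh (2 * u) * Real.cosh (2 * v)) :=
    fun u v => (cosh_le_cosh_two_mul _).trans (h2 u v)
  have e1 : √(Real.cosh (2 * (g₁.1 - g₂.1)) * Real.cosh (2 * (g₁.1 - g.1))
      * Real.cosh (2 * (g.1 - g₂.1))) ≤ 2 * (c₁ * c₂) * (2 * (c₁ * c)) * (2 * (c * c₂)) := by
    have hpos : 0 < Real.cosh (2 * (g₁.1 - g₂.1)) * Real.cosh (2 * (g₁.1 - g.1))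
      * Real.cosh (2 * (g.1 - g₂.1)) :=
      mul_pos (mul_pos (Real.cosh_pos _) (Real.cosh_pos _)) (Real.cosh_pos _)
    have hone : 1 ≤ Real.cosh (2 * (g₁.1 - g₂.1)) * Real.cosh (2 * (g₁.1 - g.1))
      * Real.cosh (2 * (g.1 - g₂.1)) :=
      one_le_mul_of_one_le_of_one_le (one_le_mul_of_one_le_of_one_le (Real.one_le_cosh _)
        (Real.one_le_cosh _)) (Real.one_le_cosh _)
    refine ((Real.sqrt_le_left hpos.le).2 (le_self_pow₀ hone two_ne_zero)).trans ?_
    exact mul_le_mul (mul_le_mul (h2 _ _) (h2 _ _) (Real.cosh_pos _).le (by positivity)) (h2 _ _)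
      (Real.cosh_pos _).le (by positivity)
  have e2 : Real.cosh (g₂.1 - g.1) ^ n ≤ (2 * (c₂ * c)) ^ n :=
    pow_le_pow_left₀ (Real.cosh_pos _).le (h1 _ _) n
  have e3 : Real.cosh (g₁.1 - g.1) ^ n ≤ (2 * (c₁ * c)) ^ n :=
    pow_le_pow_left₀ (Real.cosh_pos _).le (h1 _ _) n
  have e4 : Real.cosh (g₁.1 - g₂.1) ^ n ≤ (2 * (c₁ * c₂)) ^ n :=
    pow_le_pow_left₀ (Real.cosh_pos _).le (h1 _ _) n
  have p2 := (pow_pos (Real.cosh_pos (g₂.1 - g.1)) n).le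
  have p3 := (pow_pos (Real.cosh_pos (g₁.1 - g.1)) n).le
  have p4 := (pow_pos (Real.cosh_pos (g₁.1 - g₂.1)) n).le
  calc starAmp n g g₁ g₂ ≤ 4 * (2 * (c₁ * c₂) * (2 * (c₁ * c)) * (2 * (c * c₂))) *
        (2 * (c₂ * c)) ^ n * (2 * (c₁ * c)) ^ n * (2 * (c₁ * c₂)) ^ n := by
        unfold starAmp
        exact mul_le_mul (mul_le_mul (mul_le_mul (mul_le_mul_of_nonneg_left e1 (by norm_num)) e2 p2
          (by positivity)) e3 p3 (by positivity)) e4 p4 (by positivity)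
    _ = 4 * (8 * c ^ 2) ^ (n + 1) * c₁ ^ (2 * n + 2) * c₂ ^ (2 * n + 2) := by
        have e : ∀ t : ℝ, t ^ (2 * n + 2) = (t ^ 2) ^ n * t ^ 2 := fun t => by
          rw [pow_add, pow_mul]
        rw [mul_assoc, mul_assoc, ← mul_pow, mul_assoc, ← mul_pow, e, e, pow_succ]
        have : (2 * (c₂ * c) * (2 * (c₁ * c) * (2 * (c₁ * c₂)))) = 8 * c ^ 2 * c₁ ^ 2 * c₂ ^ 2 := by
          ring
        rw [this, mul_pow, mul_pow _ (c₁ ^ 2)]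
        ring

variable [FiniteDimensional ℝ V] (ω₀ : LinearMap.BilinForm ℝ V)

theorem continuous_bilin : Continuous fun p : V × V => ω₀ p.1 p.2 :=
  ω₀.toContinuousBilinearMap.continuous₂

theorem Continuous.bilin {X : Type*} [TopologicalSpace X] {u v : X → V} (hu : Continuous u)
    (hv : Continuous v) : Continuous fun p => ω₀ (u p) (v p) :=
  (continuous_bilin ω₀).comp (hu.prodMk hv)

omit [NormedSpace ℝ V] [FiniteDimensional ℝ V] in
theorem continuous_starAmp (n : ℕ) :
    Continuous fun p : JGroup V × JGroup V × JGroup V => starAmp n p.1 p.2.1 p.2.2 := by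
  unfold starAmp
  fun_prop

theorem continuous_starPhase (ε : ℝ) :
    Continuous fun p : JGroup V × JGroup V × JGroup V => starPhase ω₀ ε p.1 p.2.1 p.2.2 := by
  have h1 := Continuous.bilin ω₀
    (by fun_prop : Continuous fun p : JGroup V × JGroup V × JGroup V => p.2.1.2.1)
    (by fun_prop : Continuous fun p : JGroup V × JGroup V × JGroup V => p.2.2.2.1)
  have h2 := Continuous.bilin ω₀
    (by fun_prop : Continuous fun p : JGroup V × JGroup V × JGroup V => p.2.2.2.1)
    (by fun_prop : Continuous fun p : JGroup V × JGroup V × JGroup V => p.1.2.1)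
  have h3 := Continuous.bilin ω₀
    (by fun_prop : Continuous fun p : JGroup V × JGroup V × JGroup V => p.1.2.1)
    (by fun_prop : Continuous fun p : JGroup V × JGroup V × JGroup V => p.2.1.2.1)
  have k : Continuous fun p : JGroup V × JGroup V × JGroup V =>
      -Real.sinh (2 * (p.2.1.1 - p.2.2.1)) * p.1.2.2
        - Real.sinh (2 * (p.2.2.1 - p.1.1)) * p.2.1.2.2
        - Real.sinh (2 * (p.1.1 - p.2.1.1)) * p.2.2.2.2 := by fun_prop
  have k1 : Continuous fun p : JGroup V × JGroup V × JGroup V =>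
      Real.cosh (p.2.1.1 - p.1.1) * Real.cosh (p.2.2.1 - p.1.1) := by fun_prop
  have k2 : Continuous fun p : JGroup V × JGroup V × JGroup V =>
      Real.cosh (p.2.1.1 - p.1.1) * Real.cosh (p.2.1.1 - p.2.2.1) := by fun_prop
  have k3 : Continuous fun p : JGroup V × JGroup V × JGroup V =>
      Real.cosh (p.2.1.1 - p.2.2.1) * Real.cosh (p.2.2.1 - p.1.1) := by fun_prop
  exact continuous_const.mul (((k.add (k1.mul h1)).add (k2.mul h2)).add (k3.mul h3))

omit [FiniteDimensional ℝ V] in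
theorem norm_starFactor (θ ε : ℝ) (n : ℕ) (g g₁ g₂ : JGroup V) :
    ‖(starAmp n g g₁ g₂ : ℂ) * Complex.exp (-(2 * Complex.I / (θ : ℂ)) *
      (starPhase ω₀ ε g g₁ g₂ : ℂ))‖ = starAmp n g g₁ g₂ := by
  have h : -(2 * Complex.I / (θ : ℂ)) * (starPhase ω₀ ε g g₁ g₂ : ℂ) =
      ((-(2 / θ) * starPhase ω₀ ε g g₁ g₂ : ℝ) : ℂ) * Complex.I := by
    push_cast; ring
  rw [h, norm_mul, Complex.norm_exp_ofReal_mul_I, mul_one, Complex.norm_real,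
    Real.norm_of_nonneg (starAmp_nonneg n g g₁ g₂)]

/-- Since `cosh 2a ≤ 1 + |sinh 2a|`, the function `a ↦ F (sinh 2a)` decreases faster than every power of
`cosh 2a`. -/
theorem exists_norm_schwartz_sinh_le (F : 𝓢(ℝ, ℂ)) (k : ℕ) : ∃ C : ℝ, 0 ≤ C ∧ ∀ a : ℝ,
    Real.cosh (2 * a) ^ k * ‖F (Real.sinh (2 * a))‖ ≤ C * (1 + a ^ 2)⁻¹ := by
  obtain ⟨C, hC, h⟩ := F.exists_one_add_pow_mul_le (k + 1)
  refine ⟨C, hC, fun a => ?_⟩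
  have h1 := cosh_two_mul_le a
  have h2 := one_add_sq_le_cosh_two_mul a
  have h3 := Real.cosh_pos (2 * a)
  rw [← div_eq_mul_inv, le_div_iff₀ (by positivity)]
  refine le_trans ?_ (h (Real.sinh (2 * a)))
  calc Real.cosh (2 * a) ^ k * ‖F (Real.sinh (2 * a))‖ * (1 + a ^ 2)
      ≤ Real.cosh (2 * a) ^ k * ‖F (Real.sinh (2 * a))‖ * Real.cosh (2 * a) := by gcongr
    _ = Real.cosh (2 * a) ^ (k + 1) * ‖F (Real.sinh (2 * a))‖ := by ring
    _ ≤ _ := by rw [Real.norm_eq_abs]; gcongr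

omit [FiniteDimensional ℝ V] in
theorem exists_norm_cutoff_le (χ : 𝓢(JGroup V × JGroup V, ℂ)) {δ : ℝ} (hδ : 0 < δ) (k : ℕ) :
    ∃ C : ℝ, 0 ≤ C ∧ ∀ g₁ g₂ : JGroup V, Real.cosh (2 * g₂.1) ^ k *
      ‖χ (δ • (rCoord g₁, rCoord g₂))‖ ≤
        C * (decayWeight (V × ℝ) g₁.2 * (1 + g₂.1 ^ 2)⁻¹) := by
  set N := Module.finrank ℝ (V × ℝ) + 1 with hN
  obtain ⟨C, hC, h⟩ := χ.exists_one_add_pow_mul_le (N + (k + 1))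
  set d := min δ 1 with hd
  have hd0 : 0 < d := lt_min hδ one_pos
  refine ⟨C / d ^ (N + (k + 1)), by positivity, fun g₁ g₂ => ?_⟩
  set P : JGroup V × JGroup V := (rCoord g₁, rCoord g₂) with hP
  have hb : ∀ t : ℝ, 0 ≤ t → t ≤ ‖P‖ → d * (1 + t) ≤ 1 + ‖δ • P‖ := fun t h0 ht => by
    rw [norm_smul, Real.norm_of_nonneg hδ.le]
    have := mul_le_mul (min_le_left δ 1) ht h0 hδ.le
    nlinarith [min_le_right δ 1]
  have h1 : d * (1 + ‖g₁.2‖) ≤ 1 + ‖δ • P‖ :=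
    hb _ (norm_nonneg _) ((norm_snd_le (rCoord g₁)).trans (norm_fst_le P))
  have h2 : d * Real.cosh (2 * g₂.1) ≤ 1 + ‖δ • P‖ :=
    (mul_le_mul_of_nonneg_left (cosh_two_mul_le g₂.1) hd0.le).trans
      (hb _ (abs_nonneg _) ((norm_fst_le (rCoord g₂)).trans (norm_snd_le P)))
  have h3 := one_add_sq_le_cosh_two_mul g₂.1
  have hc := Real.cosh_pos (2 * g₂.1)
  rw [decayWeight, ← hN, ← mul_inv, ← div_eq_mul_inv, div_div, le_div_iff₀ (by positivity)]
  refine le_trans ?_ (h (δ • P))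
  calc Real.cosh (2 * g₂.1) ^ k * ‖χ (δ • P)‖ *
        (d ^ (N + (k + 1)) * ((1 + ‖g₁.2‖) ^ N * (1 + g₂.1 ^ 2)))
      ≤ Real.cosh (2 * g₂.1) ^ k * ‖χ (δ • P)‖ *
        (d ^ (N + (k + 1)) * ((1 + ‖g₁.2‖) ^ N * Real.cosh (2 * g₂.1))) := by gcongr
    _ = (d * (1 + ‖g₁.2‖)) ^ N * (d * Real.cosh (2 * g₂.1)) ^ (k + 1) * ‖χ (δ • P)‖ := by
        rw [mul_pow, mul_pow, pow_add]; ring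
    _ ≤ (1 + ‖δ • P‖) ^ N * (1 + ‖δ • P‖) ^ (k + 1) * ‖χ (δ • P)‖ := by gcongr
    _ = _ := by rw [← pow_add]

variable [MeasurableSpace V] [BorelSpace V]

variable {ω₀} in
/-- The function `F` controls `a₁`, the function `h` controls `(x₂, ℓ₂)`, and the cut-off controls the
remaining variables `(x₁, ℓ₁)` and `a₂`. -/
theorem integrable_starIntegrand_mul (hω : ω₀.Nondegenerate) (θ ε : ℝ) (n : ℕ) (F : 𝓢(ℝ, ℂ))
    (h : 𝓢(V × ℝ, ℂ)) (g : JGroup V) (χ : 𝓢(JGroup V × JGroup V, ℂ)) {δ : ℝ} (hδ : 0 < δ) :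
    Integrable (fun p => starIntegrand ω₀ θ ε n (fun g₁ => F (Real.sinh (2 * g₁.1)))
      (fun g₂ => h g₂.2) g p * χ (δ • (rCoord p.1, rCoord p.2)))
      ((haarS ω₀).prod (haarS ω₀)) := by
  have := isAddHaarMeasure_liouville hω
  have := isAddHaarMeasure_liouville_prod hω
  obtain ⟨C₁, hC₁, h₁⟩ := exists_norm_schwartz_sinh_le F (2 * n + 2)
  obtain ⟨C₂, hC₂, h₂⟩ := exists_norm_cutoff_le χ hδ (2 * n + 2)
  obtain ⟨C₃, hC₃, h₃⟩ := h.exists_norm_le_decayWeight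
  set A := 4 * (8 * Real.cosh (2 * g.1) ^ 2) ^ (n + 1) with hA
  have hA0 : 0 ≤ A := by positivity
  have hw : Integrable (fun g : JGroup V => (1 + g.1 ^ 2)⁻¹ * decayWeight (V × ℝ) g.2)
      (haarS ω₀) :=
    integrable_inv_one_add_sq.mul_prod (integrable_decayWeight ((liouville ω₀).prod volume))
  have hb := ((hw.mul_prod hw).const_mul (A * (C₁ * C₂ * C₃)))
  refine hb.mono' (Continuous.aestronglyMeasurable ?_) (Eventually.of_forall fun p => ?_)
  · have c1 : Continuous fun p : JGroup V × JGroup V => starAmp n g p.1 p.2 :=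
      by
        have hp : Continuous fun p : JGroup V × JGroup V => (g, p.1, p.2) :=
          continuous_const.prodMk continuous_id
        have h0 := (continuous_starAmp n).comp hp
        simp only [Function.comp_def] at h0
        exact h0
    have c2 : Continuous fun p : JGroup V × JGroup V => starPhase ω₀ ε g p.1 p.2 :=
      by
        have hp : Continuous fun p : JGroup V × JGroup V => (g, p.1, p.2) :=
          continuous_const.prodMk continuous_id
        have h0 := (continuous_starPhase ω₀ ε).comp hp
        simp only [Function.comp_def] at h0
        exact h0
    have c3 : Continuous fun p : JGroup V × JGroup V => F (Real.sinh (2 * p.1.1)) :=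
      F.continuous.comp (by fun_prop)
    have c4 : Continuous fun p : JGroup V × JGroup V => h p.2.2 := h.continuous.comp (by fun_prop)
    have c5 : Continuous fun p : JGroup V × JGroup V => χ (δ • (rCoord p.1, rCoord p.2)) :=
      by
        have hp : Continuous fun p : JGroup V × JGroup V => δ • (rCoord p.1, rCoord p.2) :=
          Continuous.const_smul ((contDiff_rCoord.continuous.comp continuous_fst).prodMk
            (contDiff_rCoord.continuous.comp continuous_snd)) δ
        exact χ.continuous.comp hp
    have e1 : Continuous fun p : JGroup V × JGroup V => (starAmp n g p.1 p.2 : ℂ) :=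
      Complex.continuous_ofReal.comp c1
    have e2 : Continuous fun p : JGroup V × JGroup V =>
        Complex.exp (-(2 * Complex.I / (θ : ℂ)) * (starPhase ω₀ ε g p.1 p.2 : ℂ)) :=
      (continuous_const.mul (Complex.continuous_ofReal.comp c2)).cexp
    exact (((e1.mul e2).mul c3).mul c4).mul c5
  · rw [starIntegrand, norm_mul, norm_mul, norm_mul, norm_starFactor]
    have i1 := starAmp_le n g p.1 p.2
    have i2 := h₁ p.1.1
    have i3 := h₂ p.1 p.2
    have i4 := h₃ p.2.2
    have w1 : 0 < (1 + p.1.1 ^ 2)⁻¹ := by positivity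
    have w2 : 0 < (1 + p.2.1 ^ 2)⁻¹ := by positivity
    have w3 := decayWeight_pos p.1.2
    have w4 := decayWeight_pos p.2.2
    have k1 := (pow_pos (Real.cosh_pos (2 * p.1.1)) (2 * n + 2)).le
    have k2 := (pow_pos (Real.cosh_pos (2 * p.2.1)) (2 * n + 2)).le
    calc _ ≤ A * Real.cosh (2 * p.1.1) ^ (2 * n + 2) * Real.cosh (2 * p.2.1) ^ (2 * n + 2) *
          ‖F (Real.sinh (2 * p.1.1))‖ * ‖h p.2.2‖ * ‖χ (δ • (rCoord p.1, rCoord p.2))‖ := by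
          gcongr
      _ = A * ((Real.cosh (2 * p.1.1) ^ (2 * n + 2) * ‖F (Real.sinh (2 * p.1.1))‖) *
          (Real.cosh (2 * p.2.1) ^ (2 * n + 2) * ‖χ (δ • (rCoord p.1, rCoord p.2))‖) *
            ‖h p.2.2‖) := by ring
      _ ≤ A * ((C₁ * (1 + p.1.1 ^ 2)⁻¹) * (C₂ * (decayWeight (V × ℝ) p.1.2 *
          (1 + p.2.1 ^ 2)⁻¹)) * (C₃ * decayWeight (V × ℝ) p.2.2)) := by
          refine mul_le_mul_of_nonneg_left (mul_le_mul (mul_le_mul i2 i3 ?_ ?_) i4 ?_ ?_) hA0 <;>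
            positivity
      _ = _ := by ring

end Star

/-! ### Integration over the variables `(x₁, ℓ₁)` -/

section InnerIntegral

variable {V : Type*} [NormedAddCommGroup V] [NormedSpace ℝ V] (ω₀ : LinearMap.BilinForm ℝ V)

/-- The vector dual to `(x₁, ℓ₁)` in the phase of the star-product. -/
noncomputable def starDual (g : JGroup V) (a₁ : ℝ) (g₂ : JGroup V) : V × ℝ :=
  (Real.cosh (g₂.1 - g.1) • (Real.cosh (a₁ - g.1) • g₂.2.1 - Real.cosh (a₁ - g₂.1) • g.2.1),
    -Real.sinh (2 * (g₂.1 - g.1)))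

/-- The part of the phase of the star-product that does not depend on `(x₁, ℓ₁)`. -/
noncomputable def starRest (ε : ℝ) (g : JGroup V) (a₁ : ℝ) (g₂ : JGroup V) : ℝ :=
  ε * (-Real.sinh (2 * (a₁ - g₂.1)) * g.2.2 - Real.sinh (2 * (g.1 - a₁)) * g₂.2.2
    + Real.cosh (a₁ - g.1) * Real.cosh (a₁ - g₂.1) * ω₀ g₂.2.1 g.2.1)

variable {ω₀} in
theorem starPhase_eq (hω : ω₀.IsAlt) (ε : ℝ) (g : JGroup V) (a₁ : ℝ) (y : V × ℝ)
    (g₂ : JGroup V) : starPhase ω₀ ε g (a₁, y) g₂ =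
      starRest ω₀ ε g a₁ g₂ + ε * prodForm ω₀ y (starDual g a₁ g₂) := by
  have h : ω₀ g.2.1 y.1 = -ω₀ y.1 g.2.1 := (LinearMap.IsAlt.neg hω y.1 g.2.1).symm
  rw [starPhase, starRest, prodForm_apply, starDual]
  simp only [map_smul, map_sub, smul_eq_mul, h]
  ring

variable [FiniteDimensional ℝ V] [MeasurableSpace V] [BorelSpace V]

/-- The integral of the regularized integrand of the star-product over `(x₁, ℓ₁)`, as a function of
`(a₁, g₂)`. The number `k` is `πθε`. -/
noncomputable def starReduced (θ ε : ℝ) (n : ℕ) (F : 𝓢(ℝ, ℂ)) (h : 𝓢(V × ℝ, ℂ)) (g : JGroup V)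
    (χ : 𝓢(JGroup V × JGroup V, ℂ)) (k δ : ℝ) (m : ℝ × JGroup V) : ℂ :=
  (starAmp n g (m.1, 0) m.2 : ℂ) *
    Complex.exp (-(2 * Complex.I / (θ : ℂ)) * (starRest ω₀ ε g m.1 m.2 : ℂ)) *
    F (Real.sinh (2 * m.1)) * h m.2.2 * (((δ ^ (2 * n + 1))⁻¹ : ℝ) *
      partialSympl ω₀ χ (δ * Real.sinh (2 * m.1), δ • rCoord m.2) ((k * δ)⁻¹ • starDual g m.1 m.2))

variable {ω₀}

/-- The phase is affine in `(x₁, ℓ₁)`, and the first factor depends on `a₁` only, so that the integral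
is a symplectic Fourier transform of the cut-off function. -/
theorem integral_starIntegrand_inner (hω : ω₀.Nondegenerate) (ha : ω₀.IsAlt) {n : ℕ}
    (hn : Module.finrank ℝ V = 2 * n) {θ ε : ℝ} (hθ : 0 < θ) (hε : ε = 1 ∨ ε = -1)
    (F : 𝓢(ℝ, ℂ)) (h : 𝓢(V × ℝ, ℂ)) (g : JGroup V) (χ : 𝓢(JGroup V × JGroup V, ℂ)) {δ : ℝ}
    (hδ : 0 < δ) (a₁ : ℝ) (g₂ : JGroup V) :
    ∫ y, starIntegrand ω₀ θ ε n (fun g₁ => F (Real.sinh (2 * g₁.1))) (fun g₂ => h g₂.2) g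
      ((a₁, y), g₂) * χ (δ • (rCoord (a₁, y), rCoord g₂)) ∂((liouville ω₀).prod volume) =
    starReduced ω₀ θ ε n F h g χ (Real.pi * θ * ε) δ (a₁, g₂) := by
  have := isAddHaarMeasure_liouville_prod hω
  set D := starDual g a₁ g₂ with hD
  set η := (Real.pi * θ * ε * δ)⁻¹ • D with hη
  set f : V × ℝ → ℂ := fun y => Complex.exp (↑(-2 * Real.pi * prodForm ω₀ y η) * Complex.I) *
    χ ((δ * Real.sinh (2 * a₁), y), δ • rCoord g₂) with hf
  have hs := Measure.integral_comp_smul ((liouville ω₀).prod (volume : Measure ℝ)) f δ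
  have hdim : Module.finrank ℝ (V × ℝ) = 2 * n + 1 := by
    rw [Module.finrank_prod, hn, Module.finrank_self]
  rw [hdim, abs_of_pos (by positivity), Complex.real_smul] at hs
  have hX : partialSympl ω₀ χ (δ * Real.sinh (2 * a₁), δ • rCoord g₂) η =
      ∫ y, f y ∂((liouville ω₀).prod volume) := rfl
  rw [starReduced, hX, ← hs, ← integral_const_mul]
  congr 1
  funext y
  have hphase : Complex.exp (-(2 * Complex.I / (θ : ℂ)) * (starPhase ω₀ ε g (a₁, y) g₂ : ℂ)) =
      Complex.exp (-(2 * Complex.I / (θ : ℂ)) * (starRest ω₀ ε g a₁ g₂ : ℂ)) *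
      Complex.exp (↑(-2 * Real.pi * prodForm ω₀ (δ • y) η) * Complex.I) := by
    rw [← Complex.exp_add, starPhase_eq ha, hη, map_smul, map_smul, LinearMap.smul_apply]
    congr 1
    -- `ε` is its own inverse
    have hε2 : (ε : ℂ) ^ 2 = 1 := by rcases hε with rfl | rfl <;> simp
    have hε0 : (ε : ℂ) ≠ 0 := by rintro h0; rw [h0] at hε2; norm_num at hε2
    have hθ0 : (θ : ℂ) ≠ 0 := Complex.ofReal_ne_zero.2 hθ.ne'
    have hδ0 : (δ : ℂ) ≠ 0 := Complex.ofReal_ne_zero.2 hδ.ne'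
    have hπ0 : (Real.pi : ℂ) ≠ 0 := Complex.ofReal_ne_zero.2 Real.pi_ne_zero
    simp only [smul_eq_mul]
    push_cast
    field_simp
    linear_combination (-(prodForm ω₀ y D : ℂ)) * hε2
  have hχ : χ (δ • (rCoord (a₁, y), rCoord g₂)) =
      χ ((δ * Real.sinh (2 * a₁), δ • y), δ • rCoord g₂) := rfl
  rw [starIntegrand, hχ, hphase, hf]
  have hamp : starAmp n g (a₁, y) g₂ = starAmp n g (a₁, 0) g₂ := rfl
  simp only [hamp]
  ring

/-- The exchange of factors `((a, g), y) ↦ ((a, y), g)`. -/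
noncomputable def exchangeEquiv (V : Type*) [NormedAddCommGroup V] [NormedSpace ℝ V]
    [MeasurableSpace V] : (ℝ × JGroup V) × (V × ℝ) ≃ᵐ JGroup V × JGroup V :=
  (MeasurableEquiv.prodAssoc.trans ((MeasurableEquiv.refl ℝ).prodCongr
    MeasurableEquiv.prodComm)).trans MeasurableEquiv.prodAssoc.symm

theorem measurePreserving_exchangeEquiv (hω : ω₀.Nondegenerate) :
    MeasurePreserving (exchangeEquiv V)
      (((volume : Measure ℝ).prod (haarS ω₀)).prod ((liouville ω₀).prod volume))
      ((haarS ω₀).prod (haarS ω₀)) := by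
  have := isAddHaarMeasure_liouville hω
  have : SFinite (haarS ω₀) := by unfold haarS; infer_instance
  have h1 := measurePreserving_prodAssoc (volume : Measure ℝ) (haarS ω₀)
    ((liouville ω₀).prod (volume : Measure ℝ))
  have h2 := (MeasurePreserving.id (volume : Measure ℝ)).prod
    (Measure.measurePreserving_swap (μ := haarS ω₀) (ν := (liouville ω₀).prod (volume : Measure ℝ)))
  have h3 := (measurePreserving_prodAssoc (volume : Measure ℝ)
    ((liouville ω₀).prod (volume : Measure ℝ)) (haarS ω₀)).symm
  exact h3.comp (h2.comp h1)

theorem integral_starIntegrand_eq (hω : ω₀.Nondegenerate) (ha : ω₀.IsAlt) {n : ℕ}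
    (hn : Module.finrank ℝ V = 2 * n) {θ ε : ℝ} (hθ : 0 < θ) (hε : ε = 1 ∨ ε = -1)
    (F : 𝓢(ℝ, ℂ)) (h : 𝓢(V × ℝ, ℂ)) (g : JGroup V) (χ : 𝓢(JGroup V × JGroup V, ℂ)) {δ : ℝ}
    (hδ : 0 < δ) :
    Integrable (starReduced ω₀ θ ε n F h g χ (Real.pi * θ * ε) δ)
      ((volume : Measure ℝ).prod (haarS ω₀)) ∧
    ∫ p, starIntegrand ω₀ θ ε n (fun g₁ => F (Real.sinh (2 * g₁.1))) (fun g₂ => h g₂.2) g p *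
      χ (δ • (rCoord p.1, rCoord p.2)) ∂((haarS ω₀).prod (haarS ω₀)) =
    ∫ m, starReduced ω₀ θ ε n F h g χ (Real.pi * θ * ε) δ m
      ∂((volume : Measure ℝ).prod (haarS ω₀)) := by
  have := isAddHaarMeasure_liouville hω
  have : SFinite (haarS ω₀) := by unfold haarS; infer_instance
  have hp := measurePreserving_exchangeEquiv hω
  have hi := integrable_starIntegrand_mul hω θ ε n F h g χ hδ
  have hi' := (hp.integrable_comp_emb (exchangeEquiv V).measurableEmbedding).2 hi
  have e : ∀ m, ∫ y, ((fun p => starIntegrand ω₀ θ ε n (fun g₁ => F (Real.sinh (2 * g₁.1)))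
      (fun g₂ => h g₂.2) g p * χ (δ • (rCoord p.1, rCoord p.2))) ∘ exchangeEquiv V) (m, y)
        ∂((liouville ω₀).prod volume) = starReduced ω₀ θ ε n F h g χ (Real.pi * θ * ε) δ m :=
    fun m => integral_starIntegrand_inner hω ha hn hθ hε F h g χ hδ m.1 m.2
  refine ⟨hi'.integral_prod_left.congr (Eventually.of_forall e), ?_⟩
  rw [← hp.integral_comp' (g := fun p => starIntegrand ω₀ θ ε n
    (fun g₁ => F (Real.sinh (2 * g₁.1))) (fun g₂ => h g₂.2) g p *
      χ (δ • (rCoord p.1, rCoord p.2)))]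
  exact (integral_prod _ hi').trans (integral_congr_ae (Eventually.of_forall e))

end InnerIntegral

/-! ### Rescaled coordinates for the second factor -/

/-- The substitution `s = K sinh(2(t - a))` in an integral over `ℝ`. -/
theorem integral_eq_integral_sinh_two_mul {K : ℝ} (hK : K ≠ 0) (a : ℝ) (H : ℝ → ℂ) :
    ∫ s, H s = ∫ t, |2 * K * Real.cosh (2 * (t - a))| • H (K * Real.sinh (2 * (t - a))) := by
  have hd : ∀ t ∈ (Set.univ : Set ℝ), HasDerivWithinAt (fun t => K * Real.sinh (2 * (t - a)))
      (2 * K * Real.cosh (2 * (t - a))) Set.univ t := by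
    intro t _
    have h := ((((hasDerivAt_id t).sub_const a).const_mul 2).sinh).const_mul K
    exact (h.congr_deriv (by simp; ring)).hasDerivWithinAt
  have hi : Set.InjOn (fun t => K * Real.sinh (2 * (t - a))) Set.univ := by
    intro t _ t' _ h
    have h1 := Real.sinh_injective (mul_left_cancel₀ hK h)
    linarith
  have him : (fun t => K * Real.sinh (2 * (t - a))) '' Set.univ = Set.univ := by
    refine Set.eq_univ_of_forall fun s => ⟨a + Real.arsinh (s / K) / 2, Set.mem_univ _, ?_⟩
    have e : 2 * (a + Real.arsinh (s / K) / 2 - a) = Real.arsinh (s / K) := by ring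
    simp only [e, Real.sinh_arsinh]
    field_simp
  have h := integral_image_eq_integral_abs_deriv_smul MeasurableSet.univ hd hi H
  rw [him] at h
  simpa using h

/-- The number `b` with `sinh(2b) = -c`. -/
noncomputable def halfArsinhNeg (c : ℝ) : ℝ := Real.arsinh (-c) / 2

theorem sinh_two_mul_halfArsinhNeg (c : ℝ) : Real.sinh (2 * halfArsinhNeg c) = -c := by
  rw [halfArsinhNeg, mul_div_cancel₀ _ two_ne_zero, Real.sinh_arsinh]

theorem halfArsinhNeg_zero : halfArsinhNeg 0 = 0 := by simp [halfArsinhNeg]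

theorem continuous_halfArsinhNeg : Continuous halfArsinhNeg :=
  (Real.continuous_arsinh.comp continuous_neg).div_const 2

/-- The substitution `sinh(2(t - a)) = -c s`, solved for `t`. -/
theorem integral_eq_integral_halfArsinhNeg {c : ℝ} (hc : c ≠ 0) (a : ℝ) (H : ℝ → ℂ) :
    ∫ t, H t = ∫ s, (|c| / (2 * Real.cosh (2 * halfArsinhNeg (c * s)))) •
      H (a + halfArsinhNeg (c * s)) := by
  rw [integral_eq_integral_sinh_two_mul (neg_ne_zero.2 (inv_ne_zero hc)) a
    fun s => (|c| / (2 * Real.cosh (2 * halfArsinhNeg (c * s)))) • H (a + halfArsinhNeg (c * s))]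
  congr 1
  funext t
  have e : halfArsinhNeg (c * (-c⁻¹ * Real.sinh (2 * (t - a)))) = t - a := by
    have : -(c * (-c⁻¹ * Real.sinh (2 * (t - a)))) = Real.sinh (2 * (t - a)) := by field_simp
    rw [halfArsinhNeg, this, Real.arsinh_sinh]
    ring
  have hc' : |c| ≠ 0 := abs_ne_zero.2 hc
  have hh := (Real.cosh_pos (2 * (t - a))).ne'
  rw [e, smul_smul, abs_mul, abs_mul, abs_neg, abs_inv, abs_of_pos (Real.cosh_pos _),
    add_sub_cancel, abs_two]
  have : 2 * |c|⁻¹ * Real.cosh (2 * (t - a)) * (|c| / (2 * Real.cosh (2 * (t - a)))) = 1 := by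
    field_simp
  rw [this, one_smul]

section Rescale

variable {V : Type*} [NormedAddCommGroup V] [NormedSpace ℝ V] [FiniteDimensional ℝ V]
  [MeasurableSpace V] [BorelSpace V]

/-- The substitution `x = cz + v` in the first variable of an integral over a product. -/
theorem integral_prod_comp_smul_add (μ : Measure V) [μ.IsAddHaarMeasure] {c : ℝ} (hc : c ≠ 0)
    (v : V) (H : V × ℝ → ℂ) : ∫ y, H y ∂(μ.prod volume) =
      |c ^ Module.finrank ℝ V| • ∫ y : V × ℝ, H (c • y.1 + v, y.2) ∂(μ.prod volume) := by
  set d := |(c ^ Module.finrank ℝ V)| with hd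
  have hd0 : 0 < d := abs_pos.2 (pow_ne_zero _ hc)
  have h1 : Measure.map (fun x : V => c • x + v) μ = ENNReal.ofReal d⁻¹ • μ := by
    have : (fun x : V => c • x + v) = (fun x => x + v) ∘ (fun x => c • x) := rfl
    rw [this, ← Measure.map_map (measurable_add_const v) (measurable_const_smul c),
      Measure.map_addHaar_smul μ hc, Measure.map_smul, map_add_right_eq_self, abs_inv]
  have h2 : Measure.map (Prod.map (fun x : V => c • x + v) (id : ℝ → ℝ)) (μ.prod volume) =
      ENNReal.ofReal d⁻¹ • (μ.prod volume) := by
    have : SFinite (Measure.map (fun x : V => c • x + v) μ) := by infer_instance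
    rw [← Measure.map_prod_map μ (volume : Measure ℝ)
      ((measurable_const_smul c).add_const v) measurable_id, h1, Measure.map_id,
      Measure.prod_smul_left]
  have hemb : MeasurableEmbedding (Prod.map (fun x : V => c • x + v) (id : ℝ → ℝ)) :=
    (((Homeomorph.smulOfNeZero c hc).trans (Homeomorph.addRight v)).prodCongr
      (Homeomorph.refl ℝ)).measurableEmbedding
  have h3 := hemb.integral_map (μ := μ.prod volume) H
  rw [h2, integral_smul_measure, ENNReal.toReal_ofReal (inv_nonneg.2 hd0.le)] at h3
  have h4 : ∫ y : V × ℝ, H (c • y.1 + v, y.2) ∂(μ.prod volume) =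
      ∫ y, H (Prod.map (fun x : V => c • x + v) (id : ℝ → ℝ) y) ∂(μ.prod volume) := rfl
  rw [h4, ← h3, smul_smul, mul_inv_cancel₀ hd0.ne', one_smul]

/-- The point `g₂` for which the vector dual to `(x₁, ℓ₁)` in the phase equals `c (z, s)`, where
`c = πθεδ` and `q = (s, z, ℓ₂)`. -/
noncomputable def rescaledPoint (g : JGroup V) (a₁ c : ℝ) (q : JGroup V) : JGroup V :=
  (g.1 + halfArsinhNeg (c * q.1),
    (c / (Real.cosh (halfArsinhNeg (c * q.1)) * Real.cosh (a₁ - g.1))) • q.2.1 +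
      (Real.cosh (a₁ - (g.1 + halfArsinhNeg (c * q.1))) / Real.cosh (a₁ - g.1)) • g.2.1,
    q.2.2)

omit [FiniteDimensional ℝ V] [MeasurableSpace V] [BorelSpace V] in
theorem starDual_rescaledPoint (g : JGroup V) (a₁ : ℝ) {c : ℝ} (hc : c ≠ 0) (q : JGroup V) :
    c⁻¹ • starDual g a₁ (rescaledPoint g a₁ c q) = (q.2.1, q.1) := by
  have h1 := (Real.cosh_pos (halfArsinhNeg (c * q.1))).ne'
  have h2 := (Real.cosh_pos (a₁ - g.1)).ne'
  rw [starDual, rescaledPoint]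
  simp only [add_sub_cancel_left, sinh_two_mul_halfArsinhNeg, Prod.smul_mk, smul_eq_mul]
  refine Prod.ext ?_ ?_
  · simp only [smul_add, smul_smul, smul_sub]
    set β := halfArsinhNeg (c * q.1)
    have e1 : c⁻¹ * (Real.cosh β * (Real.cosh (a₁ - g.1) *
        (c / (Real.cosh β * Real.cosh (a₁ - g.1))))) = 1 := by field_simp
    have e2 : c⁻¹ * (Real.cosh β * (Real.cosh (a₁ - g.1) *
        (Real.cosh (a₁ - (g.1 + β)) / Real.cosh (a₁ - g.1)))) =
        c⁻¹ * (Real.cosh β * Real.cosh (a₁ - (g.1 + β))) := by field_simp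
    rw [e1, e2, one_smul, add_sub_cancel_right]
  · field_simp

/-- The integrand of `starReduced` in the coordinates `(s, z, ℓ₂)` of `rescaledPoint`, including the
Jacobian. It is defined for `δ = 0` too. -/
noncomputable def starRescaled (ω₀ : LinearMap.BilinForm ℝ V) (θ ε : ℝ) (n : ℕ) (F : 𝓢(ℝ, ℂ))
    (h : 𝓢(V × ℝ, ℂ)) (g : JGroup V) (χ : 𝓢(JGroup V × JGroup V, ℂ)) (k δ : ℝ)
    (m : ℝ × JGroup V) : ℂ :=
  ((|k| ^ (2 * n + 1) * starAmp n g (m.1, 0) (rescaledPoint g m.1 (k * δ) m.2) /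
    (2 * Real.cosh (2 * halfArsinhNeg (k * δ * m.2.1)) *
      (Real.cosh (halfArsinhNeg (k * δ * m.2.1)) * Real.cosh (m.1 - g.1)) ^ (2 * n)) : ℝ) : ℂ) *
  Complex.exp (-(2 * Complex.I / (θ : ℂ)) *
    (starRest ω₀ ε g m.1 (rescaledPoint g m.1 (k * δ) m.2) : ℂ)) *
  F (Real.sinh (2 * m.1)) * h (rescaledPoint g m.1 (k * δ) m.2).2 *
  partialSympl ω₀ χ (δ * Real.sinh (2 * m.1), δ • rCoord (rescaledPoint g m.1 (k * δ) m.2))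
    (m.2.2.1, m.2.1)

variable {ω₀ : LinearMap.BilinForm ℝ V}

/-- For fixed `a₁`, the integral over `g₂` in the coordinates of `rescaledPoint`. The powers of `δ` from
the Jacobian cancel the factor `δ ^ -(2n + 1)` of `starReduced`. -/
theorem integral_starReduced_fiber (hω : ω₀.Nondegenerate) {n : ℕ}
    (hn : Module.finrank ℝ V = 2 * n) (θ ε : ℝ) (F : 𝓢(ℝ, ℂ)) (h : 𝓢(V × ℝ, ℂ)) (g : JGroup V)
    (χ : 𝓢(JGroup V × JGroup V, ℂ)) {k δ : ℝ} (hk : k ≠ 0) (hδ : 0 < δ) (a₁ : ℝ) :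
    ∫ a₂, ∫ y, starReduced ω₀ θ ε n F h g χ k δ (a₁, (a₂, y)) ∂((liouville ω₀).prod volume) =
    ∫ s, ∫ y, starRescaled ω₀ θ ε n F h g χ k δ (a₁, (s, y)) ∂((liouville ω₀).prod volume) := by
  have := isAddHaarMeasure_liouville hω
  have hc : k * δ ≠ 0 := mul_ne_zero hk hδ.ne'
  rw [integral_eq_integral_halfArsinhNeg hc g.1]
  congr 1
  funext s
  set β := halfArsinhNeg (k * δ * s) with hβ
  have h1 := Real.cosh_pos β
  have h2 := Real.cosh_pos (a₁ - g.1)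
  have h3 := Real.cosh_pos (2 * β)
  have hc' : k * δ / (Real.cosh β * Real.cosh (a₁ - g.1)) ≠ 0 :=
    div_ne_zero hc (mul_pos h1 h2).ne'
  rw [integral_prod_comp_smul_add (liouville ω₀) hc'
    ((Real.cosh (a₁ - (g.1 + β)) / Real.cosh (a₁ - g.1)) • g.2.1), smul_smul, ← integral_smul]
  congr 1
  funext y
  have hp : ((g.1 + β, (k * δ / (Real.cosh β * Real.cosh (a₁ - g.1))) • y.1 +
      (Real.cosh (a₁ - (g.1 + β)) / Real.cosh (a₁ - g.1)) • g.2.1, y.2) : JGroup V) =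
      rescaledPoint g a₁ (k * δ) (s, y) := rfl
  have hp' : (((k * δ / (Real.cosh β * Real.cosh (a₁ - g.1))) • y.1 +
      (Real.cosh (a₁ - (g.1 + β)) / Real.cosh (a₁ - g.1)) • g.2.1, y.2) : V × ℝ) =
      (rescaledPoint g a₁ (k * δ) (s, y)).2 := rfl
  simp only [starReduced, starRescaled, hp, starDual_rescaledPoint g a₁ hc (s, y),
    Complex.real_smul]
  rw [hp']
  have hJ : |k * δ| / (2 * Real.cosh (2 * β)) *
      |(k * δ / (Real.cosh β * Real.cosh (a₁ - g.1))) ^ Module.finrank ℝ V| *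
      (δ ^ (2 * n + 1))⁻¹ = |k| ^ (2 * n + 1) / (2 * Real.cosh (2 * β) *
        (Real.cosh β * Real.cosh (a₁ - g.1)) ^ (2 * n)) := by
    rw [hn, abs_pow, abs_div, abs_of_pos (mul_pos h1 h2), abs_mul, abs_of_pos hδ]
    have h12 := (mul_pos h1 h2).ne'
    generalize Real.cosh β * Real.cosh (a₁ - g.1) = w at h12
    rw [div_pow, mul_pow]
    field_simp
    ring
  have hJ' := congrArg (· * starAmp n g (a₁, 0) (rescaledPoint g a₁ (k * δ) (s, y))) hJ
  simp only [div_mul_eq_mul_div] at hJ'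
  rw [← hβ, ← hJ']
  push_cast
  ring

end Rescale

/-! ### The limit of the regularized star-product -/

section Limit

variable {V : Type*} [NormedAddCommGroup V] [NormedSpace ℝ V] [FiniteDimensional ℝ V]
  [MeasurableSpace V] [BorelSpace V]

omit [FiniteDimensional ℝ V] [MeasurableSpace V] [BorelSpace V] in
theorem continuous_rescaledPoint (g : JGroup V) (k : ℝ) :
    Continuous fun p : ℝ × (ℝ × JGroup V) => rescaledPoint g p.2.1 (k * p.1) p.2.2 := by
  have hb : Continuous fun p : ℝ × (ℝ × JGroup V) => halfArsinhNeg (k * p.1 * p.2.2.1) :=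
    continuous_halfArsinhNeg.comp (by fun_prop)
  have h1 : ∀ p : ℝ × (ℝ × JGroup V), Real.cosh (halfArsinhNeg (k * p.1 * p.2.2.1)) *
      Real.cosh (p.2.1 - g.1) ≠ 0 :=
    fun p => (mul_pos (Real.cosh_pos _) (Real.cosh_pos _)).ne'
  have h2 : ∀ p : ℝ × (ℝ × JGroup V), Real.cosh (p.2.1 - g.1) ≠ 0 := fun p => (Real.cosh_pos _).ne'
  unfold rescaledPoint
  fun_prop (disch := assumption)

omit [MeasurableSpace V] [BorelSpace V] in
theorem continuous_starRest (ω₀ : LinearMap.BilinForm ℝ V) (ε : ℝ) (g : JGroup V) :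
    Continuous fun p : ℝ × JGroup V => starRest ω₀ ε g p.1 p.2 := by
  have h : Continuous fun p : ℝ × JGroup V => ω₀ p.2.2.1 g.2.1 :=
    Continuous.bilin ω₀ (by fun_prop) continuous_const
  have h1 : Continuous fun p : ℝ × JGroup V => -Real.sinh (2 * (p.1 - p.2.1)) * g.2.2 -
      Real.sinh (2 * (g.1 - p.1)) * p.2.2.2 := by fun_prop
  have h2 : Continuous fun p : ℝ × JGroup V =>
      Real.cosh (p.1 - g.1) * Real.cosh (p.1 - p.2.1) := by fun_prop
  exact continuous_const.mul (h1.add (h2.mul h))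

variable {ω₀ : LinearMap.BilinForm ℝ V}

theorem continuous_starRescaled (hω : ω₀.Nondegenerate) (θ ε : ℝ) (n : ℕ) (F : 𝓢(ℝ, ℂ))
    (h : 𝓢(V × ℝ, ℂ)) (g : JGroup V) (χ : 𝓢(JGroup V × JGroup V, ℂ)) (k : ℝ) :
    Continuous fun p : ℝ × (ℝ × JGroup V) => starRescaled ω₀ θ ε n F h g χ k p.1 p.2 := by
  have hr := continuous_rescaledPoint g k
  have hb : Continuous fun p : ℝ × (ℝ × JGroup V) => halfArsinhNeg (k * p.1 * p.2.2.1) :=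
    continuous_halfArsinhNeg.comp (by fun_prop)
  have hA : Continuous fun p : ℝ × (ℝ × JGroup V) =>
      starAmp n g (p.2.1, 0) (rescaledPoint g p.2.1 (k * p.1) p.2.2) := by
    have hp : Continuous fun p : ℝ × (ℝ × JGroup V) =>
        (g, ((p.2.1, 0) : JGroup V), rescaledPoint g p.2.1 (k * p.1) p.2.2) := by fun_prop
    have h0 := (continuous_starAmp n).comp hp
    simp only [Function.comp_def] at h0
    exact h0
  have hR : Continuous fun p : ℝ × (ℝ × JGroup V) =>
      starRest ω₀ ε g p.2.1 (rescaledPoint g p.2.1 (k * p.1) p.2.2) := by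
    have hp : Continuous fun p : ℝ × (ℝ × JGroup V) =>
        (p.2.1, rescaledPoint g p.2.1 (k * p.1) p.2.2) := by fun_prop
    have h0 := (continuous_starRest ω₀ ε g).comp hp
    simp only [Function.comp_def] at h0
    exact h0
  have hP : Continuous fun p : ℝ × (ℝ × JGroup V) =>
      partialSympl ω₀ χ (p.1 * Real.sinh (2 * p.2.1),
        p.1 • rCoord (rescaledPoint g p.2.1 (k * p.1) p.2.2)) (p.2.2.2.1, p.2.2.1) := by
    have hq := contDiff_rCoord.continuous.comp hr
    simp only [Function.comp_def] at hq
    have hp : Continuous fun p : ℝ × (ℝ × JGroup V) =>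
        (((p.1 * Real.sinh (2 * p.2.1), p.1 • rCoord (rescaledPoint g p.2.1 (k * p.1) p.2.2)) :
          ℝ × JGroup V), ((p.2.2.2.1, p.2.2.1) : V × ℝ)) := by fun_prop
    have h0 := (continuous_partialSympl hω χ).comp hp
    simp only [Function.comp_def] at h0
    exact h0
  have hF : Continuous fun p : ℝ × (ℝ × JGroup V) => F (Real.sinh (2 * p.2.1)) :=
    F.continuous.comp (by fun_prop)
  have hh : Continuous fun p : ℝ × (ℝ × JGroup V) => h (rescaledPoint g p.2.1 (k * p.1) p.2.2).2 :=
    h.continuous.comp (continuous_snd.comp hr)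
  have hd : ∀ p : ℝ × (ℝ × JGroup V), 2 * Real.cosh (2 * halfArsinhNeg (k * p.1 * p.2.2.1)) *
      (Real.cosh (halfArsinhNeg (k * p.1 * p.2.2.1)) * Real.cosh (p.2.1 - g.1)) ^ (2 * n) ≠ 0 :=
    fun p => by
      have h1 := Real.cosh_pos (2 * halfArsinhNeg (k * p.1 * p.2.2.1))
      have h2 := Real.cosh_pos (halfArsinhNeg (k * p.1 * p.2.2.1))
      have h3 := Real.cosh_pos (p.2.1 - g.1)
      positivity
  have e1 : Continuous fun p : ℝ × (ℝ × JGroup V) =>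
      ((|k| ^ (2 * n + 1) * starAmp n g (p.2.1, 0) (rescaledPoint g p.2.1 (k * p.1) p.2.2) /
      (2 * Real.cosh (2 * halfArsinhNeg (k * p.1 * p.2.2.1)) *
      (Real.cosh (halfArsinhNeg (k * p.1 * p.2.2.1)) * Real.cosh (p.2.1 - g.1)) ^ (2 * n)) : ℝ) : ℂ) :=
    Complex.continuous_ofReal.comp (Continuous.div (continuous_const.mul hA) (by fun_prop) hd)
  have e2 : Continuous fun p : ℝ × (ℝ × JGroup V) => Complex.exp (-(2 * Complex.I / (θ : ℂ)) *
      (starRest ω₀ ε g p.2.1 (rescaledPoint g p.2.1 (k * p.1) p.2.2) : ℂ)) :=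
    (continuous_const.mul (Complex.continuous_ofReal.comp hR)).cexp
  exact (((e1.mul e2).mul hF).mul hh).mul hP

omit [FiniteDimensional ℝ V] [MeasurableSpace V] [BorelSpace V] in
/-- After division by the Jacobian the amplitude is bounded independently of the integration variable
`s`, because `cosh(u - v) ≤ 2 cosh u cosh v`. -/
theorem starAmp_rescaledPoint_le (n : ℕ) (g : JGroup V) (a₁ c : ℝ) (q : JGroup V) :
    starAmp n g (a₁, 0) (rescaledPoint g a₁ c q) / (2 * Real.cosh (2 * halfArsinhNeg (c * q.1)) *
      (Real.cosh (halfArsinhNeg (c * q.1)) * Real.cosh (a₁ - g.1)) ^ (2 * n)) ≤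
    4 * 2 ^ n * Real.cosh (2 * (a₁ - g.1)) := by
  set β := halfArsinhNeg (c * q.1) with hβ
  have p1 := Real.cosh_pos (2 * β)
  have p2 := Real.cosh_pos β
  have p3 := Real.cosh_pos (a₁ - g.1)
  have p4 := Real.cosh_pos (2 * (a₁ - g.1))
  rw [div_le_iff₀ (by positivity)]
  have e1 : a₁ - (g.1 + β) = (a₁ - g.1) - β := by ring
  have e2 : 2 * (a₁ - (g.1 + β)) = 2 * (a₁ - g.1) - 2 * β := by ring
  have e3 : 2 * (g.1 - (g.1 + β)) = -(2 * β) := by ring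
  have i1 := cosh_sub_le (a₁ - g.1) β
  have i2 := cosh_sub_le (2 * (a₁ - g.1)) (2 * β)
  simp only [starAmp, rescaledPoint, ← hβ, e2, e3, Real.cosh_neg, add_sub_cancel_left]
  rw [e1]
  have i3 : √(Real.cosh (2 * (a₁ - g.1) - 2 * β) * Real.cosh (2 * (a₁ - g.1)) *
      Real.cosh (2 * β)) ≤ 2 * (Real.cosh (2 * (a₁ - g.1)) * Real.cosh (2 * β)) := by
    refine Real.sqrt_le_iff.2 ⟨by positivity, ?_⟩
    calc _ ≤ 2 * (Real.cosh (2 * (a₁ - g.1)) * Real.cosh (2 * β)) * Real.cosh (2 * (a₁ - g.1)) *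
          Real.cosh (2 * β) := by gcongr
      _ ≤ _ := by nlinarith [sq_nonneg (Real.cosh (2 * (a₁ - g.1)) * Real.cosh (2 * β))]
  have p5 := (Real.cosh_pos ((a₁ - g.1) - β)).le
  calc _ ≤ 4 * (2 * (Real.cosh (2 * (a₁ - g.1)) * Real.cosh (2 * β))) * Real.cosh β ^ n *
        Real.cosh (a₁ - g.1) ^ n * (2 * (Real.cosh (a₁ - g.1) * Real.cosh β)) ^ n := by
        gcongr
    _ = _ := by rw [mul_pow, mul_pow, pow_mul, mul_pow]; ring

omit [FiniteDimensional ℝ V] [MeasurableSpace V] [BorelSpace V] in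
theorem SchwartzMap.exists_norm_le_inv_one_add_sq_snd (h : 𝓢(V × ℝ, ℂ)) :
    ∃ C : ℝ, 0 ≤ C ∧ ∀ y, ‖h y‖ ≤ C * (1 + y.2 ^ 2)⁻¹ := by
  obtain ⟨C, hC, H⟩ := h.exists_one_add_pow_mul_le 2
  refine ⟨C, hC, fun y => ?_⟩
  rw [← div_eq_mul_inv, le_div_iff₀ (by positivity), mul_comm]
  refine le_trans (mul_le_mul_of_nonneg_right ?_ (norm_nonneg _)) (H y)
  have h1 : |y.2| ≤ ‖y‖ := norm_snd_le y
  nlinarith [abs_nonneg y.2, sq_abs y.2]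

theorem exists_norm_starRescaled_le (hω : ω₀.Nondegenerate) (θ ε : ℝ) (n : ℕ) (F : 𝓢(ℝ, ℂ))
    (h : 𝓢(V × ℝ, ℂ)) (g : JGroup V) (χ : 𝓢(JGroup V × JGroup V, ℂ)) (k : ℝ) :
    ∃ C : ℝ, ∀ δ m, ‖starRescaled ω₀ θ ε n F h g χ k δ m‖ ≤
      C * ((1 + m.1 ^ 2)⁻¹ * (decayWeight (V × ℝ) (m.2.2.1, m.2.1) * (1 + m.2.2.2 ^ 2)⁻¹)) := by
  obtain ⟨C₁, hC₁, h₁⟩ := exists_norm_schwartz_sinh_le F 1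
  obtain ⟨C₂, hC₂, h₂⟩ := h.exists_norm_le_inv_one_add_sq_snd
  obtain ⟨C₃, hC₃, h₃⟩ := exists_norm_partialSympl_le hω χ
  set A := |k| ^ (2 * n + 1) * (4 * 2 ^ n * (2 * Real.cosh (2 * g.1))) with hA
  have hA0 : 0 ≤ A := by positivity
  refine ⟨A * (C₁ * C₂ * C₃), fun δ m => ?_⟩
  have i1 := starAmp_rescaledPoint_le n g m.1 (k * δ) m.2
  have i2 := h₁ m.1
  have i3 := h₂ (rescaledPoint g m.1 (k * δ) m.2).2
  have i4 := h₃ (δ * Real.sinh (2 * m.1), δ • rCoord (rescaledPoint g m.1 (k * δ) m.2))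
    (m.2.2.1, m.2.1)
  have i5 : Real.cosh (2 * (m.1 - g.1)) ≤ 2 * (Real.cosh (2 * m.1) * Real.cosh (2 * g.1)) := by
    rw [mul_sub]; exact cosh_sub_le _ _
  have q1 := starAmp_nonneg n g (m.1, 0) (rescaledPoint g m.1 (k * δ) m.2)
  have q2 := (Real.cosh_pos (2 * m.1)).le
  have q3 := decayWeight_pos ((m.2.2.1, m.2.1) : V × ℝ)
  have i6 : |k| ^ (2 * n + 1) * starAmp n g (m.1, 0) (rescaledPoint g m.1 (k * δ) m.2) /
      (2 * Real.cosh (2 * halfArsinhNeg (k * δ * m.2.1)) *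
      (Real.cosh (halfArsinhNeg (k * δ * m.2.1)) * Real.cosh (m.1 - g.1)) ^ (2 * n)) ≤
      A * Real.cosh (2 * m.1) := by
    rw [mul_div_assoc]
    calc _ ≤ |k| ^ (2 * n + 1) * (4 * 2 ^ n * (2 * (Real.cosh (2 * m.1) * Real.cosh (2 * g.1)))) := by
          refine mul_le_mul_of_nonneg_left (i1.trans ?_) (by positivity)
          gcongr
      _ = _ := by rw [hA]; ring
  have i7 : ‖Complex.exp (-(2 * Complex.I / (θ : ℂ)) *
      (starRest ω₀ ε g m.1 (rescaledPoint g m.1 (k * δ) m.2) : ℂ))‖ = 1 := by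
    rw [Complex.norm_exp, Real.exp_eq_one_iff]
    simp [Complex.div_re, Complex.div_im]
  rw [starRescaled, norm_mul, norm_mul, norm_mul, norm_mul, i7, mul_one, Complex.norm_real,
    Real.norm_eq_abs, abs_of_nonneg (by
      have h1 := (Real.cosh_pos (2 * halfArsinhNeg (k * δ * m.2.1))).le
      have h2 := (Real.cosh_pos (halfArsinhNeg (k * δ * m.2.1))).le
      have h3 := (Real.cosh_pos (m.1 - g.1)).le
      positivity)]
  calc _ ≤ (A * Real.cosh (2 * m.1)) * ‖F (Real.sinh (2 * m.1))‖ *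
        (C₂ * (1 + m.2.2.2 ^ 2)⁻¹) * (C₃ * decayWeight (V × ℝ) (m.2.2.1, m.2.1)) := by
        gcongr
        exact i3
    _ = A * (Real.cosh (2 * m.1) ^ 1 * ‖F (Real.sinh (2 * m.1))‖) *
        (C₂ * (1 + m.2.2.2 ^ 2)⁻¹) * (C₃ * decayWeight (V × ℝ) (m.2.2.1, m.2.1)) := by ring
    _ ≤ A * (C₁ * (1 + m.1 ^ 2)⁻¹) *
        (C₂ * (1 + m.2.2.2 ^ 2)⁻¹) * (C₃ * decayWeight (V × ℝ) (m.2.2.1, m.2.1)) := by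
        gcongr
    _ = _ := by ring

theorem integrable_starRescaled_bound (hω : ω₀.Nondegenerate) :
    Integrable (fun m : ℝ × JGroup V => (1 + m.1 ^ 2)⁻¹ *
      (decayWeight (V × ℝ) (m.2.2.1, m.2.1) * (1 + m.2.2.2 ^ 2)⁻¹))
      ((volume : Measure ℝ).prod (haarS ω₀)) := by
  have := isAddHaarMeasure_liouville hω
  have hw := isAddHaarMeasure_liouville_prod hω
  have h0 := (integrable_decayWeight ((liouville ω₀).prod (volume : Measure ℝ))).mul_prod
    integrable_inv_one_add_sq
  have hp : MeasurePreserving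
      ((MeasurableEquiv.prodAssoc (α := ℝ) (β := V) (γ := ℝ)).symm.trans
        (MeasurableEquiv.prodComm.prodCongr (MeasurableEquiv.refl ℝ))) (haarS ω₀)
      (((liouville ω₀).prod (volume : Measure ℝ)).prod volume) :=
    (Measure.measurePreserving_swap.prod (MeasurePreserving.id _)).comp
      (measurePreserving_prodAssoc (volume : Measure ℝ) (liouville ω₀) (volume : Measure ℝ)).symm
  have h1 := (hp.integrable_comp_emb (MeasurableEquiv.measurableEmbedding _)).2 h0
  have : SFinite (haarS ω₀) := by unfold haarS; infer_instance
  exact integrable_inv_one_add_sq.mul_prod h1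

end Limit

section StarValue

variable {V : Type*} [NormedAddCommGroup V] [NormedSpace ℝ V] [FiniteDimensional ℝ V]
  [MeasurableSpace V] [BorelSpace V] {ω₀ : LinearMap.BilinForm ℝ V}

theorem integral_prod_haarS (hω : ω₀.Nondegenerate) {G : ℝ × JGroup V → ℂ}
    (hG : Integrable G ((volume : Measure ℝ).prod (haarS ω₀))) :
    ∫ m, G m ∂((volume : Measure ℝ).prod (haarS ω₀)) =
      ∫ a₁, ∫ a₂, ∫ y, G (a₁, (a₂, y)) ∂((liouville ω₀).prod volume) := by
  have := isAddHaarMeasure_liouville hω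
  have : SFinite (haarS ω₀) := by unfold haarS; infer_instance
  rw [integral_prod _ hG]
  refine integral_congr_ae ?_
  filter_upwards [hG.prod_right_ae] with a₁ h₁
  exact integral_prod _ h₁

theorem integrable_starRescaled (hω : ω₀.Nondegenerate) (θ ε : ℝ) (n : ℕ) (F : 𝓢(ℝ, ℂ))
    (h : 𝓢(V × ℝ, ℂ)) (g : JGroup V) (χ : 𝓢(JGroup V × JGroup V, ℂ)) (k δ : ℝ) :
    Integrable (starRescaled ω₀ θ ε n F h g χ k δ) ((volume : Measure ℝ).prod (haarS ω₀)) := by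
  obtain ⟨C, hC⟩ := exists_norm_starRescaled_le hω θ ε n F h g χ k
  exact ((integrable_starRescaled_bound hω).const_mul C).mono'
    ((continuous_starRescaled hω θ ε n F h g χ k).comp
      (Continuous.prodMk_right δ)).aestronglyMeasurable (Eventually.of_forall (hC δ))

/-- Dominated convergence in the rescaled coordinates. -/
theorem tendsto_integral_starReduced (hω : ω₀.Nondegenerate) (ha : ω₀.IsAlt) {n : ℕ}
    (hn : Module.finrank ℝ V = 2 * n) {θ ε : ℝ} (hθ : 0 < θ) (hε : ε = 1 ∨ ε = -1)
    (F : 𝓢(ℝ, ℂ)) (h : 𝓢(V × ℝ, ℂ)) (g : JGroup V) (χ : 𝓢(JGroup V × JGroup V, ℂ)) :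
    Tendsto (fun δ : ℝ => ∫ p, starIntegrand ω₀ θ ε n (fun g₁ => F (Real.sinh (2 * g₁.1)))
      (fun g₂ => h g₂.2) g p * χ (δ • (rCoord p.1, rCoord p.2)) ∂((haarS ω₀).prod (haarS ω₀)))
      (𝓝[>] 0) (𝓝 (∫ m, starRescaled ω₀ θ ε n F h g χ (Real.pi * θ * ε) 0 m
        ∂((volume : Measure ℝ).prod (haarS ω₀)))) := by
  set k := Real.pi * θ * ε with hk
  have hk0 : k ≠ 0 := by
    have : ε ≠ 0 := by rcases hε with rfl | rfl <;> norm_num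
    have := Real.pi_pos
    positivity
  obtain ⟨C, hC⟩ := exists_norm_starRescaled_le hω θ ε n F h g χ k
  have hcont := continuous_starRescaled hω θ ε n F h g χ k
  have hlim : Tendsto (fun δ : ℝ => ∫ m, starRescaled ω₀ θ ε n F h g χ k δ m
      ∂((volume : Measure ℝ).prod (haarS ω₀))) (𝓝[>] 0)
      (𝓝 (∫ m, starRescaled ω₀ θ ε n F h g χ k 0 m ∂((volume : Measure ℝ).prod (haarS ω₀)))) := by
    refine tendsto_integral_filter_of_dominated_convergence _
      (Eventually.of_forall fun δ => (integrable_starRescaled hω θ ε n F h g χ k δ).1)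
      (Eventually.of_forall fun δ => Eventually.of_forall (hC δ))
      ((integrable_starRescaled_bound hω).const_mul C) (Eventually.of_forall fun m => ?_)
    have h0 : Continuous fun δ : ℝ => starRescaled ω₀ θ ε n F h g χ k δ m := by
      have h1 := hcont.comp (Continuous.prodMk_left m : Continuous fun δ : ℝ => (δ, m))
      simp only [Function.comp_def] at h1
      exact h1
    exact (h0.tendsto 0).mono_left nhdsWithin_le_nhds
  refine hlim.congr' ?_
  filter_upwards [self_mem_nhdsWithin] with δ hδ
  obtain ⟨i1, i2⟩ := integral_starIntegrand_eq hω ha hn hθ hε F h g χ hδ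
  rw [i2, integral_prod_haarS hω i1, integral_prod_haarS hω (integrable_starRescaled hω θ ε n F h g χ k δ)]
  refine integral_congr_ae (Eventually.of_forall fun a₁ => ?_)
  exact (integral_starReduced_fiber hω hn θ ε F h g χ hk0 hδ a₁).symm

/-- At `δ = 0` the point `g₂` is `(a, x, ℓ₂)`, and `ω₀ x x = 0`. -/
theorem starRescaled_zero (ha : ω₀.IsAlt) (θ ε : ℝ) (n : ℕ) (F : 𝓢(ℝ, ℂ))
    (h : 𝓢(V × ℝ, ℂ)) (g : JGroup V) (χ : 𝓢(JGroup V × JGroup V, ℂ)) (k a₁ s l : ℝ) (z : V) :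
    starRescaled ω₀ θ ε n F h g χ k 0 (a₁, (s, (z, l))) =
      ((|k| ^ (2 * n + 1) : ℝ) * ((2 * Real.cosh (2 * (a₁ - g.1)) : ℝ) * F (Real.sinh (2 * a₁)))) *
        (partialSympl ω₀ χ 0 (z, s) * (Complex.exp (-(2 * Complex.I / (θ : ℂ)) *
          (ε * (Real.sinh (2 * (a₁ - g.1)) * (l - g.2.2)) : ℝ)) * h (g.2.1, l))) := by
  have p1 := Real.cosh_pos (a₁ - g.1)
  have p2 := Real.cosh_pos (2 * (a₁ - g.1))
  have hr : rescaledPoint g a₁ (k * 0) (s, (z, l)) = (g.1, g.2.1, l) := by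
    simp only [rescaledPoint, mul_zero, zero_mul, zero_div, halfArsinhNeg_zero, add_zero, zero_smul,
      zero_add, div_self p1.ne', one_smul]
  have hs : starRest ω₀ ε g a₁ (g.1, g.2.1, l) = ε * (Real.sinh (2 * (a₁ - g.1)) * (l - g.2.2)) := by
    have e : 2 * (g.1 - a₁) = -(2 * (a₁ - g.1)) := by ring
    rw [starRest, ha, e, Real.sinh_neg]
    ring
  have hA : starAmp n g (a₁, 0) (g.1, g.2.1, l) =
      4 * Real.cosh (2 * (a₁ - g.1)) * Real.cosh (a₁ - g.1) ^ (2 * n) := by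
    simp only [starAmp, sub_self, mul_zero, Real.cosh_zero, mul_one, one_pow]
    rw [Real.sqrt_mul_self p2.le]
    ring
  simp only [starRescaled]
  rw [hr, hs, hA]
  simp only [mul_zero, zero_mul, halfArsinhNeg_zero, Real.cosh_zero, mul_one, one_mul, zero_smul]
  have hc : |k| ^ (2 * n + 1) * (4 * Real.cosh (2 * (a₁ - g.1)) * Real.cosh (a₁ - g.1) ^ (2 * n)) /
      (2 * Real.cosh (a₁ - g.1) ^ (2 * n)) =
      |k| ^ (2 * n + 1) * (2 * Real.cosh (2 * (a₁ - g.1))) := by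
    field_simp
    ring
  rw [hc]
  have h0 : ((0, 0) : ℝ × JGroup V) = 0 := rfl
  rw [h0]
  push_cast
  ring

theorem integral_starRescaled_zero (hω : ω₀.Nondegenerate) (ha : ω₀.IsAlt) (θ ε : ℝ) (n : ℕ)
    (F : 𝓢(ℝ, ℂ)) (h : 𝓢(V × ℝ, ℂ)) (g : JGroup V) (χ : 𝓢(JGroup V × JGroup V, ℂ))
    (hχ : χ 0 = 1) (k : ℝ) :
    ∫ m, starRescaled ω₀ θ ε n F h g χ k 0 m ∂((volume : Measure ℝ).prod (haarS ω₀)) =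
      (|k| ^ (2 * n + 1) : ℝ) * ∫ a₁ : ℝ, (2 * Real.cosh (2 * (a₁ - g.1)) : ℝ) *
        F (Real.sinh (2 * a₁)) * ∫ l : ℝ, Complex.exp (-(2 * Complex.I / (θ : ℂ)) *
          (ε * (Real.sinh (2 * (a₁ - g.1)) * (l - g.2.2)) : ℝ)) * h (g.2.1, l) := by
  have := isAddHaarMeasure_liouville hω
  have := isAddHaarMeasure_liouville_prod hω
  rw [integral_prod_haarS hω (integrable_starRescaled hω θ ε n F h g χ k 0), ← integral_const_mul]
  congr 1
  funext a₁
  have hP : Integrable (fun η : V × ℝ => partialSympl ω₀ χ 0 η) ((liouville ω₀).prod volume) := by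
    obtain ⟨C, -, hC⟩ := exists_norm_partialSympl_le hω χ
    exact ((integrable_decayWeight ((liouville ω₀).prod (volume : Measure ℝ))).const_mul C).mono'
      ((continuous_partialSympl hω χ).comp (Continuous.prodMk_right 0)).aestronglyMeasurable
      (Eventually.of_forall (hC 0))
  set Q : ℝ → ℂ := fun l => Complex.exp (-(2 * Complex.I / (θ : ℂ)) *
          (ε * (Real.sinh (2 * (a₁ - g.1)) * (l - g.2.2)) : ℝ)) * h (g.2.1, l) with hQ
  set c : ℂ := (|k| ^ (2 * n + 1) : ℝ) *
    ((2 * Real.cosh (2 * (a₁ - g.1)) : ℝ) * F (Real.sinh (2 * a₁))) with hc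
  have e : ∀ s, ∫ y, starRescaled ω₀ θ ε n F h g χ k 0 (a₁, (s, y)) ∂((liouville ω₀).prod volume) =
      (∫ z, partialSympl ω₀ χ 0 (z, s) ∂(liouville ω₀)) * (c * ∫ l, Q l) := by
    intro s
    have e1 : ∀ y : V × ℝ, starRescaled ω₀ θ ε n F h g χ k 0 (a₁, (s, y)) =
        c * (partialSympl ω₀ χ 0 (y.1, s) * Q y.2) :=
      fun y => starRescaled_zero ha θ ε n F h g χ k a₁ s y.2 y.1
    simp only [e1]
    rw [integral_const_mul,
      integral_prod_mul (μ := liouville ω₀) (ν := (volume : Measure ℝ))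
        (fun z => partialSympl ω₀ χ 0 (z, s)) Q]
    ring
  simp only [e]
  rw [integral_mul_const, ← integral_prod_symm _ hP, integral_partialSympl_zero hω χ, hχ, one_mul,
    hc]
  ring

/-- If `sinh(2(t - a)) = εθξ/2`, then `t` is the shift of `a` for the frequency `ξ`. -/
theorem shiftA_sinh {θ ε : ℝ} (hθ : 0 < θ) (hε : ε = 1 ∨ ε = -1) (a t : ℝ) :
    shiftA θ ε a (2 * ε / θ * Real.sinh (2 * (t - a))) = t := by
  have hε2 : ε ^ 2 = 1 := by rcases hε with rfl | rfl <;> norm_num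
  have e1 : 1 + θ ^ 2 * (2 * ε / θ * Real.sinh (2 * (t - a))) ^ 2 / 4 =
      Real.cosh (2 * (t - a)) ^ 2 := by
    rw [Real.cosh_sq]
    field_simp
    linear_combination 4 * (Real.sinh (2 * (t - a))) ^ 2 * hε2
  have e2 : 1 + Real.sinh (2 * a) ^ 2 = Real.cosh (2 * a) ^ 2 := by rw [Real.cosh_sq]; ring
  have e3 : ε * θ * (2 * ε / θ * Real.sinh (2 * (t - a))) / 2 = Real.sinh (2 * (t - a)) := by
    field_simp
    linear_combination (Real.sinh (2 * (t - a))) * hε2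
  have e4 : Real.sinh (2 * a) * Real.cosh (2 * (t - a)) + Real.sinh (2 * (t - a)) *
      Real.cosh (2 * a) = Real.sinh (2 * t) := by
    rw [show 2 * t = 2 * a + 2 * (t - a) by ring, Real.sinh_add]
    ring
  rw [shiftA, e1, e2, e3, Real.sqrt_sq (Real.cosh_pos _).le, Real.sqrt_sq (Real.cosh_pos _).le, e4,
    Real.arsinh_sinh]
  ring

omit [FiniteDimensional ℝ V] [MeasurableSpace V] [BorelSpace V] in
/-- The substitution `ξ = (2ε/θ) sinh(2(a₁ - a))`. -/
theorem twist_eq_integral {θ ε : ℝ} (hθ : 0 < θ) (hε : ε = 1 ∨ ε = -1) (F : 𝓢(ℝ, ℂ))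
    (h : 𝓢(V × ℝ, ℂ)) (g : JGroup V) :
    twist θ ε (fun g => F (Real.sinh (2 * g.1)) * h g.2) g =
      1 / ((Real.pi * θ : ℝ) : ℂ) * ∫ a₁ : ℝ, (2 * Real.cosh (2 * (a₁ - g.1)) : ℝ) *
        F (Real.sinh (2 * a₁)) * ∫ l : ℝ, Complex.exp (-(2 * Complex.I / (θ : ℂ)) *
          (ε * (Real.sinh (2 * (a₁ - g.1)) * (l - g.2.2)) : ℝ)) * h (g.2.1, l) := by
  have hε0 : ε ≠ 0 := by rcases hε with rfl | rfl <;> norm_num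
  have hεa : |ε| = 1 := by rcases hε with rfl | rfl <;> norm_num
  have hθ0 : (θ : ℂ) ≠ 0 := Complex.ofReal_ne_zero.2 hθ.ne'
  have hπ0 : (Real.pi : ℂ) ≠ 0 := Complex.ofReal_ne_zero.2 Real.pi_ne_zero
  rw [twist, integral_eq_integral_sinh_two_mul (K := 2 * ε / θ) (by positivity) g.1]
  rw [← integral_const_mul, ← integral_const_mul]
  congr 1
  funext t
  rw [shiftA_sinh hθ hε]
  have hJ : |2 * (2 * ε / θ) * Real.cosh (2 * (t - g.1))| = 4 / θ * Real.cosh (2 * (t - g.1)) := by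
    rw [abs_mul, abs_mul, abs_div, abs_mul, hεa, abs_of_pos hθ, abs_of_pos (Real.cosh_pos _),
      abs_two]
    ring
  rw [hJ, partialFourier, Complex.real_smul]
  have hl : (∫ l : ℝ, Complex.exp (-(Complex.I * (l : ℂ) *
      ((2 * ε / θ * Real.sinh (2 * (t - g.1)) : ℝ) : ℂ))) *
      (F (Real.sinh (2 * t)) * h (g.2.1, l))) *
      Complex.exp (Complex.I * (g.2.2 : ℂ) * ((2 * ε / θ * Real.sinh (2 * (t - g.1)) : ℝ) : ℂ)) =
      F (Real.sinh (2 * t)) * ∫ l : ℝ, Complex.exp (-(2 * Complex.I / (θ : ℂ)) *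
          (ε * (Real.sinh (2 * (t - g.1)) * (l - g.2.2)) : ℝ)) * h (g.2.1, l) := by
    rw [← integral_mul_const, ← integral_const_mul]
    congr 1
    funext l
    have : Complex.exp (-(2 * Complex.I / (θ : ℂ)) *
        (ε * (Real.sinh (2 * (t - g.1)) * (l - g.2.2)) : ℝ)) =
        Complex.exp (-(Complex.I * (l : ℂ) * ((2 * ε / θ * Real.sinh (2 * (t - g.1)) : ℝ) : ℂ))) *
        Complex.exp (Complex.I * (g.2.2 : ℂ) *
          ((2 * ε / θ * Real.sinh (2 * (t - g.1)) : ℝ) : ℂ)) := by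
      rw [← Complex.exp_add]
      congr 1
      push_cast
      ring
    rw [this]
    ring
  rw [hl]
  push_cast
  field_simp
  ring

/-- The star-product of `f` and `h` is the twist of `f ⊗ h`. -/
theorem hasStarProduct_twist (hω : ω₀.Nondegenerate) (ha : ω₀.IsAlt) {n : ℕ}
    (hn : Module.finrank ℝ V = 2 * n) {θ ε : ℝ} (hθ : 0 < θ) (hε : ε = 1 ∨ ε = -1)
    (F : 𝓢(ℝ, ℂ)) (h : 𝓢(V × ℝ, ℂ)) (g : JGroup V) :
    HasStarProduct ω₀ θ ε n (fun g₁ => F (Real.sinh (2 * g₁.1))) (fun g₂ => h g₂.2) g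
      (twist θ ε (fun g => F (Real.sinh (2 * g.1)) * h g.2) g) := by
  refine fun χ hχ => ⟨fun δ hδ => integrable_starIntegrand_mul hω θ ε n F h g χ hδ, ?_⟩
  have hlim := (tendsto_integral_starReduced hω ha hn hθ hε F h g χ).const_mul
    (1 / ((Real.pi * θ : ℝ) : ℂ) ^ (2 * n + 2))
  rw [integral_starRescaled_zero hω ha θ ε n F h g χ hχ] at hlim
  have hk : |Real.pi * θ * ε| = Real.pi * θ := by
    have hεa : |ε| = 1 := by rcases hε with rfl | rfl <;> norm_num
    rw [abs_mul, hεa, mul_one, abs_of_pos (mul_pos Real.pi_pos hθ)]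
  have hc : ((Real.pi * θ : ℝ) : ℂ) ≠ 0 :=
    Complex.ofReal_ne_zero.2 (mul_pos Real.pi_pos hθ).ne'
  rw [hk, Complex.ofReal_pow, ← mul_assoc] at hlim
  have e : 1 / ((Real.pi * θ : ℝ) : ℂ) ^ (2 * n + 2) * ((Real.pi * θ : ℝ) : ℂ) ^ (2 * n + 1) =
      1 / ((Real.pi * θ : ℝ) : ℂ) := by
    field_simp
    ring
  rw [e, ← twist_eq_integral hθ hε] at hlim
  exact hlim

end StarValue

/-! ### The factorization -/

/-- A cut-off function exists; without one, the condition on the star-product would be void. -/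
theorem SchwartzMap.exists_apply_zero_eq_one (E : Type*) [NormedAddCommGroup E] [NormedSpace ℝ E]
    [FiniteDimensional ℝ E] : ∃ χ : 𝓢(E, ℂ), χ 0 = 1 := by
  let b : ContDiffBump (0 : E) := ⟨1, 2, one_pos, one_lt_two⟩
  have h1 : HasCompactSupport fun x => ((b x : ℝ) : ℂ) :=
    b.hasCompactSupport.comp_left Complex.ofReal_zero
  have h2 : ContDiff ℝ ∞ fun x => ((b x : ℝ) : ℂ) := Complex.ofRealCLM.contDiff.comp b.contDiff
  refine ⟨h1.toSchwartzMap h2, ?_⟩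
  change ((b 0 : ℝ) : ℂ) = 1
  rw [b.one_of_mem_closedBall (by simp [b]), Complex.ofReal_one]

section Factorization

variable {V : Type*} [NormedAddCommGroup V] [NormedSpace ℝ V] [FiniteDimensional ℝ V]
  [MeasurableSpace V] [BorelSpace V] {ω₀ : LinearMap.BilinForm ℝ V}

/-- The value of the star-product is unique. -/
theorem HasStarProduct.unique {θ ε : ℝ} {n : ℕ} {f₁ f₂ : JGroup V → ℂ} {g : JGroup V} {z z' : ℂ}
    (h : HasStarProduct ω₀ θ ε n f₁ f₂ g z) (h' : HasStarProduct ω₀ θ ε n f₁ f₂ g z') :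
    z = z' := by
  obtain ⟨χ, hχ⟩ := SchwartzMap.exists_apply_zero_eq_one (JGroup V × JGroup V)
  exact tendsto_nhds_unique (h χ hχ).2 (h' χ hχ).2

/-- The identification of `𝓢(A) ⊗̂ 𝓢(V × ℝ)` with `𝓢(𝕊)`. -/
noncomputable def factorizationEquiv (hω : ω₀.Nondegenerate) (ha : ω₀.IsAlt) :
    CompletedTensor SchwartzA 𝓢(V × ℝ, ℂ) ≃L[ℂ] SchwartzS ω₀ :=
  (completedTensorEquiv schwartzAEquiv).trans (coordEquiv ω₀ hω ha)

omit [MeasurableSpace V] [BorelSpace V] in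
theorem factorizationEquiv_tmul (hω : ω₀.Nondegenerate) (ha : ω₀.IsAlt) (f : SchwartzA)
    (h : 𝓢(V × ℝ, ℂ)) (g : JGroup V) :
    factorizationEquiv hω ha (CompletedTensor.tmul f h) g = f g.1 * h g.2 := by
  change coordEquiv ω₀ hω ha (completedTensorEquiv schwartzAEquiv (CompletedTensor.tmul f h)) g = _
  rw [completedTensorEquiv_tmul, coordEquiv_apply, SchwartzMap.tensor_apply]
  change schwartzAEquiv f (Real.sinh (2 * g.1)) * h g.2 = _
  rw [schwartzAEquiv_apply_sinh]

/-- The operator `φ ↦ twist θ ε φ` on `𝓢(𝕊)`. -/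
noncomputable def twistS (hω : ω₀.Nondegenerate) (ha : ω₀.IsAlt) (θ : ℝ) {ε : ℝ}
    (hε : ε = 1 ∨ ε = -1) (hε' : -ε = 1 ∨ -ε = -1) : SchwartzS ω₀ ≃L[ℂ] SchwartzS ω₀ :=
  ((coordEquiv ω₀ hω ha).symm.trans (twistEquiv V θ hε hε')).trans (coordEquiv ω₀ hω ha)

omit [MeasurableSpace V] [BorelSpace V] in
theorem coordEquiv_twistCLM (hω : ω₀.Nondegenerate) (ha : ω₀.IsAlt) (θ : ℝ) {ε : ℝ}
    (hε : ε = 1 ∨ ε = -1) (φ : SchwartzS ω₀) (g : JGroup V) :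
    coordEquiv ω₀ hω ha (twistCLM V θ hε ((coordEquiv ω₀ hω ha).symm φ)) g = twist θ ε φ g := by
  have h : (fun g => (coordEquiv ω₀ hω ha).symm φ (rCoord g)) = (φ : JGroup V → ℂ) := by
    funext g'
    rw [← coordEquiv_apply ω₀ hω ha, ContinuousLinearEquiv.apply_symm_apply]
  rw [coordEquiv_apply, twistCLM_apply, h]

omit [MeasurableSpace V] [BorelSpace V] in
theorem twistS_apply (hω : ω₀.Nondegenerate) (ha : ω₀.IsAlt) (θ : ℝ) {ε : ℝ}
    (hε : ε = 1 ∨ ε = -1) (hε' : -ε = 1 ∨ -ε = -1) (φ : SchwartzS ω₀) (g : JGroup V) :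
    twistS hω ha θ hε hε' φ g = twist θ ε φ g :=
  coordEquiv_twistCLM hω ha θ hε φ g

omit [MeasurableSpace V] [BorelSpace V] in
theorem twistS_symm_apply (hω : ω₀.Nondegenerate) (ha : ω₀.IsAlt) (θ : ℝ) {ε : ℝ}
    (hε : ε = 1 ∨ ε = -1) (hε' : -ε = 1 ∨ -ε = -1) (φ : SchwartzS ω₀) (g : JGroup V) :
    (twistS hω ha θ hε hε').symm φ g = twist θ (-ε) φ g :=
  coordEquiv_twistCLM hω ha θ hε' φ g

theorem hasStarProduct_twistS (hω : ω₀.Nondegenerate) (ha : ω₀.IsAlt) {n : ℕ}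
    (hn : Module.finrank ℝ V = 2 * n) {θ ε : ℝ} (hθ : 0 < θ) (hε : ε = 1 ∨ ε = -1)
    (hε' : -ε = 1 ∨ -ε = -1) (f : SchwartzA) (h : 𝓢(V × ℝ, ℂ)) (g : JGroup V) :
    HasStarProduct ω₀ θ ε n (fun g₁ => f g₁.1) (fun g₂ => h g₂.2) g
      (twistS hω ha θ hε hε' (factorizationEquiv hω ha (CompletedTensor.tmul f h)) g) := by
  have e : (factorizationEquiv hω ha (CompletedTensor.tmul f h) : JGroup V → ℂ) =
      fun g => schwartzAEquiv f (Real.sinh (2 * g.1)) * h g.2 := by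
    funext g'
    rw [factorizationEquiv_tmul, schwartzAEquiv_apply_sinh]
  have H := hasStarProduct_twist hω ha hn hθ hε (schwartzAEquiv f) h g
  simp only [schwartzAEquiv_apply_sinh] at H e
  rw [twistS_apply, e]
  exact H

end Factorization

theorem mainTheorem9 {V : Type*} [NormedAddCommGroup V] [NormedSpace ℝ V] [FiniteDimensional ℝ V]
    [MeasurableSpace V] [BorelSpace V]
    (ω₀ : LinearMap.BilinForm ℝ V) (hω_alt : ω₀.IsAlt) (hω_nondeg : ω₀.Nondegenerate)
    (n : ℕ) (hn : Module.finrank ℝ V = 2 * n)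
    (θ : ℝ) (hθ : 0 < θ) (ε : ℝ) (hε : ε = 1 ∨ ε = -1) :
    ∃ ι : CompletedTensor SchwartzA 𝓢(V × ℝ, ℂ) ≃L[ℂ] SchwartzS ω₀,
      (∀ (f : SchwartzA) (h : 𝓢(V × ℝ, ℂ)) (g : JGroup V),
        ι (CompletedTensor.tmul f h) g = f g.1 * h g.2) ∧
      ∃ Φ : SchwartzS ω₀ ≃L[ℂ] SchwartzS ω₀,
        (∀ (f : SchwartzA) (h : 𝓢(V × ℝ, ℂ)) (g : JGroup V),
          HasStarProduct ω₀ θ ε n (fun g₁ => f g₁.1) (fun g₂ => h g₂.2) g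
            (Φ (ι (CompletedTensor.tmul f h)) g)) ∧
        (∀ Ψ : SchwartzS ω₀ →L[ℂ] SchwartzS ω₀,
          (∀ (f : SchwartzA) (h : 𝓢(V × ℝ, ℂ)) (g : JGroup V),
            HasStarProduct ω₀ θ ε n (fun g₁ => f g₁.1) (fun g₂ => h g₂.2) g
              (Ψ (ι (CompletedTensor.tmul f h)) g)) →
          Ψ = Φ) ∧
        (∀ (φ : SchwartzS ω₀) (g : JGroup V), Φ φ g = twist θ ε φ g) ∧
        (∀ (φ : SchwartzS ω₀) (g : JGroup V), Φ.symm φ g = twist θ (-ε) φ g) := by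
  have hε' : -ε = 1 ∨ -ε = -1 := by rcases hε with rfl | rfl <;> norm_num
  refine ⟨factorizationEquiv hω_nondeg hω_alt, factorizationEquiv_tmul hω_nondeg hω_alt,
    twistS hω_nondeg hω_alt θ hε hε', hasStarProduct_twistS hω_nondeg hω_alt hn hθ hε hε',
    fun Ψ hΨ => ?_, twistS_apply hω_nondeg hω_alt θ hε hε',
    twistS_symm_apply hω_nondeg hω_alt θ hε hε'⟩
  set κ := coordEquiv ω₀ hω_nondeg hω_alt
  set ι := factorizationEquiv hω_nondeg hω_alt
  set Φ := twistS hω_nondeg hω_alt θ hε hε' with hΦ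
  -- in the coordinates, `Ψ` and `Φ` agree on the pure tensors, which span a dense subspace
  have key : (κ.symm : SchwartzS ω₀ →L[ℂ] 𝓢(JGroup V, ℂ)) ∘L Ψ ∘L (ι : CompletedTensor SchwartzA 𝓢(V × ℝ, ℂ) →L[ℂ] SchwartzS ω₀) =
      (κ.symm : SchwartzS ω₀ →L[ℂ] 𝓢(JGroup V, ℂ)) ∘L (Φ : SchwartzS ω₀ →L[ℂ] SchwartzS ω₀) ∘L
        (ι : CompletedTensor SchwartzA 𝓢(V × ℝ, ℂ) →L[ℂ] SchwartzS ω₀) := by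
    refine CompletedTensor.ext_of_tmul fun f h => ?_
    ext p
    exact (hΨ f h (rInv p)).unique
      (hasStarProduct_twistS hω_nondeg hω_alt hn hθ hε hε' f h (rInv p))
  refine ContinuousLinearMap.ext fun φ => κ.symm.injective ?_
  have h := DFunLike.congr_fun key (ι.symm φ)
  change κ.symm (Ψ (ι (ι.symm φ))) = κ.symm (Φ (ι (ι.symm φ))) at h
  rwa [ι.apply_symm_apply] at h
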